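/- Let $d\ge 1$ and let $D$ be either a nonempty, compact, connected smooth $d$-dimensional Riemannian manifold without boundary, with Riemannian distance $d_D$ and with $\mu_D$ its Riemannian volume normalized to be a probability measure, or the cube $D=[0,1]^d$ with the Euclidean distance $d_D$ and the Lebesgue measure $\mu_D$. Let $\Gamma(D)$ be the set of Borel probability measures on $D\times D$ with both marginals equal to $\mu_D$; the first coordinate is called the label, and each $\eta\in\Gamma(D)$ is disintegrated with respect to it as $\eta=\eta_a\otimes\mu_D$. For $\eta,\gamma\in\Gamma(D)$, a generalized incompressible flow from $\eta$ to $\gamma$ is a Borel probability measure $Q$ on $C([0,1];D)\times D$, whose elements are denoted $(\omega,a)$, such that the law of $a$ is $\mu_D$, the law of $\omega(t)$ is $\mu_D$ for every $t\in[0,1]$, the law of $(a,\omega(0))$ is $\eta$ and the law of $(a,\omega(1))$ is $\gamma$. Define $\bar\delta(\eta,\gamma)\ge 0$ by $$\bar\delta(\eta,\gamma)^2=\inf_Q\int \mathcal A(\omega)\,dQ(\omega,a),\qquad \mathcal A(\omega)=\int_0^1\tfrac12|\dot\omega(t)|^2\,dt \text{ if } \omega \text{ is absolutely continuous},\quad \mathcal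 A(\omega)=+\infty\text{ otherwise},$$ the infimum being over all generalized incompressible flows $Q$ from $\eta$ to $\gamma$. Let $W_2$ be the quadratic Wasserstein distance on Borel probability measures on $D\times D$ for the cost $\tfrac12 d_D(x_1,y_1)^2+\tfrac12 d_D(x_2,y_2)^2$. Then: 1. $\bar\delta$ is finite and $(\Gamma(D),\bar\delta)$ is a complete metric space; 2. $\bar\delta(\eta,\gamma)\ge W_2(\eta,\gamma)$ for all $\eta,\gamma\in\Gamma(D)$, and every $\bar\delta$-convergent sequence converges narrowly to the same limit; 3. for every Borel map $h:D\to D$ with $h_\#\mu_D=\mu_D$ that is injective outside of a $\mu_D$-negligible set, $\bar\delta(\eta\circ h,\gamma\circ h)=\bar\delta(\eta,\gamma)$ for all $\eta,\gamma\in\Gamma(D)$, where $\eta\circ h:=\eta_{h(a)}\otimes\mu_D\in\Gamma(D)$; 4. there is a sequence in $\Gamma(D)$ that converges narrowly to an element of $\Gamma(D)$ but does not converge to it for $\bar\delta$; 5. $(\Gamma(D),\bar\delta)$ is not compact. -/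

import Mathlib

open MeasureTheory ProbabilityTheory Filter Topology
open scoped ENNReal ContDiff Manifold Bundle

noncomputable section

/-! ### The domain and its volume measure -/

/-- The cube `[0,1]^d`, with the Euclidean distance. -/
def unitCube (d : ℕ) : Set (EuclideanSpace ℝ (Fin d)) :=
  {x | ∀ i, x i ∈ Set.Icc (0 : ℝ) 1}

/-- The normalized Riemannian volume of a compact `d`-dimensional Riemannian manifold: the
Riemannian volume is a constant (depending on `d` only) times the `d`-dimensional Hausdorff measure
of the Riemannian distance, and the constant disappears when the total mass is normalized to one. -/
def normalizedVolume (d : ℕ) (D : Type*) [MetricSpace D] [MeasurableSpace D] [BorelSpace D] :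
    Measure D :=
  (μH[(d : ℝ)] (Set.univ : Set D))⁻¹ • (μH[(d : ℝ)] : Measure D)

/-- The pairs `(D, μ)` under consideration, for a compact metric space `D`:
either `D` is a smooth `d`-dimensional manifold without boundary with a smooth Riemannian
metric, whose distance is the Riemannian distance (which is finite, so that `D` is connected),
and `μ` is the normalized volume; or `D` is (isometric to) the cube `[0,1]^d` with the Lebesgue
measure. -/
inductive IsFluidDomain (d : ℕ) (D : Type*) [MetricSpace D] [MeasurableSpace D] [BorelSpace D]
    (μ : Measure D) : Prop
  | riemannian
      [ChartedSpace (EuclideanSpace ℝ (Fin d)) D]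
      [IsManifold (𝓡 d) ∞ D]
      [Bundle.RiemannianBundle (fun x : D => TangentSpace (𝓡 d) x)]
      [IsContMDiffRiemannianBundle (𝓡 d) ∞ (EuclideanSpace ℝ (Fin d))
        (fun x : D => TangentSpace (𝓡 d) x)]
      [IsRiemannianManifold (𝓡 d) D]
      (hμ : μ = normalizedVolume d D) : IsFluidDomain d D μ
  | cube (e : D ≃ᵢ unitCube d)
      (hμ : μ =
        ((volume : Measure (EuclideanSpace ℝ (Fin d))).comap
          ((↑) : unitCube d → EuclideanSpace ℝ (Fin d))).map e.symm) : IsFluidDomain d D μ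

/-! ### Paths and their action -/

/-- The space `Ω(D) = C([0,1]; D)` with its Borel σ-algebra. -/
abbrev PathSpace (D : Type*) [TopologicalSpace D] : Type _ := C(unitInterval, D)

instance (D : Type*) [TopologicalSpace D] : MeasurableSpace (PathSpace D) := borel _

instance (D : Type*) [TopologicalSpace D] : BorelSpace (PathSpace D) := ⟨rfl⟩

/-- The extension of a path to `ℝ`, constant outside `[0,1]`. -/
def PathSpace.extend {D : Type*} [TopologicalSpace D] (c : PathSpace D) : ℝ → D :=
  fun t => c (Set.projIcc (0 : ℝ) 1 zero_le_one t)

/-- The speed `|ċ|(t) = limsup_{s → t} d(c(s), c(t)) / |s - t|`. For an absolutely continuous curve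
it is a limit for almost every `t`, and on a Riemannian manifold or in `ℝ^d` it is then the norm of
the derivative. -/
def metricSpeed {D : Type*} [MetricSpace D] (f : ℝ → D) (t : ℝ) : ℝ≥0∞ :=
  limsup (fun s : ℝ => edist (f s) (f t) / ENNReal.ofReal |s - t|) (𝓝[≠] t)

open Classical in
/-- The action of a path (on the time interval `[0,1]`): `∫₀¹ |ċ|² / 2 dt` if `c` is absolutely
continuous, and `+∞` otherwise. -/
def pathAction {D : Type*} [MetricSpace D] (c : PathSpace D) : ℝ≥0∞ :=
  if AbsolutelyContinuousOnInterval c.extend 0 1 then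
    ∫⁻ t in Set.Icc (0 : ℝ) 1, (metricSpeed c.extend t) ^ 2 / 2
  else ∞

/-! ### Measure-preserving plans and the relaxed distance -/

/-- `Γ(D)`: the probability measures on `D × D` with both marginals equal to `μ`. The first
coordinate is the label `a` and the second one is the position, so that `γ = γ_a ⊗ μ`, and a
measure-preserving map `g` is identified with the image of `μ` under `a ↦ (a, g a)`. -/
@[ext]
structure MPPlan {D : Type*} [MeasurableSpace D] (μ : Measure D) where
  /-- the underlying probability measure -/
  plan : ProbabilityMeasure (D × D)
  map_fst : (plan : Measure (D × D)).map Prod.fst = μ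
  map_snd : (plan : Measure (D × D)).map Prod.snd = μ

/-- `Q` is a generalized incompressible flow connecting the plans `η` and `γ`: a probability measure
on `Ω(D) × D` whose second marginal is `μ`, with `(e_t)_# Q = μ` for all `t`, and such that the
joint law of the label and of the position is `η` at time `0` and `γ` at time `1`. -/
structure IsGeneralizedFlow {D : Type*} [MetricSpace D] [MeasurableSpace D] {μ : Measure D}
    (η γ : MPPlan μ) (Q : Measure (PathSpace D × D)) : Prop where
  isProb : IsProbabilityMeasure Q
  label : Q.map Prod.snd = μ
  incompressible : ∀ t : unitInterval, Q.map (fun p => p.1 t) = μ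
  initial : Q.map (fun p => (p.2, p.1 0)) = (η.plan : Measure (D × D))
  final : Q.map (fun p => (p.2, p.1 1)) = (γ.plan : Measure (D × D))

/-- The relaxed distance, as a number in `[0,∞]`: its square is the infimum of the action among the
generalized incompressible flows connecting `η` to `γ`. -/
def relaxedDist {D : Type*} [MetricSpace D] [MeasurableSpace D] {μ : Measure D}
    (η γ : MPPlan μ) : ℝ≥0∞ :=
  (⨅ (Q : Measure (PathSpace D × D)) (_ : IsGeneralizedFlow η γ Q),
    ∫⁻ p, pathAction p.1 ∂Q) ^ (1 / 2 : ℝ)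

/-- The quadratic Wasserstein distance on probability measures on `D × D`, for the cost
`d(x₁,y₁)²/2 + d(x₂,y₂)²/2`. -/
def wasserstein₂ {D : Type*} [MetricSpace D] [MeasurableSpace D]
    (P P' : ProbabilityMeasure (D × D)) : ℝ≥0∞ :=
  (⨅ (P₀ : Measure ((D × D) × (D × D))) (_ : P₀.map Prod.fst = P)
      (_ : P₀.map Prod.snd = P'),
    ∫⁻ z, edist z.1.1 z.2.1 ^ 2 / 2 + edist z.1.2 z.2.2 ^ 2 / 2 ∂P₀) ^ (1 / 2 : ℝ)

/-- `S^i(D)`: the Borel maps `h : D → D` preserving `μ` which are injective outside of a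
`μ`-negligible set. -/
structure IsEssInjMeasurePreserving {D : Type*} [MeasurableSpace D] (μ : Measure D)
    (h : D → D) : Prop where
  measurePreserving : MeasurePreserving h μ μ
  essInjective : ∃ s ∈ ae μ, Set.InjOn h s

namespace MPPlan

variable {D : Type*} [MeasurableSpace D] {μ : Measure D}

theorem isProbabilityMeasure (η : MPPlan μ) : IsProbabilityMeasure μ := by
  rw [← η.map_fst]
  exact Measure.isProbabilityMeasure_map measurable_fst.aemeasurable

variable [StandardBorelSpace D] [Nonempty D]

/-- The measure `η_{h(a)} ⊗ μ`, where `η = η_a ⊗ μ` is the disintegration of `η` with respect to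
the first coordinate. -/
def rightCompMeasure (η : MPPlan μ) (h : D → D) (hh : MeasurePreserving h μ μ) :
    Measure (D × D) :=
  μ ⊗ₘ ((η.plan : Measure (D × D)).condKernel.comap h hh.measurable)

theorem rightCompMeasure_fst (η : MPPlan μ) (h : D → D) (hh : MeasurePreserving h μ μ) :
    (η.rightCompMeasure h hh).map Prod.fst = μ := by
  have := η.isProbabilityMeasure
  exact Measure.fst_compProd μ _

theorem rightCompMeasure_snd (η : MPPlan μ) (h : D → D) (hh : MeasurePreserving h μ μ) :
    (η.rightCompMeasure h hh).map Prod.snd = μ := by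
  have := η.isProbabilityMeasure
  have hdis : μ ⊗ₘ (η.plan : Measure (D × D)).condKernel = (η.plan : Measure (D × D)) := by
    have := Measure.disintegrate (η.plan : Measure (D × D)) (η.plan : Measure (D × D)).condKernel
    rwa [show (η.plan : Measure (D × D)).fst = μ from η.map_fst] at this
  ext s hs
  have key : ∀ κ : Kernel D D, IsMarkovKernel κ →
      (μ ⊗ₘ κ).map Prod.snd s = ∫⁻ a, κ a s ∂μ := by
    intro κ _
    rw [Measure.map_apply measurable_snd hs, Measure.compProd_apply (measurable_snd hs)]
    rfl
  rw [rightCompMeasure, key _ inferInstance]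
  simp only [Kernel.comap_apply]
  rw [hh.lintegral_comp ((η.plan : Measure (D × D)).condKernel.measurable_coe hs),
    ← key _ inferInstance, hdis, η.map_snd]

/-- The action of a measure-preserving map on `Γ(D)` by right composition: `η ∘ h` is
`η_{h(a)} ⊗ μ`. -/
def rightComp (η : MPPlan μ) (h : D → D) (hh : MeasurePreserving h μ μ) : MPPlan μ where
  plan := ⟨η.rightCompMeasure h hh, by
    have := η.isProbabilityMeasure
    unfold rightCompMeasure
    infer_instance⟩
  map_fst := η.rightCompMeasure_fst h hh
  map_snd := η.rightCompMeasure_snd h hh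

end MPPlan

end

/-! ### Speed bounds and the action of a path -/

/-! Much rests on the action being lower semicontinuous with compact sublevels. It is the supremum,
over disjoint families of intervals, of the energies of the increments
(`pathAction_eq_discreteEnergy`), and paths of bounded action share a Hölder modulus, so
Arzelà–Ascoli applies (`isCompact_pathAction_le`). By Prokhorov, near-optimal flows between narrowly
convergent plans have a limit flow, so bounds on `relaxedDist` pass to narrow limits
(`relaxedDist_le_of_tendsto`). Plans are narrowly compact; a Cauchy sequence therefore has a narrow
cluster point, which this semicontinuity turns into a limit for the distance.

The metric axioms come from operations on flows: rest, time reversal and, for the triangle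
inequality, gluing two flows along the joint law of label and position. Separation and narrow
convergence come from `sq_integral_sub_le_relaxedCost`: a flow does not move labels, so the change
of `∫ F` is controlled by the Lipschitz constant of `F` in the position alone. The endpoints of a
flow form a coupling, whence the Wasserstein bound. For right invariance, labels are pushed forward
by `h` in one direction, and the disintegration of the flow is composed with `h` in the other.

Finiteness is the substantial point. Every plan is joined to the product plan, by mixing. In a
Lipschitz image of a torus, particles moved along straight lines with a uniform random displacement
stay uniformly distributed at all times, and their final position is independent of the label
(`exists_torus_move`). The domain is covered by finitely many such images (the folded cube, or
bi-Lipschitz charts) with a connected overlap graph, so finitely many moves lead, at bounded cost,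
to a plan dominating `ε μ ⊗ μ`. Repeating this on the remaining fraction `q = 1 - ε` multiplies the
distance by `q ^ (1/2)` at each turn; the series is geometric and semicontinuity gives the bound
(`exists_relaxedDist_le_of_smul_le`).

For the two negative statements, the plans with density `1 + s n a * φ x`, where `s n` oscillates,
converge narrowly to the product. The test function `s n a * φ x` is Lipschitz in `x` uniformly in
`n` and keeps them at a fixed distance from it. A convergent subsequence would have the product as
its limit, so there is no compactness. -/

theorem sq_lintegral_le {α : Type*} [MeasurableSpace α] (ν : Measure α) {g : α → ℝ≥0∞}
    (hg : AEMeasurable g ν) : (∫⁻ u, g u ∂ν) ^ 2 ≤ ν Set.univ * ∫⁻ u, g u ^ 2 ∂ν := by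
  have h := ENNReal.lintegral_mul_le_Lp_mul_Lq ν
    (Real.HolderConjugate.two_two) (f := fun _ => 1) (g := g) aemeasurable_const hg
  have h2 : ∫⁻ u, g u ∂ν ≤ (ν Set.univ) ^ (1 / 2 : ℝ) * (∫⁻ u, g u ^ 2 ∂ν) ^ (1 / 2 : ℝ) := by
    simpa using h
  calc (∫⁻ u, g u ∂ν) ^ 2
      ≤ ((ν Set.univ) ^ (1 / 2 : ℝ) * (∫⁻ u, g u ^ 2 ∂ν) ^ (1 / 2 : ℝ)) ^ 2 := by gcongr
    _ = ν Set.univ * ∫⁻ u, g u ^ 2 ∂ν := by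
      rw [mul_pow, ← ENNReal.rpow_natCast, ← ENNReal.rpow_natCast, ← ENNReal.rpow_mul,
        ← ENNReal.rpow_mul]
      norm_num

theorem sq_setLIntegral_le {g : ℝ → ℝ≥0∞} (hg : Measurable g) (s : Set ℝ) :
    (∫⁻ u in s, g u) ^ 2 ≤ volume s * ∫⁻ u in s, g u ^ 2 := by
  simpa using sq_lintegral_le (volume.restrict s) hg.aemeasurable

/-- `g` controls the increments of the curve `f`. -/
def IsSpeedBound {D : Type*} [MetricSpace D] (f : ℝ → D) (g : ℝ → ℝ≥0∞) : Prop :=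
  Measurable g ∧ ∀ s t, s ≤ t → edist (f s) (f t) ≤ ∫⁻ u in Set.Ioc s t, g u

section
variable {D : Type*} [MetricSpace D]

theorem IsSpeedBound.edist_le_uIoc {f : ℝ → D} {g : ℝ → ℝ≥0∞} (h : IsSpeedBound f g) (s t : ℝ) :
    edist (f s) (f t) ≤ ∫⁻ u in Set.uIoc s t, g u := by
  rcases le_total s t with hst | hst
  · rw [Set.uIoc_of_le hst]; exact h.2 s t hst
  · rw [Set.uIoc_of_ge hst, edist_comm]; exact h.2 t s hst

/-- The sum of the increments over disjoint intervals is at most the integral of `g` over their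
union, which is small when the total length is, by absolute continuity of the integral. -/
theorem IsSpeedBound.absolutelyContinuousOnInterval {f : ℝ → D} {g : ℝ → ℝ≥0∞}
    (h : IsSpeedBound f g) (hg : ∫⁻ u in Set.Icc (0 : ℝ) 1, g u ≠ ⊤) :
    AbsolutelyContinuousOnInterval f 0 1 := by
  have hg' : ∫⁻ u in Set.uIoc (0 : ℝ) 1, g u ≠ ⊤ := by
    rw [Set.uIoc_of_le zero_le_one]
    exact ne_top_of_le_ne_top hg (lintegral_mono_set Set.Ioc_subset_Icc_self)
  have key := tendsto_setLIntegral_zero hg'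
    (AbsolutelyContinuousOnInterval.tendsto_volume_restrict_totalLengthFilter_disjWithin_nhds_zero
      0 1)
  have key' := ENNReal.toReal_zero ▸ (ENNReal.continuousAt_toReal (by simp)).tendsto.comp key
  refine squeeze_zero' ?_ ?_ key'
  · filter_upwards with E
    exact Finset.sum_nonneg (fun _ _ ↦ dist_nonneg)
  · have hmem : ∀ᶠ E in AbsolutelyContinuousOnInterval.totalLengthFilter ⊓
        𝓟 (AbsolutelyContinuousOnInterval.disjWithin 0 1),
        E ∈ AbsolutelyContinuousOnInterval.disjWithin 0 1 :=
      Filter.mem_inf_of_right (mem_principal_self _)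
    filter_upwards [hmem] with E hE
    simp only [Function.comp]
    have hfin : ∫⁻ x in ⋃ i ∈ Finset.range E.1, Set.uIoc (E.2 i).1 (E.2 i).2,
        g x ∂volume.restrict (Set.uIoc 0 1) ≠ ⊤ :=
      ne_top_of_le_ne_top hg' (setLIntegral_le_lintegral _ _)
    have : ∑ i ∈ Finset.range E.1, edist (f (E.2 i).1) (f (E.2 i).2) ≤
        ∫⁻ x in ⋃ i ∈ Finset.range E.1, Set.uIoc (E.2 i).1 (E.2 i).2,
        g x ∂volume.restrict (Set.uIoc 0 1) := by
      rw [lintegral_biUnion_finset hE.2 (fun i _ => measurableSet_uIoc)]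
      refine Finset.sum_le_sum fun i hi => ?_
      rw [Measure.restrict_restrict measurableSet_uIoc, Set.inter_eq_left.mpr]
      · exact h.edist_le_uIoc _ _
      · exact AbsolutelyContinuousOnInterval.uIoc_subset_of_mem_disjWithin
          (n := E.1) (I := E.2) hE (Finset.mem_range.mp hi)
    have h2 := ENNReal.toReal_mono hfin this
    rw [ENNReal.toReal_sum (fun i _ => edist_ne_top _ _)] at h2
    simpa only [dist_edist] using h2

/-- Lebesgue differentiation: the difference quotients of the primitive of `g` dominate those of `f`
and converge to `g t` at almost every `t`. -/
theorem IsSpeedBound.metricSpeed_le {f : ℝ → D} {g : ℝ → ℝ≥0∞}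
    (h : IsSpeedBound f g) (hg : ∫⁻ u in Set.Icc (0 : ℝ) 1, g u ≠ ⊤) :
    ∀ᵐ t ∂(volume.restrict (Set.Icc (0 : ℝ) 1)), metricSpeed f t ≤ g t := by
  rw [← restrict_Ioo_eq_restrict_Icc] at hg ⊢
  have hg1 : ∫⁻ u in Set.Ioc (0 : ℝ) 1, g u ≠ ⊤ := by rwa [← restrict_Ioo_eq_restrict_Ioc]
  have hfin : ∀ᵐ t ∂(volume.restrict (Set.Ioo (0 : ℝ) 1)), g t < ⊤ :=
    ae_lt_top h.1 hg
  have hfin' : ∀ᵐ t ∂(volume.restrict (Set.Ioc (0 : ℝ) 1)), g t < ⊤ :=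
    ae_lt_top h.1 hg1
  have hint : IntervalIntegrable (fun u => (g u).toReal) volume 0 1 := by
    rw [intervalIntegrable_iff_integrableOn_Ioc_of_le zero_le_one]
    exact integrable_toReal_of_lintegral_ne_top h.1.aemeasurable hg1
  have hder := hint.ae_hasDerivAt_integral
  rw [ae_restrict_iff' measurableSet_Ioo] at hfin ⊢
  filter_upwards [hder, hfin] with t ht hft htm
  have hft := hft htm
  have htI : t ∈ Set.uIcc (0 : ℝ) 1 := by
    rw [Set.uIcc_of_le zero_le_one]; exact Set.Ioo_subset_Icc_self htm
  have hd := ht htI 0 (by simp)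
  rw [hasDerivAt_iff_tendsto_slope] at hd
  have hd2 : Tendsto (fun s => ENNReal.ofReal |slope (fun x => ∫ u in (0 : ℝ)..x, (g u).toReal) t s|)
      (𝓝[≠] t) (𝓝 (g t)) := by
    have := ENNReal.tendsto_ofReal hd.abs
    rwa [abs_of_nonneg ENNReal.toReal_nonneg, ENNReal.ofReal_toReal hft.ne] at this
  rw [← hd2.limsup_eq]
  refine limsup_le_limsup ?_
  have hnear : ∀ᶠ s in 𝓝[≠] t, s ∈ Set.Ioo (0 : ℝ) 1 :=
    mem_nhdsWithin_of_mem_nhds (Ioo_mem_nhds htm.1 htm.2)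
  filter_upwards [hnear, self_mem_nhdsWithin] with s hs hst
  have hst' : s ≠ t := hst
  rw [slope_def_field, abs_div, ENNReal.ofReal_div_of_pos (abs_pos.mpr (sub_ne_zero.mpr hst'))]
  gcongr
  have hii : ∀ {a b : ℝ}, a ∈ Set.Ioo (0 : ℝ) 1 → b ∈ Set.Ioo (0 : ℝ) 1 →
      IntervalIntegrable (fun u => (g u).toReal) volume a b := fun {a b} ha hb =>
    hint.mono_set (by
      rw [Set.uIcc_of_le zero_le_one]
      exact (Set.ordConnected_Icc).uIcc_subset (Set.Ioo_subset_Icc_self ha)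
        (Set.Ioo_subset_Icc_self hb))
  have h0 : ∀ {b : ℝ}, b ∈ Set.Ioo (0 : ℝ) 1 →
      IntervalIntegrable (fun u => (g u).toReal) volume 0 b := fun {b} hb =>
    hint.mono_set (by
      rw [Set.uIcc_of_le zero_le_one, Set.uIcc_of_le hb.1.le]
      exact Set.Icc_subset_Icc_right hb.2.le)
  rw [intervalIntegral.integral_interval_sub_left (h0 hs) (h0 htm)]
  have hsub : Set.uIoc t s ⊆ Set.Ioc 0 1 := by
    intro x hx
    rw [Set.mem_uIoc] at hx
    rcases hx with hx | hx
    · exact ⟨htm.1.trans hx.1, hx.2.trans hs.2.le⟩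
    · exact ⟨hs.1.trans hx.1, hx.2.trans htm.2.le⟩
  refine (edist_comm (f s) (f t) ▸ h.edist_le_uIoc t s).trans ?_
  rw [intervalIntegral.abs_intervalIntegral_eq, integral_toReal h.1.aemeasurable
    (ae_mono (Measure.restrict_mono_set _ hsub) hfin'), abs_of_nonneg ENNReal.toReal_nonneg,
    ENNReal.ofReal_toReal (ne_top_of_le_ne_top hg1 (lintegral_mono_set hsub))]

-- With `exists_isSpeedBound`, this reduces operations on paths to operations on speed bounds. A
-- finite energy makes `g` integrable by Cauchy–Schwarz, so both preceding lemmas apply.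
open Classical in
theorem pathAction_le_of_isSpeedBound {c : PathSpace D} {g : ℝ → ℝ≥0∞}
    (h : IsSpeedBound c.extend g) :
    pathAction c ≤ ∫⁻ u in Set.Icc (0 : ℝ) 1, g u ^ 2 / 2 := by
  by_cases hfin : ∫⁻ u in Set.Icc (0 : ℝ) 1, g u ^ 2 / 2 = ⊤
  · rw [hfin]; exact le_top
  have h1 : ∫⁻ u in Set.Icc (0 : ℝ) 1, g u ≠ ⊤ := by
    intro htop
    have := sq_setLIntegral_le h.1 (Set.Icc (0 : ℝ) 1)
    simp only [htop, Real.volume_Icc, sub_zero, ENNReal.ofReal_one, one_mul] at this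
    apply hfin
    simp only [div_eq_mul_inv]
    rw [lintegral_mul_const _ (h.1.pow_const 2),
      show ∫⁻ u in Set.Icc (0 : ℝ) 1, g u ^ 2 = ⊤ from top_le_iff.mp (by simpa using this)]
    simp
  rw [pathAction, if_pos (h.absolutelyContinuousOnInterval h1)]
  refine lintegral_mono_ae ?_
  filter_upwards [h.metricSpeed_le h1] with t ht
  gcongr

/-- The distance to a point is 1-Lipschitz. Where it is not differentiable along `f`, `deriv` is
zero and nothing is to be proved. -/
theorem enorm_deriv_dist_le_metricSpeed (f : ℝ → D) (x : D) (t : ℝ) :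
    ‖deriv (fun u => dist x (f u)) t‖ₑ ≤ metricSpeed f t := by
  by_cases hd : DifferentiableAt ℝ (fun u => dist x (f u)) t
  · have h := hd.hasDerivAt
    rw [hasDerivAt_iff_tendsto_slope] at h
    have h2 := h.enorm
    rw [← h2.limsup_eq]
    refine limsup_le_limsup ?_
    filter_upwards [self_mem_nhdsWithin] with s hs
    have hst' : s ≠ t := hs
    rw [slope_def_field, Real.enorm_eq_ofReal_abs, abs_div,
      ENNReal.ofReal_div_of_pos (abs_pos.mpr (sub_ne_zero.mpr hst'))]
    gcongr
    rw [edist_dist]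
    exact ENNReal.ofReal_le_ofReal (by
      rw [dist_comm x, dist_comm x]; exact abs_dist_sub_le _ _ _)
  · rw [deriv_zero_of_not_differentiableAt hd]
    simp

theorem AbsolutelyContinuousOnInterval.dist_left {f : ℝ → D} {a b : ℝ}
    (h : AbsolutelyContinuousOnInterval f a b) (x : D) :
    AbsolutelyContinuousOnInterval (fun u => dist x (f u)) a b := by
  refine squeeze_zero (fun E => Finset.sum_nonneg (fun _ _ ↦ dist_nonneg)) (fun E => ?_) h
  refine Finset.sum_le_sum fun i _ => ?_
  simp only [Real.dist_eq, dist_comm x]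
  exact abs_dist_sub_le _ _ _

theorem PathSpace.extend_eq_min_max (c : PathSpace D) (t : ℝ) :
    c.extend t = c.extend (max 0 (min 1 t)) := by
  simp only [PathSpace.extend]
  congr 1
  ext
  simp only [Set.coe_projIcc]
  rcases le_total t 1 with h1 | h1 <;> rcases le_total 0 t with h2 | h2 <;> simp [h1, h2]

theorem PathSpace.continuous_extend (c : PathSpace D) : Continuous c.extend :=
  c.continuous.comp continuous_projIcc

/-- The largest speed of the distances to the points of a dense sequence. -/
noncomputable def denseSpeed [CompactSpace D] [Nonempty D] (f : ℝ → D) (t : ℝ) : ℝ≥0∞ :=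
  ⨆ n, ‖deriv (fun u => dist (TopologicalSpace.denseSeq D n) (f u)) t‖ₑ

theorem denseSpeed_le_metricSpeed [CompactSpace D] [Nonempty D] (f : ℝ → D) (t : ℝ) :
    denseSpeed f t ≤ metricSpeed f t :=
  iSup_le fun _ => enorm_deriv_dist_le_metricSpeed f _ t

theorem measurable_denseSpeed [CompactSpace D] [Nonempty D] (f : ℝ → D) :
    Measurable (denseSpeed f) :=
  Measurable.iSup fun _ => (measurable_deriv _).enorm

theorem edist_eq_iSup_denseSeq [CompactSpace D] [Nonempty D] (x y : D) :
    edist x y ≤ ⨆ n, ENNReal.ofReal |dist (TopologicalSpace.denseSeq D n) y -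
      dist (TopologicalSpace.denseSeq D n) x| := by
  refine ENNReal.le_of_forall_pos_le_add fun ε hε _ => ?_
  obtain ⟨n, hn⟩ := (TopologicalSpace.denseRange_denseSeq D).exists_dist_lt x
    (ε := ε / 2) (by positivity)
  refine le_trans ?_ (add_le_add_left (le_iSup _ n) _)
  rw [edist_dist, ← ENNReal.ofReal_coe_nnreal (p := ε), ← ENNReal.ofReal_add (abs_nonneg _) ε.coe_nonneg]
  refine ENNReal.ofReal_le_ofReal ?_
  have h1 := dist_triangle x (TopologicalSpace.denseSeq D n) y
  have h2 := le_abs_self (dist (TopologicalSpace.denseSeq D n) y -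
      dist (TopologicalSpace.denseSeq D n) x)
  rw [dist_comm] at hn
  have h3 := dist_comm x (TopologicalSpace.denseSeq D n)
  linarith

/-- The distance of two points is a supremum of differences of distances to a dense sequence, and
each of these scalar functions is the integral of its derivative. Unlike for `metricSpeed`,
measurability of `denseSpeed` is immediate, as a speed bound requires. -/
theorem AbsolutelyContinuousOnInterval.edist_le_denseSpeed [CompactSpace D] [Nonempty D]
    {f : ℝ → D} {s t : ℝ} (hst : s ≤ t) (h : AbsolutelyContinuousOnInterval f s t) :
    edist (f s) (f t) ≤ ∫⁻ u in Set.Ioc s t, denseSpeed f u := by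
  refine (edist_eq_iSup_denseSeq _ _).trans (iSup_le fun n => ?_)
  rw [← (h.dist_left _).integral_deriv_eq_sub, intervalIntegral.integral_of_le hst,
    ← Real.enorm_eq_ofReal_abs]
  refine (enorm_integral_le_lintegral_enorm _).trans (lintegral_mono fun u => ?_)
  exact le_iSup (fun n => ‖deriv (fun u => dist (TopologicalSpace.denseSeq D n) (f u)) u‖ₑ) n

theorem isSpeedBound_denseSpeed [CompactSpace D] [Nonempty D] {c : PathSpace D}
    (h : AbsolutelyContinuousOnInterval c.extend 0 1) :
    IsSpeedBound c.extend ((Set.Icc (0 : ℝ) 1).indicator (denseSpeed c.extend)) := by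
  refine ⟨(measurable_denseSpeed _).indicator measurableSet_Icc, fun s t hst => ?_⟩
  -- The extended path is constant outside `[0,1]`, so the times can be clamped there; this is why
  -- the indicator suffices.
  rw [c.extend_eq_min_max s, c.extend_eq_min_max t]
  have hle : max 0 (min 1 s) ≤ max 0 (min 1 t) := by gcongr
  refine ((h.mono ?_).edist_le_denseSpeed hle).trans ?_
  · rw [Set.uIcc_of_le hle, Set.uIcc_of_le zero_le_one]
    exact Set.Icc_subset_Icc (by simp) (by simp)
  · rw [lintegral_indicator measurableSet_Icc, Measure.restrict_restrict measurableSet_Icc]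
    refine lintegral_mono_set fun x hx => ?_
    simp only [Set.mem_Ioc, max_lt_iff, le_max_iff, min_lt_iff, le_min_iff] at hx
    simp only [Set.mem_inter_iff, Set.mem_Icc, Set.mem_Ioc]
    grind

theorem exists_isSpeedBound [CompactSpace D] [Nonempty D] {c : PathSpace D}
    (h : pathAction c ≠ ⊤) :
    ∃ g, IsSpeedBound c.extend g ∧ ∫⁻ u, g u ^ 2 / 2 ≤ pathAction c := by
  classical
  by_cases hac : AbsolutelyContinuousOnInterval c.extend 0 1
  · refine ⟨_, isSpeedBound_denseSpeed hac, ?_⟩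
    rw [pathAction, if_pos hac, ← lintegral_indicator measurableSet_Icc]
    refine lintegral_mono fun u => ?_
    by_cases hu : u ∈ Set.Icc (0 : ℝ) 1
    · simp only [Set.indicator_of_mem hu]
      gcongr
      exact denseSpeed_le_metricSpeed _ _
    · simp [Set.indicator_of_notMem hu]
  · exact absurd (by rw [pathAction, if_neg hac]) h

end

/-! ### The action as a supremum over partitions -/

theorem lintegral_biUnion_finset_le {α ι : Type*} [MeasurableSpace α] {μ : Measure α}
    (s : Finset ι) (t : ι → Set α) (f : α → ℝ≥0∞) :
    ∫⁻ x in ⋃ i ∈ s, t i, f x ∂μ ≤ ∑ i ∈ s, ∫⁻ x in t i, f x ∂μ := by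
  classical
  induction s using Finset.induction_on with
  | empty => simp
  | insert a s ha ih =>
    rw [Finset.set_biUnion_insert, Finset.sum_insert ha]
    exact (lintegral_union_le _ _ _).trans (add_le_add_right ih _)

section
variable {D : Type*} [MetricSpace D]

/-- The energy of the increments of `f` on a finite family of intervals. -/
noncomputable def incrementEnergy (f : ℝ → D) (E : ℕ × (ℕ → ℝ × ℝ)) : ℝ≥0∞ :=
  ∑ i ∈ Finset.range E.1,
    edist (f (E.2 i).1) (f (E.2 i).2) ^ 2 / (2 * ENNReal.ofReal (dist (E.2 i).1 (E.2 i).2))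

/-- The supremum of the energies of the increments on disjoint families of intervals. -/
noncomputable def discreteEnergy (f : ℝ → D) : ℝ≥0∞ :=
  ⨆ E ∈ AbsolutelyContinuousOnInterval.disjWithin 0 1, incrementEnergy f E

theorem incrementEnergy_le_discreteEnergy (f : ℝ → D) {E : ℕ × (ℕ → ℝ × ℝ)}
    (hE : E ∈ AbsolutelyContinuousOnInterval.disjWithin 0 1) :
    incrementEnergy f E ≤ discreteEnergy f := by
  rw [discreteEnergy]
  exact le_iSup₂_of_le E hE le_rfl

/-- Cauchy–Schwarz on each interval, then disjointness. -/
theorem IsSpeedBound.incrementEnergy_le {f : ℝ → D} {g : ℝ → ℝ≥0∞} (h : IsSpeedBound f g)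
    {E : ℕ × (ℕ → ℝ × ℝ)} (hE : E ∈ AbsolutelyContinuousOnInterval.disjWithin 0 1) :
    incrementEnergy f E ≤ ∫⁻ u, g u ^ 2 / 2 := by
  refine le_trans ?_ (setLIntegral_le_lintegral
    (⋃ i ∈ Finset.range E.1, Set.uIoc (E.2 i).1 (E.2 i).2) _)
  rw [lintegral_biUnion_finset hE.2 (fun i _ => measurableSet_uIoc), incrementEnergy]
  refine Finset.sum_le_sum fun i _ => ENNReal.div_le_of_le_mul ?_
  have hv : volume (Set.uIoc (E.2 i).1 (E.2 i).2) =
      ENNReal.ofReal (dist (E.2 i).1 (E.2 i).2) := by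
    rw [Real.volume_uIoc, dist_comm, Real.dist_eq]
  simp only [div_eq_mul_inv]
  rw [lintegral_mul_const _ (h.1.pow_const 2)]
  calc edist (f (E.2 i).1) (f (E.2 i).2) ^ 2
      ≤ (∫⁻ u in Set.uIoc (E.2 i).1 (E.2 i).2, g u) ^ 2 := by
        gcongr; exact h.edist_le_uIoc _ _
    _ ≤ _ := sq_setLIntegral_le h.1 _
    _ = _ := by
      rw [hv, mul_comm, mul_assoc, ← mul_assoc _ 2, ENNReal.inv_mul_cancel (by simp) (by simp),
        one_mul]

/-- Cauchy–Schwarz for sums: the squared total increment is at most twice the total length times the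
discrete energy. -/
theorem absolutelyContinuousOnInterval_of_discreteEnergy_ne_top {f : ℝ → D}
    (h : discreteEnergy f ≠ ⊤) : AbsolutelyContinuousOnInterval f 0 1 := by
  rw [absolutelyContinuousOnInterval_iff]
  intro ε hε
  set e := (discreteEnergy f).toReal
  have he : 0 ≤ e := ENNReal.toReal_nonneg
  -- The `1` keeps the denominator positive when the energy vanishes.
  refine ⟨ε ^ 2 / (2 * (e + 1)), by positivity, fun E hE hlen => ?_⟩
  have hle := incrementEnergy_le_discreteEnergy f hE
  have hsum : ∑ i ∈ Finset.range E.1, dist (f (E.2 i).1) (f (E.2 i).2) ^ 2 /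
      (2 * dist (E.2 i).1 (E.2 i).2) ≤ e := by
    have h1 := ENNReal.toReal_mono h hle
    have hne : ∀ i ∈ Finset.range E.1, edist (f (E.2 i).1) (f (E.2 i).2) ^ 2 /
        (2 * ENNReal.ofReal (dist (E.2 i).1 (E.2 i).2)) ≠ ⊤ := fun i hi =>
      ne_top_of_le_ne_top (ne_top_of_le_ne_top h hle)
        (Finset.single_le_sum (f := fun i => edist (f (E.2 i).1) (f (E.2 i).2) ^ 2 /
        (2 * ENNReal.ofReal (dist (E.2 i).1 (E.2 i).2))) (fun _ _ => zero_le) hi)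
    rw [incrementEnergy, ENNReal.toReal_sum hne] at h1
    simpa [ENNReal.toReal_div, ← dist_edist] using h1
  have hcs := Finset.sum_sq_le_sum_mul_sum_of_sq_le_mul (Finset.range E.1)
    (r := fun i => dist (f (E.2 i).1) (f (E.2 i).2))
    (f := fun i => 2 * dist (E.2 i).1 (E.2 i).2)
    (g := fun i => dist (f (E.2 i).1) (f (E.2 i).2) ^ 2 / (2 * dist (E.2 i).1 (E.2 i).2))
    (fun i _ => by positivity) (fun i _ => by positivity) (fun i _ => by
      by_cases hd : dist (E.2 i).1 (E.2 i).2 = 0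
      · simp [dist_eq_zero.mp hd]
      · field_simp; exact le_rfl)
  rw [← Finset.mul_sum] at hcs
  refine lt_of_pow_lt_pow_left₀ 2 hε.le (hcs.trans_lt ?_)
  rw [lt_div_iff₀ (by positivity)] at hlen
  have hL : 0 ≤ ∑ i ∈ Finset.range E.1, dist (E.2 i).1 (E.2 i).2 :=
    Finset.sum_nonneg fun _ _ => dist_nonneg
  nlinarith

/-- The difference quotient of `f` on the interval of length `1 / (n + 1)` of the uniform grid
which contains `t`. -/
noncomputable def gridSpeed (f : ℝ → D) (n : ℕ) (t : ℝ) : ℝ≥0∞ :=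
  edist (f (⌊(n + 1 : ℝ) * t⌋₊ / (n + 1 : ℝ))) (f ((⌊(n + 1 : ℝ) * t⌋₊ + 1) / (n + 1 : ℝ))) * (n + 1)

theorem measurable_gridSpeed [SecondCountableTopology D] [MeasurableSpace D] [BorelSpace D]
    {f : ℝ → D} (hf : Continuous f) (n : ℕ) : Measurable (gridSpeed f n) := by
  have hfl : Measurable fun t : ℝ => ((⌊(n + 1 : ℝ) * t⌋₊ : ℕ) : ℝ) :=
    measurable_from_top.comp (Nat.measurable_floor.comp (measurable_id.const_mul _))
  refine Measurable.mul_const (Measurable.edist ?_ ?_) _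
  · exact hf.measurable.comp (hfl.div_const _)
  · exact hf.measurable.comp ((hfl.add_const 1).div_const _)

/-- The cell containing `t` straddles it, so the errors of the linear approximation at its two ends
are proportional to `b - t` and `t - a`, which add up to the length of the cell. -/
theorem tendsto_grid_slope {h : ℝ → ℝ} {h' t : ℝ} (ht : 0 ≤ t) (hd : HasDerivAt h h' t) :
    Tendsto (fun n : ℕ => (h ((⌊(n + 1 : ℝ) * t⌋₊ + 1) / (n + 1 : ℝ)) -
      h (⌊(n + 1 : ℝ) * t⌋₊ / (n + 1 : ℝ))) * (n + 1)) atTop (𝓝 h') := by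
  rw [hasDerivAt_iff_isLittleO, Asymptotics.isLittleO_iff] at hd
  rw [Metric.tendsto_nhds]
  intro ε hε
  have hd := hd (c := ε / 2) (by positivity)
  obtain ⟨δ, hδ, hball⟩ := Metric.eventually_nhds_iff.mp hd
  obtain ⟨n₀, hn₀⟩ := exists_nat_one_div_lt hδ
  filter_upwards [eventually_ge_atTop n₀] with n hn
  have hN : (0 : ℝ) < n + 1 := by positivity
  set k := ⌊(n + 1 : ℝ) * t⌋₊
  have hk1 : (k : ℝ) ≤ (n + 1) * t := Nat.floor_le (by positivity)
  have hk2 : (n + 1) * t < k + 1 := Nat.lt_floor_add_one _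
  have ha : (k : ℝ) / (n + 1) ≤ t := by rw [div_le_iff₀ hN]; linarith
  have hb : t < (k + 1 : ℝ) / (n + 1) := by rw [lt_div_iff₀ hN]; linarith
  have hab : (k + 1 : ℝ) / (n + 1) - k / (n + 1) = 1 / (n + 1) := by field_simp; ring
  have hsmall : 1 / ((n : ℝ) + 1) < δ := by
    refine lt_of_le_of_lt ?_ hn₀
    gcongr
  have h1 := hball (y := (k : ℝ) / (n + 1)) (by
    rw [Real.dist_eq, abs_sub_comm, abs_of_nonneg] <;> linarith)
  have h2 := hball (y := (k + 1 : ℝ) / (n + 1)) (by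
    rw [Real.dist_eq, abs_of_nonneg] <;> linarith)
  set a := (k : ℝ) / (n + 1)
  set b := (k + 1 : ℝ) / (n + 1)
  simp only [Real.norm_eq_abs, smul_eq_mul] at h1 h2
  rw [abs_of_nonpos (by linarith : a - t ≤ 0)] at h1
  rw [abs_of_nonneg (by linarith : 0 ≤ b - t)] at h2
  have hN' : (b - a) * (n + 1) = 1 := by rw [hab]; field_simp
  rw [Real.dist_eq]
  have hexp : (h b - h a) * (n + 1) - h' =
      ((h b - h t - (b - t) * h') - (h a - h t - (a - t) * h')) * (n + 1) := by
    linear_combination h' * hN'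
  rw [hexp, abs_mul, abs_of_pos hN]
  calc _ ≤ (ε / 2 * (b - t) + ε / 2 * -(a - t)) * (n + 1) := by
        gcongr
        exact (abs_sub _ _).trans (add_le_add h2 h1)
    _ = ε / 2 := by linear_combination (ε / 2) * hN'
    _ < ε := by linarith

/-- At almost every `t` all the countably many distance functions are differentiable; their grid
slopes converge to the derivatives and are bounded by `gridSpeed`. -/
theorem AbsolutelyContinuousOnInterval.denseSpeed_le_liminf_gridSpeed [CompactSpace D] [Nonempty D]
    {f : ℝ → D} (h : AbsolutelyContinuousOnInterval f 0 1) :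
    ∀ᵐ t ∂(volume.restrict (Set.Icc (0 : ℝ) 1)),
      denseSpeed f t ≤ liminf (fun n => gridSpeed f n t) atTop := by
  have hall : ∀ j, ∀ᵐ t, t ∈ Set.uIcc (0 : ℝ) 1 →
      DifferentiableAt ℝ (fun u => dist (TopologicalSpace.denseSeq D j) (f u)) t :=
    fun j => (h.dist_left _).ae_differentiableAt
  rw [← ae_all_iff] at hall
  rw [ae_restrict_iff' measurableSet_Icc]
  filter_upwards [hall] with t ht htm
  rw [Set.uIcc_of_le zero_le_one] at ht
  refine iSup_le fun j => ?_
  have hs := tendsto_grid_slope htm.1 (ht j htm).hasDerivAt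
  rw [← hs.enorm.liminf_eq]
  refine liminf_le_liminf (Eventually.of_forall fun n => ?_)
  have hn : ‖(n : ℝ) + 1‖ₑ = n + 1 := by
    have : ‖((n + 1 : ℕ) : ℝ)‖ₑ = ((n + 1 : ℕ) : ℝ≥0∞) := by
      rw [Real.enorm_natCast]
    exact_mod_cast this
  rw [enorm_mul, hn, gridSpeed]
  gcongr
  rw [edist_dist, Real.enorm_eq_ofReal_abs]
  refine ENNReal.ofReal_le_ofReal ?_
  rw [abs_sub_comm]
  simp only [dist_comm (TopologicalSpace.denseSeq D j)]
  exact abs_dist_sub_le _ _ _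

theorem grid_mem_disjWithin (n : ℕ) :
    ((n + 1, fun k : ℕ => ((k : ℝ) / (n + 1 : ℝ), (k + 1 : ℝ) / (n + 1 : ℝ))) : ℕ × (ℕ → ℝ × ℝ)) ∈
      AbsolutelyContinuousOnInterval.disjWithin 0 1 := by
  have hN : (0 : ℝ) < n + 1 := by positivity
  refine ⟨fun i hi => ?_, fun i _ j _ hij => ?_⟩
  · have hi' : (i : ℝ) + 1 ≤ n + 1 := by exact_mod_cast Finset.mem_range.mp hi
    rw [Set.uIcc_of_le zero_le_one]
    refine ⟨⟨by positivity, ?_⟩, ⟨by positivity, ?_⟩⟩ <;> simp only <;> rw [div_le_one hN] <;> linarith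
  · simp only [Function.onFun]
    rw [Set.uIoc_of_le (by gcongr; linarith), Set.uIoc_of_le (by gcongr; linarith),
      Set.disjoint_left]
    rintro x ⟨h1, h2⟩ ⟨h3, h4⟩
    rw [div_lt_iff₀ hN] at h1 h3
    rw [le_div_iff₀ hN] at h2 h4
    have h5 : (i : ℝ) < j + 1 := by linarith
    have h6 : (j : ℝ) < i + 1 := by linarith
    norm_cast at h5 h6
    omega

theorem lintegral_gridSpeed_le (f : ℝ → D) (n : ℕ) :
    ∫⁻ t in Set.Icc (0 : ℝ) 1, gridSpeed f n t ^ 2 / 2 ≤ discreteEnergy f := by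
  have hN : (0 : ℝ) < n + 1 := by positivity
  -- The point `t = 1` falls in the cell after the last one; it is negligible.
  rw [← restrict_Ico_eq_restrict_Icc]
  have hsub : Set.Ico (0 : ℝ) 1 ⊆ ⋃ k ∈ Finset.range (n + 1),
      Set.Ico ((k : ℝ) / (n + 1 : ℝ)) ((k + 1 : ℝ) / (n + 1 : ℝ)) := by
    intro t ht
    simp only [Set.mem_iUnion, Finset.mem_range, exists_prop]
    have h0 : 0 ≤ (n + 1 : ℝ) * t := mul_nonneg hN.le ht.1
    refine ⟨⌊(n + 1 : ℝ) * t⌋₊, ?_, ?_, ?_⟩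
    · rw [Nat.floor_lt h0]; push_cast; nlinarith [ht.2]
    · rw [div_le_iff₀ hN, mul_comm t]; exact Nat.floor_le h0
    · rw [lt_div_iff₀ hN, mul_comm t]; exact Nat.lt_floor_add_one _
  refine (lintegral_mono_set hsub).trans ?_
  refine (lintegral_biUnion_finset_le _ _ _).trans ?_
  refine le_trans ?_ (incrementEnergy_le_discreteEnergy f (grid_mem_disjWithin n))
  refine Finset.sum_le_sum fun k _ => ?_
  have hconst : ∀ t ∈ Set.Ico ((k : ℝ) / (n + 1 : ℝ)) ((k + 1 : ℝ) / (n + 1 : ℝ)),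
      gridSpeed f n t ^ 2 / 2 =
      (edist (f (k / (n + 1 : ℝ))) (f ((k + 1) / (n + 1 : ℝ))) * (n + 1)) ^ 2 / 2 := by
    intro t ht
    rw [Set.mem_Ico, div_le_iff₀ hN, lt_div_iff₀ hN] at ht
    have : ⌊(n + 1 : ℝ) * t⌋₊ = k := by
      rw [Nat.floor_eq_iff (le_trans (Nat.cast_nonneg k) (by linarith))]
      constructor <;> linarith
    rw [gridSpeed, this]
  rw [setLIntegral_congr_fun measurableSet_Ico hconst, setLIntegral_const, Real.volume_Ico]
  have hlen : ((k + 1 : ℝ) / (n + 1 : ℝ)) - k / (n + 1) = (n + 1 : ℝ)⁻¹ := by field_simp; ring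
  have hdist : dist ((k : ℝ) / (n + 1 : ℝ)) ((k + 1 : ℝ) / (n + 1 : ℝ)) = (n + 1 : ℝ)⁻¹ := by
    rw [dist_comm, Real.dist_eq, hlen, abs_of_pos (by positivity)]
  have hcast : ENNReal.ofReal (n + 1 : ℝ) = n + 1 := by
    rw [ENNReal.ofReal_add (by positivity) zero_le_one]; simp
  have hne : (n + 1 : ℝ≥0∞) ≠ 0 := by simp
  have hnt : (n + 1 : ℝ≥0∞) ≠ ⊤ := by simp
  simp only [hlen, hdist]
  generalize edist (f _) (f _) = X
  rw [ENNReal.ofReal_inv_of_pos hN, hcast, mul_pow, div_eq_mul_inv, div_eq_mul_inv,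
    ENNReal.mul_inv (by simp) (by simp), inv_inv]
  refine le_of_eq ?_
  rw [sq (n + 1 : ℝ≥0∞)]
  calc _ = X ^ 2 * (n + 1) * 2⁻¹ *
        ((n + 1) * (n + 1 : ℝ≥0∞)⁻¹) := by ring
    _ = _ := by rw [ENNReal.mul_inv_cancel hne hnt]; ring

/-- One inequality is Fatou along the uniform grids, the other is Cauchy–Schwarz for an optimal
speed bound. The right-hand side is a supremum of continuous functions of finitely many positions,
whence semicontinuity. -/
theorem pathAction_eq_discreteEnergy [CompactSpace D] [Nonempty D] (c : PathSpace D) :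
    pathAction c = discreteEnergy c.extend := by
  borelize D
  apply le_antisymm
  · by_cases h : discreteEnergy c.extend = ⊤
    · rw [h]; exact le_top
    have hac := absolutelyContinuousOnInterval_of_discreteEnergy_ne_top h
    refine (pathAction_le_of_isSpeedBound (isSpeedBound_denseSpeed hac)).trans ?_
    calc _ ≤ ∫⁻ t in Set.Icc (0 : ℝ) 1, liminf (fun n => gridSpeed c.extend n t ^ 2 / 2) atTop := by
          refine lintegral_mono_ae ?_
          filter_upwards [hac.denseSpeed_le_liminf_gridSpeed, ae_restrict_mem measurableSet_Icc]
            with t ht htm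
          rw [Set.indicator_of_mem htm]
          have hmono : Monotone fun x : ℝ≥0∞ => x ^ 2 / 2 := fun x y hxy => by
            dsimp only; gcongr
          refine (hmono ht).trans (le_of_eq ?_)
          refine hmono.map_liminf_of_continuousAt (fun n => gridSpeed c.extend n t) ?_
          exact ((ENNReal.continuous_div_const 2 (by simp)).comp
            (ENNReal.continuous_pow 2)).continuousAt
      _ ≤ liminf (fun n => ∫⁻ t in Set.Icc (0 : ℝ) 1, gridSpeed c.extend n t ^ 2 / 2) atTop :=
          lintegral_liminf_le fun n =>
            ((measurable_gridSpeed c.continuous_extend n).pow_const 2).div_const 2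
      _ ≤ discreteEnergy c.extend := by
          refine liminf_le_of_le (h := fun b hb => ?_)
          obtain ⟨n, hn⟩ := hb.exists
          exact hn.trans (lintegral_gridSpeed_le _ _)
  · by_cases h : pathAction c = ⊤
    · rw [h]; exact le_top
    obtain ⟨g, hg, hle⟩ := exists_isSpeedBound h
    rw [discreteEnergy]
    refine iSup₂_le fun E hE => ?_
    exact (hg.incrementEnergy_le hE).trans hle

/-- Posed on all functions, for pointwise convergence, because the compactness proof needs sublevels
closed in the product space. -/
theorem lowerSemicontinuous_discreteEnergy :
    LowerSemicontinuous fun f : unitInterval → D =>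
      discreteEnergy fun t => f (Set.projIcc (0 : ℝ) 1 zero_le_one t) := by
  refine lowerSemicontinuous_iSup fun E => lowerSemicontinuous_iSup fun _ => ?_
  refine Continuous.lowerSemicontinuous ?_
  refine continuous_finsetSum _ fun i _ => ?_
  by_cases hd : dist (E.2 i).1 (E.2 i).2 = 0
  · simp only [dist_eq_zero.mp hd, edist_self]
    exact continuous_const
  · refine (ENNReal.continuous_div_const _ ?_).comp ((ENNReal.continuous_pow 2).comp
        ((continuous_apply _).edist (continuous_apply _)))
    · simp only [ne_eq, mul_eq_zero, ENNReal.ofReal_eq_zero, not_or, not_le]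
      exact ⟨by simp, lt_of_le_of_ne dist_nonneg (Ne.symm hd)⟩

theorem lowerSemicontinuous_pathAction [CompactSpace D] [Nonempty D] :
    LowerSemicontinuous (pathAction : PathSpace D → ℝ≥0∞) := by
  have : (pathAction : PathSpace D → ℝ≥0∞) = fun c => discreteEnergy c.extend :=
    funext pathAction_eq_discreteEnergy
  rw [this]
  exact lowerSemicontinuous_discreteEnergy.comp (g := fun c : PathSpace D => (c : unitInterval → D))
    (continuous_pi fun t => continuous_eval_const t)

theorem measurable_pathAction [CompactSpace D] [Nonempty D] :
    Measurable (pathAction : PathSpace D → ℝ≥0∞) :=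
  lowerSemicontinuous_pathAction.measurable

/-- Only the single interval from `s` to `t` is used; the result is a Hölder estimate of exponent
1/2. -/
theorem edist_sq_le_discreteEnergy (f : ℝ → D) {s t : ℝ} (hs : s ∈ Set.Icc (0 : ℝ) 1)
    (ht : t ∈ Set.Icc (0 : ℝ) 1) :
    edist (f s) (f t) ^ 2 ≤ 2 * ENNReal.ofReal (dist s t) * discreteEnergy f := by
  by_cases hst : s = t
  · simp [hst]
  have hmem : ((1, fun _ : ℕ => (s, t)) : ℕ × (ℕ → ℝ × ℝ)) ∈
      AbsolutelyContinuousOnInterval.disjWithin 0 1 := by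
    refine ⟨fun i _ => ?_, fun i hi j hj hij => ?_⟩
    · rw [Set.uIcc_of_le zero_le_one]; exact ⟨hs, ht⟩
    · simp at hi hj; omega
  have h' := incrementEnergy_le_discreteEnergy f hmem
  simp only [incrementEnergy, Finset.range_one, Finset.sum_singleton] at h'
  rw [ENNReal.div_le_iff (by simpa using hst) (by finiteness)] at h'
  rw [mul_comm]; exact h'

theorem edist_sq_le_pathAction [CompactSpace D] [Nonempty D] (c : PathSpace D) (s t : unitInterval) :
    edist (c s) (c t) ^ 2 ≤ 2 * ENNReal.ofReal (dist s t) * pathAction c := by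
  rw [pathAction_eq_discreteEnergy]
  simpa [PathSpace.extend, Subtype.dist_eq] using edist_sq_le_discreteEnergy c.extend s.2 t.2

/-- Arzelà–Ascoli with the modulus `√(2 x M)`. This modulus makes every function of discrete energy
at most `M` continuous, so the sublevel is closed in the compact product `D^[0,1]`. -/
theorem isCompact_pathAction_le [CompactSpace D] [Nonempty D] {M : ℝ≥0∞} (hM : M ≠ ⊤) :
    IsCompact {c : PathSpace D | pathAction c ≤ M} := by
  have hbound : ∀ f : unitInterval → D,
      discreteEnergy (fun t => f (Set.projIcc (0 : ℝ) 1 zero_le_one t)) ≤ M →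
      ∀ s t, dist (f s) (f t) ≤ √(2 * dist s t * M.toReal) := by
    intro f hf s t
    have h := edist_sq_le_discreteEnergy (fun t => f (Set.projIcc (0 : ℝ) 1 zero_le_one t)) s.2 t.2
    simp only [Set.projIcc_val] at h
    have h2 := ENNReal.toReal_mono (by finiteness)
      (h.trans (mul_le_mul_right hf _))
    refine Real.le_sqrt_of_sq_le ?_
    simpa [← dist_edist, ENNReal.toReal_mul, Subtype.dist_eq] using h2
  have hlim : Tendsto (fun x : ℝ => √(2 * x * M.toReal)) (𝓝 0) (𝓝 0) := by
    have : Continuous fun x : ℝ => √(2 * x * M.toReal) := by fun_prop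
    simpa using this.tendsto 0
  refine ArzelaAscoli.isCompact_of_equicontinuous _ ?_ ?_
  · have : ContinuousMap.toFun '' {c : PathSpace D | pathAction c ≤ M} =
        {f : unitInterval → D |
          discreteEnergy (fun t => f (Set.projIcc (0 : ℝ) 1 zero_le_one t)) ≤ M} := by
      ext f
      constructor
      · rintro ⟨c, hc, rfl⟩
        rw [Set.mem_ofPred_eq, pathAction_eq_discreteEnergy] at hc
        exact hc
      · intro hf
        have hcont : Continuous f := by
          rw [Metric.continuous_iff']
          intro t ε hε
          have h1 : Tendsto (fun s => √(2 * dist s t * M.toReal)) (𝓝 t) (𝓝 0) := by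
            refine hlim.comp ?_
            exact tendsto_iff_dist_tendsto_zero.mp (tendsto_id (α := unitInterval) (x := 𝓝 t))
          filter_upwards [h1.eventually_lt_const hε] with s hs
          exact (hbound f hf s t).trans_lt hs
        refine ⟨⟨f, hcont⟩, ?_, rfl⟩
        rw [Set.mem_ofPred_eq, pathAction_eq_discreteEnergy]
        exact hf
    rw [this]
    exact (lowerSemicontinuous_discreteEnergy.isClosed_preimage M).isCompact
  · refine Metric.equicontinuous_of_continuity_modulus (fun x => √(2 * x * M.toReal)) hlim _ ?_
    intro s t c
    refine hbound _ ?_ s t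
    have := c.2
    rw [Set.mem_ofPred_eq, pathAction_eq_discreteEnergy] at this
    exact this

end

/-! ### Operations on paths -/

section
variable {D : Type*} [MetricSpace D]

/-- The uniform distance to a path is computed on countably many times, and every open set of paths
is a countable union of balls. -/
theorem measurable_pathSpace_of_eval [CompactSpace D] [MeasurableSpace D] [BorelSpace D]
    {Z : Type*} [MeasurableSpace Z] {Φ : Z → PathSpace D} (h : ∀ t, Measurable fun z => Φ z t) :
    Measurable Φ := by
  have hdist : ∀ c : PathSpace D, Measurable fun z => dist (Φ z) c := by
    intro c
    refine measurable_of_Iic fun r => ?_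
    by_cases hr : 0 ≤ r
    · have : (fun z => dist (Φ z) c) ⁻¹' Set.Iic r =
          ⋂ n, {z | dist (Φ z (TopologicalSpace.denseSeq unitInterval n))
            (c (TopologicalSpace.denseSeq unitInterval n)) ≤ r} := by
        ext z
        simp only [Set.mem_preimage, Set.mem_Iic, Set.mem_iInter, Set.mem_ofPred_eq,
          ContinuousMap.dist_le hr]
        refine ⟨fun hz n => hz _, fun hz => ?_⟩
        have hcl : IsClosed {t : unitInterval | dist (Φ z t) (c t) ≤ r} :=
          isClosed_le ((Φ z).continuous.dist c.continuous) continuous_const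
        exact fun t => (TopologicalSpace.denseRange_denseSeq unitInterval).induction_on
          (p := fun t => dist (Φ z t) (c t) ≤ r) t hcl hz
      rw [this]
      exact MeasurableSet.iInter fun n => measurableSet_le ((h _).dist measurable_const)
        measurable_const
    · have : (fun z => dist (Φ z) c) ⁻¹' Set.Iic r = ∅ := by
        ext z
        simp only [Set.mem_preimage, Set.mem_Iic, Set.mem_empty_iff_false, iff_false, not_le]
        exact lt_of_lt_of_le (not_le.mp hr) dist_nonneg
      rw [this]
      exact MeasurableSet.empty
  refine measurable_of_isOpen fun U hU => ?_
  obtain ⟨T, hT, hTU⟩ := TopologicalSpace.isOpen_iUnion_countable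
    (fun p : {p : PathSpace D × ℝ // Metric.ball p.1 p.2 ⊆ U} => Metric.ball p.1.1 p.1.2)
    fun _ => Metric.isOpen_ball
  have hUe : U = ⋃ p ∈ T, Metric.ball p.1.1 p.1.2 := by
    rw [hTU]
    refine subset_antisymm (fun c hc => ?_) (Set.iUnion_subset fun p => p.2)
    obtain ⟨r, hr, hball⟩ := Metric.isOpen_iff.mp hU c hc
    exact Set.mem_iUnion.mpr ⟨⟨(c, r), hball⟩, Metric.mem_ball_self hr⟩
  rw [hUe, Set.preimage_iUnion₂]
  exact MeasurableSet.biUnion hT fun p _ => measurableSet_lt (hdist _) measurable_const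

theorem PathSpace.extend_of_le_zero (c : PathSpace D) {t : ℝ} (ht : t ≤ 0) :
    c.extend t = c 0 := by
  rw [PathSpace.extend, Set.projIcc_of_le_left _ ht]; rfl

theorem PathSpace.extend_of_one_le (c : PathSpace D) {t : ℝ} (ht : 1 ≤ t) :
    c.extend t = c 1 := by
  rw [PathSpace.extend, Set.projIcc_of_right_le _ ht]; rfl

theorem pathAction_le_of_lipschitzWith {c : PathSpace D} {L : NNReal} (h : LipschitzWith L c) :
    pathAction c ≤ L ^ 2 / 2 := by
  have hs : IsSpeedBound c.extend fun _ => (L : ℝ≥0∞) := by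
    refine ⟨measurable_const, fun s t hst => ?_⟩
    have := (h.comp (LipschitzWith.projIcc (zero_le_one (α := ℝ)))) s t
    rw [setLIntegral_const, Real.volume_Ioc]
    refine this.trans (le_of_eq ?_)
    rw [mul_one, edist_comm, edist_dist, Real.dist_eq, abs_of_nonneg (sub_nonneg.mpr hst)]
  simpa using pathAction_le_of_isSpeedBound hs

theorem pathAction_const (x : D) : pathAction (ContinuousMap.const unitInterval x) = 0 := by
  have h : LipschitzWith 0 (ContinuousMap.const unitInterval x) := LipschitzWith.const x
  simpa using pathAction_le_of_lipschitzWith h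

/-- The path run backwards. -/
def PathSpace.reverse (c : PathSpace D) : PathSpace D := c.comp ⟨unitInterval.symm, by fun_prop⟩

theorem PathSpace.reverse_apply (c : PathSpace D) (t : unitInterval) :
    c.reverse t = c (unitInterval.symm t) := rfl

theorem PathSpace.continuous_reverse : Continuous (PathSpace.reverse : PathSpace D → PathSpace D) :=
  ContinuousMap.continuous_precomp _

theorem PathSpace.extend_reverse (c : PathSpace D) (t : ℝ) :
    c.reverse.extend t = c.extend (1 - t) := by
  simp only [PathSpace.extend, PathSpace.reverse_apply]
  congr 1
  ext
  simp only [unitInterval.coe_symm_eq, Set.coe_projIcc]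
  rcases le_total t 1 with h1 | h1 <;> rcases le_total 0 t with h2 | h2
  · simp [h1, h2]
  · simp [h2]
  · simp [h1, h2]
  · linarith

theorem IsSpeedBound.reverse {f : ℝ → D} {g : ℝ → ℝ≥0∞} (h : IsSpeedBound f g) :
    IsSpeedBound (fun t => f (1 - t)) fun t => g (1 - t) := by
  refine ⟨h.1.comp (measurable_const.sub measurable_id), fun s t hst => ?_⟩
  have hpre : (fun x : ℝ => 1 - x) ⁻¹' Set.Ico (1 - t) (1 - s) = Set.Ioc s t := by
    ext x; simp only [Set.mem_preimage, Set.mem_Ico, Set.mem_Ioc]; constructor <;> intro h <;>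
      constructor <;> linarith [h.1, h.2]
  rw [← hpre, (Measure.measurePreserving_sub_left volume (1 : ℝ)).setLIntegral_comp_preimage
    measurableSet_Ico h.1, restrict_Ico_eq_restrict_Icc, ← restrict_Ioc_eq_restrict_Icc, edist_comm]
  exact h.2 _ _ (by linarith)

theorem pathAction_reverse_le [CompactSpace D] [Nonempty D] (c : PathSpace D) :
    pathAction c.reverse ≤ pathAction c := by
  by_cases h : pathAction c = ⊤
  · rw [h]; exact le_top
  obtain ⟨g, hg, hle⟩ := exists_isSpeedBound h
  have hr : IsSpeedBound c.reverse.extend fun t => g (1 - t) := by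
    rw [show c.reverse.extend = fun t => c.extend (1 - t) from funext c.extend_reverse]
    exact hg.reverse
  refine (pathAction_le_of_isSpeedBound hr).trans ((setLIntegral_le_lintegral _ _).trans ?_)
  rw [lintegral_sub_left_eq_self (fun t => g t ^ 2 / 2) (1 : ℝ)]
  exact hle

theorem lintegral_comp_sub_div {f : ℝ → ℝ≥0∞} (hf : Measurable f) {s : ℝ} (hs : 0 < s) (r : ℝ) :
    ∫⁻ u, f ((u - r) / s) = ENNReal.ofReal s * ∫⁻ u, f u := by
  rw [lintegral_sub_right_eq_self (fun u => f (u / s)) r]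
  have h := Real.map_volume_mul_left (inv_ne_zero hs.ne')
  simp only [inv_inv, abs_of_pos hs] at h
  rw [← smul_eq_mul, ← lintegral_smul_measure, ← h, lintegral_map hf (by fun_prop)]
  simp only [div_eq_inv_mul]

theorem IsSpeedBound.comp_sub_div {f : ℝ → D} {g : ℝ → ℝ≥0∞} (h : IsSpeedBound f g) {s : ℝ}
    (hs : 0 < s) (r : ℝ) :
    IsSpeedBound (fun u => f ((u - r) / s)) fun u => (ENNReal.ofReal s)⁻¹ * g ((u - r) / s) := by
  have hm : Measurable fun u : ℝ => (u - r) / s := by fun_prop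
  refine ⟨(h.1.comp hm).const_mul _, fun a b hab => ?_⟩
  have hs0 : ENNReal.ofReal s ≠ 0 := by simpa using hs
  have hgm : Measurable fun u => g ((u - r) / s) := h.1.comp hm
  simp only
  rw [lintegral_const_mul _ hgm, ← lintegral_indicator measurableSet_Ioc]
  have hind : (Set.Ioc a b).indicator (fun u => g ((u - r) / s)) = fun u =>
      (Set.Ioc ((a - r) / s) ((b - r) / s)).indicator g ((u - r) / s) := by
    ext u
    simp only [Set.indicator_apply, Set.mem_Ioc, div_lt_div_iff_of_pos_right hs,
      div_le_div_iff_of_pos_right hs, sub_lt_sub_iff_right, sub_le_sub_iff_right]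
  rw [show (fun u => (Set.Ioc a b).indicator (fun u => g ((u - r) / s)) u) = _ from hind,
    lintegral_comp_sub_div (h.1.indicator measurableSet_Ioc) hs, ← mul_assoc,
    ENNReal.inv_mul_cancel hs0 ENNReal.ofReal_ne_top, one_mul, lintegral_indicator measurableSet_Ioc]
  exact h.2 _ _ (by gcongr)

/-- The squared speed gains a factor `s⁻²`, the time interval a factor `s`. -/
theorem lintegral_sq_comp_sub_div {g : ℝ → ℝ≥0∞} (hg : Measurable g) {s : ℝ} (hs : 0 < s) (r : ℝ) :
    ∫⁻ u, ((ENNReal.ofReal s)⁻¹ * g ((u - r) / s)) ^ 2 / 2 =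
      (ENNReal.ofReal s)⁻¹ * ∫⁻ u, g u ^ 2 / 2 := by
  have hs0 : ENNReal.ofReal s ≠ 0 := by simpa using hs
  have h1 : ∀ u : ℝ, ((ENNReal.ofReal s)⁻¹ * g ((u - r) / s)) ^ 2 / 2 =
      ((ENNReal.ofReal s)⁻¹ ^ 2) * (g ((u - r) / s) ^ 2 / 2) := fun u => by
    rw [mul_pow, mul_div_assoc]
  have hm : Measurable fun u => g u ^ 2 / 2 := (hg.pow_const 2).div_const 2
  have hm' : Measurable fun u => g ((u - r) / s) ^ 2 / 2 :=
    hm.comp (by fun_prop : Measurable fun u : ℝ => (u - r) / s)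
  simp only [h1]
  rw [lintegral_const_mul _ hm',
    lintegral_comp_sub_div hm hs, sq, ← mul_assoc, mul_assoc _ _ (ENNReal.ofReal s),
    ENNReal.inv_mul_cancel hs0 ENNReal.ofReal_ne_top, mul_one]

/-- The curve which runs along `c₁` on `[0,s]` and then along `c₂` on `[s,1]`. -/
noncomputable def PathSpace.concatFun (c₁ c₂ : PathSpace D) (s : ℝ) (t : ℝ) : D :=
  if t ≤ s then c₁.extend (t / s) else c₂.extend ((t - s) / (1 - s))

theorem PathSpace.continuous_concatFun {c₁ c₂ : PathSpace D} (h : c₁ 1 = c₂ 0) {s : ℝ}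
    (hs : s ∈ Set.Ioo (0 : ℝ) 1) : Continuous (PathSpace.concatFun c₁ c₂ s) := by
  refine Continuous.if_le (c₁.continuous_extend.comp (by fun_prop))
    (c₂.continuous_extend.comp (by fun_prop)) continuous_id continuous_const ?_
  rintro t rfl
  rw [div_self hs.1.ne', c₁.extend_of_one_le le_rfl, sub_self, zero_div,
    c₂.extend_of_le_zero le_rfl, h]

open Classical in
/-- The concatenation of two paths at time `s` (the first path if the end of the first one is not
the origin of the second one). -/
noncomputable def PathSpace.concat (s : Set.Ioo (0 : ℝ) 1) (c₁ c₂ : PathSpace D) : PathSpace D :=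
  if h : c₁ 1 = c₂ 0 then
    ⟨fun t => PathSpace.concatFun c₁ c₂ s t,
      (PathSpace.continuous_concatFun h s.2).comp continuous_subtype_val⟩
  else c₁

theorem PathSpace.concat_apply (s : Set.Ioo (0 : ℝ) 1) {c₁ c₂ : PathSpace D} (h : c₁ 1 = c₂ 0)
    (t : unitInterval) : PathSpace.concat s c₁ c₂ t = PathSpace.concatFun c₁ c₂ s t := by
  rw [PathSpace.concat, dif_pos h]; rfl

theorem PathSpace.concat_zero (s : Set.Ioo (0 : ℝ) 1) {c₁ c₂ : PathSpace D} (h : c₁ 1 = c₂ 0) :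
    PathSpace.concat s c₁ c₂ 0 = c₁ 0 := by
  rw [PathSpace.concat_apply s h, PathSpace.concatFun, if_pos (by simpa using s.2.1.le)]
  exact c₁.extend_of_le_zero (by simp)

theorem PathSpace.concat_one (s : Set.Ioo (0 : ℝ) 1) {c₁ c₂ : PathSpace D} (h : c₁ 1 = c₂ 0) :
    PathSpace.concat s c₁ c₂ 1 = c₂ 1 := by
  rw [PathSpace.concat_apply s h, PathSpace.concatFun, if_neg (by simpa using s.2.2)]
  refine c₂.extend_of_one_le ?_
  simp only [Set.Icc.coe_one]
  rw [div_self (by linarith [s.2.2])]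

theorem PathSpace.extend_concat (s : Set.Ioo (0 : ℝ) 1) {c₁ c₂ : PathSpace D} (h : c₁ 1 = c₂ 0)
    (t : ℝ) : (PathSpace.concat s c₁ c₂).extend t = PathSpace.concatFun c₁ c₂ s t := by
  have hs := s.2
  have hs' : 0 < 1 - (s : ℝ) := by linarith [hs.2]
  rcases le_total t 0 with h0 | h0
  · rw [PathSpace.extend_of_le_zero _ h0, PathSpace.concat_zero s h, PathSpace.concatFun,
      if_pos (h0.trans hs.1.le), PathSpace.extend_of_le_zero]
    exact div_nonpos_of_nonpos_of_nonneg h0 hs.1.le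
  rcases le_total 1 t with h1 | h1
  · rw [PathSpace.extend_of_one_le _ h1, PathSpace.concat_one s h, PathSpace.concatFun,
      if_neg (by linarith [hs.2]), PathSpace.extend_of_one_le]
    rw [le_div_iff₀ hs']; linarith
  · rw [PathSpace.extend, PathSpace.concat_apply s h, Set.projIcc_of_mem _ ⟨h0, h1⟩]

/-- The rescaled speed bounds of the two pieces are pasted at time `s`; an interval containing `s`
is cut there by the triangle inequality. -/
theorem pathAction_concat_le [CompactSpace D] [Nonempty D] (s : Set.Ioo (0 : ℝ) 1)
    {c₁ c₂ : PathSpace D} (h : c₁ 1 = c₂ 0) :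
    pathAction (PathSpace.concat s c₁ c₂) ≤
      (ENNReal.ofReal s)⁻¹ * pathAction c₁ + (ENNReal.ofReal (1 - s))⁻¹ * pathAction c₂ := by
  have hs := s.2
  have hs' : 0 < 1 - (s : ℝ) := by linarith [hs.2]
  by_cases h1 : pathAction c₁ = ⊤
  · rw [h1, ENNReal.mul_top (by simp)]; simp
  by_cases h2 : pathAction c₂ = ⊤
  · rw [h2, ENNReal.mul_top (by simp)]; simp
  obtain ⟨g₁, hg₁, hle₁⟩ := exists_isSpeedBound h1
  obtain ⟨g₂, hg₂, hle₂⟩ := exists_isSpeedBound h2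
  have b₁ := hg₁.comp_sub_div hs.1 0
  have b₂ := hg₂.comp_sub_div hs' (s : ℝ)
  set G₁ : ℝ → ℝ≥0∞ := fun u => (ENNReal.ofReal s)⁻¹ * g₁ ((u - 0) / s)
  set G₂ : ℝ → ℝ≥0∞ := fun u => (ENNReal.ofReal (1 - s))⁻¹ * g₂ ((u - s) / (1 - s))
  have key : IsSpeedBound (PathSpace.concat s c₁ c₂).extend
      fun u => if u ≤ s then G₁ u else G₂ u := by
    refine ⟨Measurable.ite measurableSet_Iic b₁.1 b₂.1, fun a b hab => ?_⟩
    rw [PathSpace.extend_concat s h, PathSpace.extend_concat s h]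
    have left : ∀ a b : ℝ, a ≤ b → b ≤ s →
        edist (PathSpace.concatFun c₁ c₂ s a) (PathSpace.concatFun c₁ c₂ s b) ≤
          ∫⁻ u in Set.Ioc a b, if u ≤ s then G₁ u else G₂ u := by
      intro a b hab hb
      rw [setLIntegral_congr_fun measurableSet_Ioc (g := G₁)
        (fun u hu => if_pos (hu.2.trans hb)), PathSpace.concatFun, PathSpace.concatFun,
        if_pos hb, if_pos (hab.trans hb)]
      simpa using b₁.2 a b hab
    have right : ∀ a b : ℝ, a ≤ b → s ≤ a →
        edist (PathSpace.concatFun c₁ c₂ s a) (PathSpace.concatFun c₁ c₂ s b) ≤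
          ∫⁻ u in Set.Ioc a b, if u ≤ s then G₁ u else G₂ u := by
      intro a b hab ha
      have hright : ∀ x : ℝ, s ≤ x → PathSpace.concatFun c₁ c₂ s x =
          c₂.extend ((x - s) / (1 - s)) := by
        intro x hx
        rcases hx.eq_or_lt with hx | hx
        · rw [← hx, PathSpace.concatFun, if_pos le_rfl, div_self hs.1.ne', sub_self, zero_div,
            c₁.extend_of_one_le le_rfl, c₂.extend_of_le_zero le_rfl, h]
        · rw [PathSpace.concatFun, if_neg hx.not_ge]
      rw [setLIntegral_congr_fun measurableSet_Ioc (g := G₂)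
        (fun u hu => if_neg (ha.trans_lt hu.1).not_ge), hright a ha, hright b (ha.trans hab)]
      exact b₂.2 a b hab
    rcases le_total b s with hb | hb
    · exact left a b hab hb
    rcases le_total (s : ℝ) a with ha | ha
    · exact right a b hab ha
    · refine (edist_triangle _ (PathSpace.concatFun c₁ c₂ s s) _).trans ?_
      rw [← Set.Ioc_union_Ioc_eq_Ioc ha hb, lintegral_union measurableSet_Ioc
        (Set.Ioc_disjoint_Ioc_of_le le_rfl)]
      exact add_le_add (left a s ha le_rfl) (right s b hb le_rfl)
  calc pathAction (PathSpace.concat s c₁ c₂)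
      ≤ ∫⁻ u : ℝ, (if u ≤ s then G₁ u else G₂ u) ^ 2 / 2 :=
        (pathAction_le_of_isSpeedBound key).trans (setLIntegral_le_lintegral _ _)
    _ ≤ ∫⁻ u, (G₁ u ^ 2 / 2 + G₂ u ^ 2 / 2) := by
        refine lintegral_mono fun u => ?_
        dsimp only
        split_ifs
        · exact le_self_add
        · exact le_add_self
    _ = (∫⁻ u, G₁ u ^ 2 / 2) + ∫⁻ u, G₂ u ^ 2 / 2 :=
        lintegral_add_left ((b₁.1.pow_const 2).div_const 2) _
    _ ≤ _ := by
        rw [lintegral_sq_comp_sub_div hg₁.1 hs.1, lintegral_sq_comp_sub_div hg₂.1 hs']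
        gcongr

theorem PathSpace.measurable_concat [CompactSpace D] [MeasurableSpace D] [BorelSpace D]
    (s : Set.Ioo (0 : ℝ) 1) :
    Measurable fun p : PathSpace D × PathSpace D => PathSpace.concat s p.1 p.2 := by
  classical
  refine measurable_pathSpace_of_eval fun t => ?_
  have hev : ∀ r : unitInterval, Measurable fun c : PathSpace D => c r := fun r =>
    (continuous_eval_const r).measurable
  have : (fun p : PathSpace D × PathSpace D => PathSpace.concat s p.1 p.2 t) = fun p =>
      if p.1 1 = p.2 0 then PathSpace.concatFun p.1 p.2 s t else p.1 t := by
    ext p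
    split_ifs with h
    · exact PathSpace.concat_apply s h t
    · rw [PathSpace.concat, dif_neg h]
  rw [this]
  refine Measurable.ite ?_ ?_ ((hev t).comp measurable_fst)
  · exact measurableSet_eq_fun ((hev 1).comp measurable_fst) ((hev 0).comp measurable_snd)
  · simp only [PathSpace.concatFun]
    split_ifs
    · exact (hev _).comp measurable_fst
    · exact (hev _).comp measurable_snd

end

/-! ### Gluing of measures along a common marginal -/

/-- Conditionally on the common value of `f₁` and `f₂`, the two points are drawn independently. The
conditional laws come from disintegrating the graph measures `m₁` and `m₂` over their first
coordinate. -/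
theorem exists_glue {X₁ X₂ Z : Type*} [MeasurableSpace X₁] [StandardBorelSpace X₁] [Nonempty X₁]
    [MeasurableSpace X₂] [StandardBorelSpace X₂] [Nonempty X₂] [MeasurableSpace Z]
    [StandardBorelSpace Z] (ρ₁ : Measure X₁) [IsFiniteMeasure ρ₁] (ρ₂ : Measure X₂)
    [IsFiniteMeasure ρ₂] {f₁ : X₁ → Z} {f₂ : X₂ → Z} (hf₁ : Measurable f₁) (hf₂ : Measurable f₂)
    (h : ρ₁.map f₁ = ρ₂.map f₂) :
    ∃ ρ : Measure (X₁ × X₂), ρ.map Prod.fst = ρ₁ ∧ ρ.map Prod.snd = ρ₂ ∧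
      ∀ᵐ p ∂ρ, f₁ p.1 = f₂ p.2 := by
  set θ := ρ₁.map f₁ with hθ
  have g₁ : Measurable fun x => (f₁ x, x) := hf₁.prodMk measurable_id
  have g₂ : Measurable fun x => (f₂ x, x) := hf₂.prodMk measurable_id
  set m₁ := ρ₁.map fun x => (f₁ x, x)
  set m₂ := ρ₂.map fun x => (f₂ x, x)
  have hm₁ : θ ⊗ₘ m₁.condKernel = m₁ := by
    have h1 : m₁.fst = θ := by
      rw [Measure.fst, Measure.map_map measurable_fst g₁]; rfl
    rw [← h1]; exact m₁.disintegrate m₁.condKernel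
  have hm₂ : θ ⊗ₘ m₂.condKernel = m₂ := by
    have h1 : m₂.fst = θ := by
      rw [h, Measure.fst, Measure.map_map measurable_fst g₂]; rfl
    rw [← h1]; exact m₂.disintegrate m₂.condKernel
  set R₀ := θ ⊗ₘ (m₁.condKernel ×ₖ m₂.condKernel)
  have hR₁ : R₀.map (Prod.map id Prod.fst) = m₁ := by
    rw [← Measure.compProd_map measurable_fst, ← Kernel.fst_eq, Kernel.fst_prod, hm₁]
  have hR₂ : R₀.map (Prod.map id Prod.snd) = m₂ := by
    rw [← Measure.compProd_map measurable_snd, ← Kernel.snd_eq, Kernel.snd_prod, hm₂]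
  have e₁ : ∀ᵐ p ∂(R₀), f₁ p.2.1 = p.1 := by
    have : ∀ᵐ p ∂m₁, f₁ p.2 = p.1 := by
      exact (ae_map_iff g₁.aemeasurable
        (measurableSet_eq_fun (hf₁.comp measurable_snd) measurable_fst)).mpr
        (Eventually.of_forall fun _ => rfl)
    rw [← hR₁] at this
    exact ae_of_ae_map (by fun_prop) this
  have e₂ : ∀ᵐ p ∂(R₀), f₂ p.2.2 = p.1 := by
    have : ∀ᵐ p ∂m₂, f₂ p.2 = p.1 := by
      exact (ae_map_iff g₂.aemeasurable
        (measurableSet_eq_fun (hf₂.comp measurable_snd) measurable_fst)).mpr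
        (Eventually.of_forall fun _ => rfl)
    rw [← hR₂] at this
    exact ae_of_ae_map (by fun_prop) this
  refine ⟨R₀.map Prod.snd, ?_, ?_, ?_⟩
  · rw [Measure.map_map measurable_fst measurable_snd]
    have : R₀.map (Prod.snd ∘ Prod.map id Prod.fst) = ρ₁ := by
      rw [← Measure.map_map measurable_snd (by fun_prop), hR₁,
        Measure.map_map measurable_snd g₁]
      exact Measure.map_id
    exact this
  · rw [Measure.map_map measurable_snd measurable_snd]
    have : R₀.map (Prod.snd ∘ Prod.map id Prod.snd) = ρ₂ := by
      rw [← Measure.map_map measurable_snd (by fun_prop), hR₂,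
        Measure.map_map measurable_snd g₂]
      exact Measure.map_id
    exact this
  · refine (ae_map_iff measurable_snd.aemeasurable
      (measurableSet_eq_fun (hf₁.comp measurable_fst) (hf₂.comp measurable_snd))).mpr ?_
    filter_upwards [e₁, e₂] with p h1 h2
    exact h1.trans h2.symm

/-! ### The cost and its first properties -/

section
variable {D : Type*} [MetricSpace D] [MeasurableSpace D] {μ : Measure D}

/-- The infimum of the action among the flows connecting two plans. -/
noncomputable def relaxedCost (η γ : MPPlan μ) : ℝ≥0∞ :=
  ⨅ (Q : Measure (PathSpace D × D)) (_ : IsGeneralizedFlow η γ Q), ∫⁻ p, pathAction p.1 ∂Q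

theorem relaxedDist_eq (η γ : MPPlan μ) : relaxedDist η γ = relaxedCost η γ ^ (1 / 2 : ℝ) := rfl

theorem relaxedDist_sq (η γ : MPPlan μ) : relaxedDist η γ ^ 2 = relaxedCost η γ := by
  rw [relaxedDist_eq, ← ENNReal.rpow_natCast, ← ENNReal.rpow_mul]
  norm_num

theorem relaxedDist_le_iff {η γ : MPPlan μ} {r : ℝ≥0∞} :
    relaxedDist η γ ≤ r ↔ relaxedCost η γ ≤ r ^ 2 := by
  rw [← relaxedDist_sq, ENNReal.pow_le_pow_left_iff two_ne_zero]

theorem exists_flow_of_relaxedCost_lt {η γ : MPPlan μ} {r : ℝ≥0∞} (h : relaxedCost η γ < r) :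
    ∃ Q, IsGeneralizedFlow η γ Q ∧ ∫⁻ p, pathAction p.1 ∂Q < r := by
  simpa [relaxedCost, iInf_lt_iff] using h

theorem IsGeneralizedFlow.relaxedCost_le {η γ : MPPlan μ} {Q : Measure (PathSpace D × D)}
    (h : IsGeneralizedFlow η γ Q) : relaxedCost η γ ≤ ∫⁻ p, pathAction p.1 ∂Q :=
  iInf₂_le Q h

theorem PathSpace.measurable_eval [BorelSpace D] (t : unitInterval) :
    Measurable fun c : PathSpace D => c t :=
  (continuous_eval_const t).measurable

theorem PathSpace.measurable_fst_eval [BorelSpace D] (t : unitInterval) :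
    Measurable fun p : PathSpace D × D => p.1 t :=
  (PathSpace.measurable_eval t).comp measurable_fst

theorem PathSpace.measurable_label_eval [BorelSpace D] (t : unitInterval) :
    Measurable fun p : PathSpace D × D => (p.2, p.1 t) :=
  measurable_snd.prodMk (PathSpace.measurable_fst_eval t)

instance [Nonempty D] : Nonempty (PathSpace D) :=
  ⟨ContinuousMap.const _ (Classical.arbitrary D)⟩

theorem measurable_pathAction_fst [CompactSpace D] [Nonempty D] :
    Measurable fun p : PathSpace D × D => pathAction p.1 :=
  measurable_pathAction.comp measurable_fst

variable [CompactSpace D] [BorelSpace D]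

/-- Flows are built as random paths with random labels on an auxiliary space `S`; total mass one and
the law of the label follow from the initial condition. -/
theorem relaxedCost_le_of_model [Nonempty D] {S : Type*} [MeasurableSpace S] (P : Measure S)
    {Φ : S → PathSpace D} {a : S → D} (hΦ : Measurable Φ) (ha : Measurable a) {η γ : MPPlan μ}
    (hinc : ∀ t, P.map (fun s => Φ s t) = μ)
    (h0 : P.map (fun s => (a s, Φ s 0)) = (η.plan : Measure (D × D)))
    (h1 : P.map (fun s => (a s, Φ s 1)) = (γ.plan : Measure (D × D))) :
    relaxedCost η γ ≤ ∫⁻ s, pathAction (Φ s) ∂P := by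
  have hm : Measurable fun s => (Φ s, a s) := hΦ.prodMk ha
  have hev : ∀ t, Measurable fun s => (a s, Φ s t) := fun t =>
    ha.prodMk ((PathSpace.measurable_eval t).comp hΦ)
  have hP : IsProbabilityMeasure P := by
    constructor
    have h2 : (P.map (fun s => (a s, Φ s 0))) Set.univ = 1 := by rw [h0]; exact measure_univ
    rwa [Measure.map_apply (hev 0) MeasurableSet.univ, Set.preimage_univ] at h2
  have hQ : IsGeneralizedFlow η γ (P.map fun s => (Φ s, a s)) := by
    refine ⟨Measure.isProbabilityMeasure_map hm.aemeasurable, ?_, fun t => ?_, ?_, ?_⟩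
    · rw [Measure.map_map measurable_snd hm, ← η.map_fst, ← h0,
        Measure.map_map measurable_fst (hev 0)]
      rfl
    · rw [Measure.map_map (PathSpace.measurable_fst_eval t) hm, ← hinc t]; rfl
    · rw [Measure.map_map (PathSpace.measurable_label_eval 0) hm, ← h0]; rfl
    · rw [Measure.map_map (PathSpace.measurable_label_eval 1) hm, ← h1]; rfl
  refine hQ.relaxedCost_le.trans (le_of_eq ?_)
  rw [lintegral_map measurable_pathAction_fst hm]

theorem relaxedCost_self [Nonempty D] (η : MPPlan μ) : relaxedCost η η = 0 := by
  have hΦ : Measurable fun p : D × D => (ContinuousMap.const unitInterval p.2 : PathSpace D) :=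
    measurable_pathSpace_of_eval fun t => measurable_snd
  have h := relaxedCost_le_of_model (η := η) (γ := η) (η.plan : Measure (D × D)) hΦ measurable_fst
    (fun t => η.map_snd) Measure.map_id Measure.map_id
  simpa [pathAction_const] using h

theorem relaxedCost_comm_le [Nonempty D] (η γ : MPPlan μ) : relaxedCost η γ ≤ relaxedCost γ η := by
  refine le_iInf₂ fun Q hQ => ?_
  refine (relaxedCost_le_of_model Q (Φ := fun p => p.1.reverse)
    (PathSpace.continuous_reverse.measurable.comp measurable_fst) measurable_snd
    (fun t => ?_) ?_ ?_).trans (lintegral_mono fun p => pathAction_reverse_le _)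
  · simp only [PathSpace.reverse_apply]; exact hQ.incompressible _
  · simp only [PathSpace.reverse_apply, unitInterval.symm_zero]; exact hQ.final
  · simp only [PathSpace.reverse_apply, unitInterval.symm_one]; exact hQ.initial

theorem relaxedCost_comm [Nonempty D] (η γ : MPPlan μ) : relaxedCost η γ = relaxedCost γ η :=
  le_antisymm (relaxedCost_comm_le _ _) (relaxedCost_comm_le _ _)

/-- The final law of `Q₁` and the initial law of `Q₂` for (label, position) are both `θ`, so
particles can be matched with equal labels and meeting paths. At each time the position is read in
only one of the two flows, which preserves incompressibility. -/
theorem relaxedCost_le_concat [Nonempty D] (η θ γ : MPPlan μ) (s : Set.Ioo (0 : ℝ) 1)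
    {Q₁ Q₂ : Measure (PathSpace D × D)} (h₁ : IsGeneralizedFlow η θ Q₁)
    (h₂ : IsGeneralizedFlow θ γ Q₂) :
    relaxedCost η γ ≤ (ENNReal.ofReal s)⁻¹ * ∫⁻ p, pathAction p.1 ∂Q₁ +
      (ENNReal.ofReal (1 - s))⁻¹ * ∫⁻ p, pathAction p.1 ∂Q₂ := by
  have := h₁.isProb
  have := h₂.isProb
  obtain ⟨ρ, hρ₁, hρ₂, hρ⟩ := exists_glue Q₁ Q₂
    (f₁ := fun p => (p.2, p.1 1)) (f₂ := fun p => (p.2, p.1 0))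
    (PathSpace.measurable_label_eval 1)
    (PathSpace.measurable_label_eval 0) (h₁.final.trans h₂.initial.symm)
  have hρ' : ∀ᵐ p ∂ρ, p.1.2 = p.2.2 ∧ p.1.1 1 = p.2.1 0 := by
    filter_upwards [hρ] with p hp
    exact Prod.ext_iff.mp hp
  have hΦ : Measurable fun p : (PathSpace D × D) × (PathSpace D × D) =>
      PathSpace.concat s p.1.1 p.2.1 := (PathSpace.measurable_concat s).comp
        ((measurable_fst.comp measurable_fst).prodMk (measurable_fst.comp measurable_snd))
  refine (relaxedCost_le_of_model ρ hΦ (measurable_snd.comp measurable_fst) (fun t => ?_)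
    ?_ ?_).trans ?_
  · by_cases ht : (t : ℝ) ≤ s
    · have : (fun p : (PathSpace D × D) × (PathSpace D × D) => PathSpace.concat s p.1.1 p.2.1 t)
          =ᵐ[ρ] (fun p => p.1 (Set.projIcc (0 : ℝ) 1 zero_le_one (t / s))) ∘ Prod.fst := by
        filter_upwards [hρ'] with p hp
        rw [PathSpace.concat_apply s hp.2, PathSpace.concatFun, if_pos ht]; rfl
      rw [Measure.map_congr this, ← Measure.map_map (PathSpace.measurable_fst_eval _) measurable_fst,
        hρ₁]
      exact h₁.incompressible _
    · have : (fun p : (PathSpace D × D) × (PathSpace D × D) => PathSpace.concat s p.1.1 p.2.1 t)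
          =ᵐ[ρ] (fun p => p.1 (Set.projIcc (0 : ℝ) 1 zero_le_one ((t - s) / (1 - s)))) ∘
            Prod.snd := by
        filter_upwards [hρ'] with p hp
        rw [PathSpace.concat_apply s hp.2, PathSpace.concatFun, if_neg ht]; rfl
      rw [Measure.map_congr this, ← Measure.map_map (PathSpace.measurable_fst_eval _) measurable_snd,
        hρ₂]
      exact h₂.incompressible _
  · have : (fun p : (PathSpace D × D) × (PathSpace D × D) =>
        ((Prod.snd ∘ Prod.fst) p, PathSpace.concat s p.1.1 p.2.1 0))
          =ᵐ[ρ] (fun p => (p.2, p.1 0)) ∘ Prod.fst := by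
      filter_upwards [hρ'] with p hp
      rw [PathSpace.concat_zero s hp.2]; rfl
    rw [Measure.map_congr this, ← Measure.map_map
      (PathSpace.measurable_label_eval 0) measurable_fst, hρ₁, h₁.initial]
  · have : (fun p : (PathSpace D × D) × (PathSpace D × D) =>
        ((Prod.snd ∘ Prod.fst) p, PathSpace.concat s p.1.1 p.2.1 1))
          =ᵐ[ρ] (fun p => (p.2, p.1 1)) ∘ Prod.snd := by
      filter_upwards [hρ'] with p hp
      rw [PathSpace.concat_one s hp.2]
      simp [hp.1]
    rw [Measure.map_congr this, ← Measure.map_map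
      (PathSpace.measurable_label_eval 1) measurable_snd, hρ₂, h₂.final]
  · have hA := measurable_pathAction_fst (D := D)
    have hA₁ : Measurable fun p : (PathSpace D × D) × (PathSpace D × D) => pathAction p.1.1 :=
      hA.comp measurable_fst
    have hA₂ : Measurable fun p : (PathSpace D × D) × (PathSpace D × D) => pathAction p.2.1 :=
      hA.comp measurable_snd
    calc ∫⁻ p, pathAction (PathSpace.concat s p.1.1 p.2.1) ∂ρ
        ≤ ∫⁻ p, ((ENNReal.ofReal s)⁻¹ * pathAction p.1.1 +
            (ENNReal.ofReal (1 - s))⁻¹ * pathAction p.2.1) ∂ρ := by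
          refine lintegral_mono_ae ?_
          filter_upwards [hρ'] with p hp
          exact pathAction_concat_le s hp.2
      _ = _ := by
          rw [lintegral_add_left (hA₁.const_mul _),
            lintegral_const_mul _ hA₁, lintegral_const_mul _ hA₂, ← hρ₁, ← hρ₂,
            lintegral_map hA measurable_fst, lintegral_map hA measurable_snd]

theorem relaxedDist_triangle [Nonempty D] (η θ γ : MPPlan μ) :
    relaxedDist η γ ≤ relaxedDist η θ + relaxedDist θ γ := by
  by_cases h1 : relaxedDist η θ = ⊤
  · simp [h1]
  by_cases h2 : relaxedDist θ γ = ⊤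
  · simp [h2]
  refine ENNReal.le_of_forall_pos_le_add fun ε hε _ => ?_
  have key : ∀ {x : ℝ≥0∞}, x ≠ ⊤ → ∃ r : ℝ, 0 < r ∧ x < ENNReal.ofReal r ∧
      ENNReal.ofReal r = x + (ε / 2 : NNReal) := by
    intro x hx
    have hε2 : 0 < ε / 2 := by positivity
    refine ⟨x.toReal + (ε / 2 : NNReal), by positivity, ?_, ?_⟩
    · rw [ENNReal.ofReal_add ENNReal.toReal_nonneg (by positivity), ENNReal.ofReal_toReal hx,
        ENNReal.ofReal_coe_nnreal]
      exact ENNReal.lt_add_right hx (by simpa using hε.ne')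
    · rw [ENNReal.ofReal_add ENNReal.toReal_nonneg (by positivity), ENNReal.ofReal_toReal hx,
        ENNReal.ofReal_coe_nnreal]
  obtain ⟨a, ha, hxa, hae⟩ := key h1
  obtain ⟨b, hb, hyb, hbe⟩ := key h2
  have hQ : ∀ {η γ : MPPlan μ} {r : ℝ}, relaxedDist η γ < ENNReal.ofReal r →
      ∃ Q, IsGeneralizedFlow η γ Q ∧ ∫⁻ p, pathAction p.1 ∂Q < ENNReal.ofReal r ^ 2 := by
    intro η γ r hr
    refine exists_flow_of_relaxedCost_lt ?_
    rw [← relaxedDist_sq]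
    exact ENNReal.pow_lt_pow_left two_ne_zero hr
  obtain ⟨Q₁, hQ₁, hlt₁⟩ := hQ hxa
  obtain ⟨Q₂, hQ₂, hlt₂⟩ := hQ hyb
  -- The minimizer of `a² / s + b² / (1 - s)`, with minimum `(a + b)²`. Taking `a` and `b` slightly
  -- above the two distances keeps `s` inside `(0,1)` even if a distance vanishes.
  have hs : a / (a + b) ∈ Set.Ioo (0 : ℝ) 1 :=
    ⟨by positivity, by rw [div_lt_one (by positivity)]; linarith⟩
  have hc := relaxedCost_le_concat η θ γ ⟨a / (a + b), hs⟩ hQ₁ hQ₂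
  have hs' : 1 - a / (a + b) = b / (a + b) := by field_simp; ring
  have hfinal : relaxedCost η γ ≤ ENNReal.ofReal (a + b) ^ 2 := by
    refine hc.trans ?_
    simp only [hs']
    refine (add_le_add (mul_le_mul_right hlt₁.le _) (mul_le_mul_right hlt₂.le _)).trans ?_
    rw [← ENNReal.ofReal_inv_of_pos (by positivity), ← ENNReal.ofReal_inv_of_pos (by positivity),
      ← ENNReal.ofReal_pow ha.le, ← ENNReal.ofReal_pow hb.le,
      ← ENNReal.ofReal_pow (by positivity), ← ENNReal.ofReal_mul (by positivity),
      ← ENNReal.ofReal_mul (by positivity), ← ENNReal.ofReal_add (by positivity) (by positivity)]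
    refine ENNReal.ofReal_le_ofReal (le_of_eq ?_)
    field_simp
    try ring
  refine (relaxedDist_le_iff.mpr hfinal).trans (le_of_eq ?_)
  rw [ENNReal.ofReal_add ha.le hb.le, hae, hbe]
  have : (ε : ℝ≥0∞) = (ε / 2 : NNReal) + (ε / 2 : NNReal) := by
    rw [← ENNReal.coe_add, add_halves]
  rw [this]
  ring

theorem relaxedDist_self [Nonempty D] (η : MPPlan μ) : relaxedDist η η = 0 := by
  rw [relaxedDist_eq, relaxedCost_self]; simp

theorem relaxedDist_comm [Nonempty D] (η γ : MPPlan μ) : relaxedDist η γ = relaxedDist γ η := by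
  rw [relaxedDist_eq, relaxedDist_eq, relaxedCost_comm]

/-- The pair of (label, position) at times 0 and 1 is a coupling in which the label does not move,
and `d² / 2` between endpoints is at most the action. -/
theorem wasserstein₂_le_relaxedDist [Nonempty D] (η γ : MPPlan μ) :
    wasserstein₂ η.plan γ.plan ≤ relaxedDist η γ := by
  rw [relaxedDist_eq]
  refine ENNReal.rpow_le_rpow ?_ (by norm_num)
  refine le_iInf₂ fun Q hQ => ?_
  have hmm : Measurable fun p : PathSpace D × D => ((p.2, p.1 0), (p.2, p.1 1)) :=
    (PathSpace.measurable_label_eval 0).prodMk (PathSpace.measurable_label_eval 1)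
  refine (iInf₂_le (Q.map fun p => ((p.2, p.1 0), (p.2, p.1 1))) ?_).trans ?_
  · rw [Measure.map_map measurable_fst hmm, ← hQ.initial]; rfl
  · refine (iInf_le _ ?_).trans ?_
    · rw [Measure.map_map measurable_snd hmm, ← hQ.final]; rfl
    · refine (lintegral_map_le _ _).trans (lintegral_mono fun p => ?_)
      have h := edist_sq_le_pathAction p.1 0 1
      simp only [edist_self]
      rw [zero_pow two_ne_zero, ENNReal.zero_div, zero_add]
      refine ENNReal.div_le_of_le_mul ?_
      simpa [Subtype.dist_eq, mul_comm] using h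

end

/-! ### Right invariance -/

section
variable {D : Type*} [MeasurableSpace D] {μ : Measure D}

theorem map_compProd_comap {X : Type*} [MeasurableSpace X] [SFinite μ] (κ : Kernel D X)
    [IsMarkovKernel κ] {h : D → D} (hh : MeasurePreserving h μ μ) :
    (μ ⊗ₘ κ.comap h hh.measurable).map (Prod.map h id) = μ ⊗ₘ κ := by
  have hm : Measurable (Prod.map h (id : X → X)) := hh.measurable.prodMap measurable_id
  ext s hs
  rw [Measure.map_apply hm hs, Measure.compProd_apply (hm hs), Measure.compProd_apply hs,
    ← hh.lintegral_comp (Kernel.measurable_kernel_prodMk_left hs)]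
  rfl

theorem map_snd_compProd_comap {X : Type*} [MeasurableSpace X] [SFinite μ] (κ : Kernel D X)
    [IsMarkovKernel κ] {h : D → D} (hh : MeasurePreserving h μ μ) :
    (μ ⊗ₘ κ.comap h hh.measurable).map Prod.snd = (μ ⊗ₘ κ).map Prod.snd := by
  rw [← map_compProd_comap κ hh, Measure.map_map measurable_snd
    (hh.measurable.prodMap measurable_id)]
  rfl

theorem MPPlan.compProd_condKernel [StandardBorelSpace D] [Nonempty D] (η : MPPlan μ) :
    μ ⊗ₘ (η.plan : Measure (D × D)).condKernel = (η.plan : Measure (D × D)) := by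
  have := Measure.disintegrate (η.plan : Measure (D × D)) (η.plan : Measure (D × D)).condKernel
  rwa [show (η.plan : Measure (D × D)).fst = μ from η.map_fst] at this

theorem MPPlan.map_rightComp [StandardBorelSpace D] [Nonempty D] (η : MPPlan μ) {h : D → D}
    (hh : MeasurePreserving h μ μ) :
    ((η.rightComp h hh).plan : Measure (D × D)).map (Prod.map h id) =
      (η.plan : Measure (D × D)) := by
  have := η.isProbabilityMeasure
  exact (map_compProd_comap _ hh).trans η.compProd_condKernel

end

section
variable {D : Type*} [MetricSpace D] [MeasurableSpace D] [BorelSpace D] [CompactSpace D] [Nonempty D]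
  {μ : Measure D}

/-- Replacing each label `a` by `h a` in a flow between the composed plans gives a flow between `η`
and `γ` along the same paths. -/
theorem relaxedCost_le_rightComp (η γ : MPPlan μ) {h : D → D} (hh : MeasurePreserving h μ μ) :
    relaxedCost η γ ≤ relaxedCost (η.rightComp h hh) (γ.rightComp h hh) := by
  refine le_iInf₂ fun Q hQ => ?_
  have hm : Measurable (Prod.map h (id : D → D)) := hh.measurable.prodMap measurable_id
  refine relaxedCost_le_of_model Q measurable_fst (hh.measurable.comp measurable_snd)
    hQ.incompressible ?_ ?_
  · rw [← η.map_rightComp hh, ← hQ.initial, Measure.map_map hm (PathSpace.measurable_label_eval 0)]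
    rfl
  · rw [← γ.map_rightComp hh, ← hQ.final, Measure.map_map hm (PathSpace.measurable_label_eval 1)]
    rfl

/-- With `Q = Q_a ⊗ μ`, the flow `Q_{h(a)} ⊗ μ` has the same law of paths, hence the same action.
Its endpoints are the composed plans by almost everywhere uniqueness of disintegrations. -/
theorem relaxedCost_rightComp_le (η γ : MPPlan μ) {h : D → D} (hh : MeasurePreserving h μ μ) :
    relaxedCost (η.rightComp h hh) (γ.rightComp h hh) ≤ relaxedCost η γ := by
  refine le_iInf₂ fun Q hQ => ?_
  have hμ := η.isProbabilityMeasure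
  have := hQ.isProb
  set R₀ := Q.map Prod.swap
  have hR : R₀.map Prod.fst = μ := by
    rw [Measure.map_map measurable_fst measurable_swap, ← hQ.label]; rfl
  have hRs : R₀.map Prod.snd = Q.map Prod.fst := by
    rw [Measure.map_map measurable_snd measurable_swap]; rfl
  have hprob : IsProbabilityMeasure R₀ := Measure.isProbabilityMeasure_map (by fun_prop)
  have hdis : μ ⊗ₘ R₀.condKernel = R₀ := by
    have := R₀.disintegrate R₀.condKernel
    rwa [show R₀.fst = μ from hR] at this
  set P := μ ⊗ₘ R₀.condKernel.comap h hh.measurable with hP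
  have hPs : P.map Prod.snd = Q.map Prod.fst := by
    rw [hP, map_snd_compProd_comap _ hh, hdis, hRs]
  have endpoint : ∀ (θ : MPPlan μ) (t : unitInterval),
      Q.map (fun p => (p.2, p.1 t)) = (θ.plan : Measure (D × D)) →
      P.map (fun p => (p.1, p.2 t)) = ((θ.rightComp h hh).plan : Measure (D × D)) := by
    intro θ t hθ
    have h1 : R₀.condKernel.map (fun c => c t) =ᵐ[μ] (θ.plan : Measure (D × D)).condKernel := by
      have : IsMarkovKernel (R₀.condKernel.map (fun c : PathSpace D => c t)) :=
        Kernel.IsMarkovKernel.map _ (PathSpace.measurable_eval t)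
      refine Kernel.ae_eq_of_compProd_eq ?_
      rw [Measure.compProd_map (PathSpace.measurable_eval t), hdis, θ.compProd_condKernel, ← hθ,
        Measure.map_map (measurable_id.prodMap (PathSpace.measurable_eval t)) measurable_swap]
      rfl
    have h2 : (R₀.condKernel.comap h hh.measurable).map (fun c => c t) =ᵐ[μ]
        (θ.plan : Measure (D × D)).condKernel.comap h hh.measurable := by
      -- Preimages under `h` of null sets are null, so the almost sure identity can be read at `h
      -- a`.
      filter_upwards [hh.quasiMeasurePreserving.ae h1] with a ha
      rw [Kernel.map_apply _ (PathSpace.measurable_eval t), Kernel.comap_apply, Kernel.comap_apply,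
        ← ha, Kernel.map_apply _ (PathSpace.measurable_eval t)]
    have h3 : (μ ⊗ₘ (R₀.condKernel.comap h hh.measurable).map (fun c => c t)) =
        ((θ.rightComp h hh).plan : Measure (D × D)) := Measure.compProd_congr h2
    rw [← h3, Measure.compProd_map (PathSpace.measurable_eval t)]
    rfl
  refine (relaxedCost_le_of_model P measurable_snd measurable_fst (fun t => ?_)
    (endpoint η 0 hQ.initial) (endpoint γ 1 hQ.final)).trans (le_of_eq ?_)
  · have : (fun p : D × PathSpace D => p.2 t) = (fun c : PathSpace D => c t) ∘ Prod.snd := rfl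
    rw [this, ← Measure.map_map (PathSpace.measurable_eval t) measurable_snd, hPs,
      Measure.map_map (PathSpace.measurable_eval t) measurable_fst]
    exact hQ.incompressible t
  · rw [← lintegral_map measurable_pathAction measurable_snd, hPs,
      lintegral_map measurable_pathAction measurable_fst]

theorem relaxedDist_rightComp (η γ : MPPlan μ) {h : D → D} (hh : MeasurePreserving h μ μ) :
    relaxedDist (η.rightComp h hh) (γ.rightComp h hh) = relaxedDist η γ := by
  rw [relaxedDist_eq, relaxedDist_eq, le_antisymm (relaxedCost_rightComp_le η γ hh)
    (relaxedCost_le_rightComp η γ hh)]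

/-! ### Test functions -/

/-- Only the position moves along a flow, so `F` may be merely measurable in the label; this is what
later separates narrow from strong convergence. The constant comes from Cauchy–Schwarz and `d² ≤ 2 *
pathAction`; `L ≠ 0` lets it pass through the infimum. -/
theorem sq_integral_sub_le_relaxedCost (η γ : MPPlan μ) {F : D × D → ℝ} (hF : Measurable F)
    {C : ℝ} (hC : ∀ p, |F p| ≤ C) {L : NNReal} (hL0 : L ≠ 0)
    (hL : ∀ a x y, |F (a, x) - F (a, y)| ≤ L * dist x y) :
    ENNReal.ofReal |∫ p, F p ∂(η.plan : Measure (D × D)) - ∫ p, F p ∂(γ.plan : Measure (D × D))| ^ 2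
      ≤ (2 * L ^ 2) * relaxedCost η γ := by
  rw [relaxedCost, ENNReal.mul_iInf_of_ne (by simpa using hL0) (by finiteness)]
  refine le_iInf fun Q => ?_
  rw [ENNReal.mul_iInf_of_ne (by simpa using hL0) (by finiteness)]
  refine le_iInf fun hQ => ?_
  have := hQ.isProb
  have hint : ∀ t : unitInterval, Integrable (fun p : PathSpace D × D => F (p.2, p.1 t)) Q := by
    intro t
    refine Integrable.of_bound (C := C)
      (hF.comp (PathSpace.measurable_label_eval t)).aestronglyMeasurable ?_
    exact Eventually.of_forall fun p => hC _
  have hlaw : ∀ (θ : MPPlan μ) (t : unitInterval),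
      Q.map (fun p => (p.2, p.1 t)) = (θ.plan : Measure (D × D)) →
      ∫ p, F p ∂(θ.plan : Measure (D × D)) = ∫ p, F (p.2, p.1 t) ∂Q := by
    intro θ t h
    rw [← h, integral_map (PathSpace.measurable_label_eval t).aemeasurable
      hF.aestronglyMeasurable]
  have hed : Measurable fun p : PathSpace D × D => edist (p.1 0) (p.1 1) :=
    (PathSpace.measurable_fst_eval 0).edist (PathSpace.measurable_fst_eval 1)
  have h1 : ENNReal.ofReal |∫ p, F p ∂(η.plan : Measure (D × D)) -
      ∫ p, F p ∂(γ.plan : Measure (D × D))| ≤ L * ∫⁻ p, edist (p.1 0) (p.1 1) ∂Q := by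
    rw [hlaw η 0 hQ.initial, hlaw γ 1 hQ.final, ← integral_sub (hint 0) (hint 1),
      ← Real.enorm_eq_ofReal_abs, ← lintegral_const_mul _ hed]
    refine (enorm_integral_le_lintegral_enorm _).trans (lintegral_mono fun p => ?_)
    rw [Real.enorm_eq_ofReal_abs, edist_dist, ← ENNReal.ofReal_coe_nnreal,
      ← ENNReal.ofReal_mul L.coe_nonneg]
    exact ENNReal.ofReal_le_ofReal (hL _ _ _)
  calc _ ≤ (L * ∫⁻ p, edist (p.1 0) (p.1 1) ∂Q) ^ 2 := by gcongr
    _ = L ^ 2 * (∫⁻ p, edist (p.1 0) (p.1 1) ∂Q) ^ 2 := mul_pow _ _ _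
    _ ≤ L ^ 2 * (Q Set.univ * ∫⁻ p, edist (p.1 0) (p.1 1) ^ 2 ∂Q) := by
        gcongr; exact sq_lintegral_le Q hed.aemeasurable
    _ ≤ L ^ 2 * ∫⁻ p, 2 * pathAction p.1 ∂Q := by
        rw [measure_univ, one_mul]
        gcongr with p
        simpa [Subtype.dist_eq] using edist_sq_le_pathAction p.1 0 1
    _ = _ := by rw [lintegral_const_mul _ measurable_pathAction_fst]; ring

theorem tendsto_plan_of_relaxedDist {u : ℕ → MPPlan μ} {γ : MPPlan μ}
    (h : Tendsto (fun n => relaxedDist (u n) γ) atTop (𝓝 0)) :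
    Tendsto (fun n => (u n).plan) atTop (𝓝 γ.plan) := by
  rw [tendsto_iff_forall_lipschitz_integral_tendsto]
  rintro F - ⟨L, hL⟩
  obtain ⟨C, hC⟩ := isCompact_univ.exists_bound_of_continuousOn hL.continuous.continuousOn
  rw [tendsto_iff_dist_tendsto_zero]
  -- `L + 1` replaces `L` so that the Lipschitz constant is nonzero.
  have hb : ∀ n, ENNReal.ofReal (dist (∫ p, F p ∂((u n).plan : Measure (D × D)))
      (∫ p, F p ∂(γ.plan : Measure (D × D)))) ^ 2 ≤
      (2 * (L + 1 : NNReal) ^ 2) * relaxedDist (u n) γ ^ 2 := by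
    intro n
    rw [relaxedDist_sq, Real.dist_eq]
    refine sq_integral_sub_le_relaxedCost (u n) γ hL.continuous.measurable
      (fun p => hC p (Set.mem_univ p)) (by positivity) fun a x y => ?_
    have := hL.dist_le_mul (a, x) (a, y)
    rw [Real.dist_eq, Prod.dist_eq, dist_self, max_eq_right dist_nonneg] at this
    refine this.trans ?_
    push_cast
    gcongr
    linarith
  have hz : Tendsto (fun n => (2 * ((L + 1 : NNReal) : ℝ≥0∞) ^ 2) * relaxedDist (u n) γ ^ 2) atTop
      (𝓝 0) := by
    have h2 := ENNReal.Tendsto.const_mul (a := 2 * ((L + 1 : NNReal) : ℝ≥0∞) ^ 2)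
      ((ENNReal.continuous_pow 2).tendsto 0 |>.comp h) (Or.inr (by finiteness))
    simpa [Function.comp_def] using h2
  have h3 := tendsto_of_tendsto_of_tendsto_of_le_of_le tendsto_const_nhds hz (fun _ => zero_le) hb
  have h4 := (ENNReal.continuous_rpow_const (y := (1 / 2 : ℝ))).tendsto 0 |>.comp h3
  have h5 : Tendsto (fun n => ENNReal.ofReal (dist (∫ p, F p ∂((u n).plan : Measure (D × D)))
      (∫ p, F p ∂(γ.plan : Measure (D × D))))) atTop (𝓝 0) := by
    refine h4.congr' (Eventually.of_forall fun n => ?_) |>.trans ?_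
    · simp only [Function.comp]
      rw [← ENNReal.rpow_natCast, ← ENNReal.rpow_mul]
      norm_num
    · simp
  have h6 := (ENNReal.tendsto_toReal (by simp : (0 : ℝ≥0∞) ≠ ⊤)).comp h5
  simpa [Function.comp_def, ENNReal.toReal_ofReal dist_nonneg] using h6

theorem eq_of_relaxedDist_eq_zero {η γ : MPPlan μ} (h : relaxedDist η γ = 0) : η = γ := by
  have := tendsto_plan_of_relaxedDist (u := fun _ => η) (γ := γ) (by simp [h])
  exact MPPlan.ext (tendsto_nhds_unique tendsto_const_nhds this)

/-! ### Lower semicontinuity and completeness -/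

-- Portmanteau on the open superlevel sets, integrated by the layer cake formula. Truncation at `k`
-- keeps the function finite, as that formula needs real values.
omit [MetricSpace D] [MeasurableSpace D] [BorelSpace D] [CompactSpace D] [Nonempty D] in
theorem lintegral_le_of_tendsto_of_lowerSemicontinuous {X : Type*} [TopologicalSpace X]
    [MeasurableSpace X] [OpensMeasurableSpace X] [HasOuterApproxClosed X]
    {P : ProbabilityMeasure X} {u : ℕ → ProbabilityMeasure X} (hu : Tendsto u atTop (𝓝 P))
    {f : X → ℝ≥0∞} (hf : LowerSemicontinuous f) {M : ℝ≥0∞}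
    (hM : ∀ n, ∫⁻ x, f x ∂(u n : Measure X) ≤ M) : ∫⁻ x, f x ∂(P : Measure X) ≤ M := by
  have hmeas : Measurable f := hf.measurable
  have htrunc : ∀ k : ℕ, ∫⁻ x, min (f x) k ∂(P : Measure X) ≤ M := by
    intro k
    have hcake : ∀ ν : Measure X, ∫⁻ x, min (f x) k ∂ν =
        ∫⁻ t in Set.Ioi (0 : ℝ), ν {x | ENNReal.ofReal t < min (f x) k} := by
      intro ν
      have hm : Measurable fun x => (min (f x) k).toReal := (hmeas.min measurable_const).ennreal_toReal
      have h := lintegral_eq_lintegral_meas_lt ν (f := fun x => (min (f x) k).toReal)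
        (Eventually.of_forall fun _ => ENNReal.toReal_nonneg) hm.aemeasurable
      have hfin : ∀ x, min (f x) (k : ℝ≥0∞) ≠ ⊤ := fun x =>
        ne_top_of_le_ne_top (ENNReal.natCast_ne_top k) (min_le_right _ _)
      simp only [ENNReal.ofReal_toReal (hfin _)] at h
      rw [h]
      refine setLIntegral_congr_fun measurableSet_Ioi fun t ht => ?_
      congr 1
      ext x
      exact (ENNReal.ofReal_lt_iff_lt_toReal (le_of_lt ht) (hfin x)).symm
    rw [hcake]
    calc ∫⁻ t in Set.Ioi (0 : ℝ), (P : Measure X) {x | ENNReal.ofReal t < min (f x) k}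
        ≤ ∫⁻ t in Set.Ioi (0 : ℝ), liminf (fun n =>
            (u n : Measure X) {x | ENNReal.ofReal t < min (f x) k}) atTop := by
          refine lintegral_mono fun t => ?_
          refine ProbabilityMeasure.le_liminf_measure_open_of_tendsto hu ?_
          have : {x | ENNReal.ofReal t < min (f x) k} =
              {x | ENNReal.ofReal t < f x} ∩ {x | ENNReal.ofReal t < k} := by
            ext x; simp
          rw [this]
          exact (hf.isOpen_preimage _).inter isOpen_const
      _ ≤ liminf (fun n => ∫⁻ t in Set.Ioi (0 : ℝ),
            (u n : Measure X) {x | ENNReal.ofReal t < min (f x) k}) atTop := by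
          refine lintegral_liminf_le fun n => ?_
          refine Antitone.measurable fun s t hst => measure_mono fun x hx => ?_
          exact (ENNReal.ofReal_le_ofReal hst).trans_lt hx
      _ ≤ M := by
          refine liminf_le_of_le (h := fun b hb => ?_)
          obtain ⟨n, hn⟩ := hb.exists
          rw [← hcake] at hn
          exact hn.trans ((lintegral_mono fun x => min_le_left _ _).trans (hM n))
  have hsup : ∀ x, f x = ⨆ k : ℕ, min (f x) k := by
    intro x
    refine le_antisymm (le_of_forall_lt fun c hc => ?_) (iSup_le fun k => min_le_left _ _)
    obtain ⟨k, hk⟩ := ENNReal.exists_nat_gt hc.ne_top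
    exact lt_of_lt_of_le (lt_min hc hk) (le_iSup (fun k : ℕ => min (f x) k) k)
  rw [lintegral_congr hsup, lintegral_iSup (fun k => hmeas.min measurable_const)
    (fun i j hij x => min_le_min le_rfl (by exact_mod_cast hij))]
  exact iSup_le htrunc

omit [MetricSpace D] [MeasurableSpace D] [BorelSpace D] [CompactSpace D] [Nonempty D] in
theorem map_eq_of_tendsto {X Y : Type*} [TopologicalSpace X] [MeasurableSpace X] [BorelSpace X]
    [TopologicalSpace Y] [MeasurableSpace Y] [BorelSpace Y] [HasOuterApproxClosed Y]
    {P : ProbabilityMeasure X} {u : ℕ → ProbabilityMeasure X} (hu : Tendsto u atTop (𝓝 P))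
    {f : X → Y} (hf : Continuous f) {v : ℕ → ProbabilityMeasure Y} {ν : ProbabilityMeasure Y}
    (hv : Tendsto v atTop (𝓝 ν)) (h : ∀ n, (u n : Measure X).map f = (v n : Measure Y)) :
    (P : Measure X).map f = (ν : Measure Y) := by
  have h1 := ProbabilityMeasure.tendsto_map_of_tendsto_of_continuous u P hu hf
  have h2 : (fun n => (u n).map hf.measurable.aemeasurable) = v := by
    ext1 n
    exact Subtype.ext (h n)
  rw [h2] at h1
  have := tendsto_nhds_unique h1 hv
  exact congrArg Subtype.val this

/-- Flows of action below `M` are tight, by Markov's inequality and compactness of the sublevels of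
the action. The constraints on a flow are laws of continuous functions, hence survive in a Prokhorov
limit, and the action is lower semicontinuous. -/
theorem relaxedDist_le_of_tendsto {u v : ℕ → MPPlan μ} {η γ : MPPlan μ}
    (hu : Tendsto (fun n => (u n).plan) atTop (𝓝 η.plan))
    (hv : Tendsto (fun n => (v n).plan) atTop (𝓝 γ.plan)) {r : ℝ≥0∞}
    (h : ∀ n, relaxedDist (u n) (v n) ≤ r) : relaxedDist η γ ≤ r := by
  rw [relaxedDist_le_iff]
  refine le_of_forall_gt_imp_ge_of_dense fun M hM => ?_
  by_cases hMt : M = ⊤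
  · rw [hMt]; exact le_top
  have hM0 : M ≠ 0 := (pos_of_gt hM).ne'
  have hQ : ∀ n, ∃ Q, IsGeneralizedFlow (u n) (v n) Q ∧ ∫⁻ p, pathAction p.1 ∂Q < M := fun n =>
    exists_flow_of_relaxedCost_lt ((relaxedDist_le_iff.mp (h n)).trans_lt hM)
  choose Q hQ hQM using hQ
  let Q' : ℕ → ProbabilityMeasure (PathSpace D × D) := fun n => ⟨Q n, (hQ n).isProb⟩
  have htight : IsTightMeasureSet {((ν : ProbabilityMeasure (PathSpace D × D)) :
      Measure (PathSpace D × D)) | ν ∈ Set.range Q'} := by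
    rw [isTightMeasureSet_iff_exists_isCompact_measure_compl_le]
    intro ε hε
    by_cases hεt : ε = ⊤
    · exact ⟨∅, isCompact_empty, fun ν _ => by rw [hεt]; exact le_top⟩
    have hMe : M / ε ≠ ⊤ := ENNReal.div_ne_top hMt hε.ne'
    refine ⟨{c : PathSpace D | pathAction c ≤ M / ε} ×ˢ Set.univ,
      (isCompact_pathAction_le hMe).prod isCompact_univ, ?_⟩
    rintro _ ⟨_, ⟨n, rfl⟩, rfl⟩
    have hsub : ({c : PathSpace D | pathAction c ≤ M / ε} ×ˢ (Set.univ : Set D))ᶜ ⊆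
        {p | M / ε ≤ pathAction p.1} := by
      intro p hp
      simp only [Set.mem_compl_iff, Set.mem_prod, Set.mem_univ, and_true, Set.mem_ofPred_eq,
        not_le] at hp
      exact hp.le
    refine (measure_mono hsub).trans ?_
    refine (meas_ge_le_lintegral_div measurable_pathAction_fst.aemeasurable
      (ENNReal.div_ne_zero.mpr ⟨hM0, hεt⟩) hMe).trans ?_
    refine (ENNReal.div_le_div_right (hQM n).le _).trans (le_of_eq ?_)
    rw [ENNReal.div_eq_inv_mul, ENNReal.inv_div (Or.inl hεt) (Or.inl hε.ne'),
      ENNReal.div_mul_cancel hM0 hMt]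
  have hcomp := isCompact_closure_of_isTightMeasureSet htight
  obtain ⟨Q₀, -, φ, hφ, hlim⟩ := hcomp.tendsto_subseq
    (fun n => subset_closure (Set.mem_range_self (f := Q') n))
  have hμ := η.isProbabilityMeasure
  let μ' : ProbabilityMeasure D := ⟨μ, hμ⟩
  have hconst : Tendsto (fun _ : ℕ => μ') atTop (𝓝 μ') := tendsto_const_nhds
  have hcl : ∀ t : unitInterval, Continuous fun p : PathSpace D × D => (p.2, p.1 t) := fun t =>
    continuous_snd.prodMk ((continuous_eval_const t).comp continuous_fst)
  have hflow : IsGeneralizedFlow η γ (Q₀ : Measure (PathSpace D × D)) := by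
    refine ⟨inferInstance, ?_, fun t => ?_, ?_, ?_⟩
    · exact map_eq_of_tendsto hlim continuous_snd hconst fun n => (hQ (φ n)).label
    · exact map_eq_of_tendsto hlim ((continuous_eval_const t).comp continuous_fst) hconst fun n =>
        (hQ (φ n)).incompressible t
    · exact map_eq_of_tendsto hlim (hcl 0) (hu.comp hφ.tendsto_atTop) fun n => (hQ (φ n)).initial
    · exact map_eq_of_tendsto hlim (hcl 1) (hv.comp hφ.tendsto_atTop) fun n => (hQ (φ n)).final
  refine hflow.relaxedCost_le.trans ?_
  exact lintegral_le_of_tendsto_of_lowerSemicontinuous hlim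
    (lowerSemicontinuous_pathAction.comp continuous_fst) fun n => (hQM (φ n)).le

omit [Nonempty D] in
theorem MPPlan.exists_subseq_tendsto (u : ℕ → MPPlan μ) :
    ∃ (γ : MPPlan μ) (φ : ℕ → ℕ), StrictMono φ ∧
      Tendsto (fun n => (u (φ n)).plan) atTop (𝓝 γ.plan) := by
  obtain ⟨P, -, φ, hφ, hlim⟩ := isCompact_univ.tendsto_subseq
    (x := fun n => (u n).plan) (fun n => Set.mem_univ _)
  have hμ := (u 0).isProbabilityMeasure
  let μ' : ProbabilityMeasure D := ⟨μ, hμ⟩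
  have hconst : Tendsto (fun _ : ℕ => μ') atTop (𝓝 μ') := tendsto_const_nhds
  exact ⟨⟨P, map_eq_of_tendsto hlim continuous_fst hconst fun n => (u (φ n)).map_fst,
    map_eq_of_tendsto hlim continuous_snd hconst fun n => (u (φ n)).map_snd⟩, φ, hφ, hlim⟩

theorem exists_relaxedDist_le_of_cauchy {u : ℕ → MPPlan μ} {B : ℕ → ℝ≥0∞}
    (h : ∀ N n m, N ≤ n → N ≤ m → relaxedDist (u n) (u m) ≤ B N) :
    ∃ γ : MPPlan μ, ∀ N n, N ≤ n → relaxedDist (u n) γ ≤ B N := by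
  obtain ⟨γ, φ, hφ, hlim⟩ := MPPlan.exists_subseq_tendsto u
  refine ⟨γ, fun N n hn => ?_⟩
  -- The shift by `N` ensures that every index of the subsequence is at least `N`.
  have hlim' := hlim.comp (tendsto_add_atTop_nat N)
  exact relaxedDist_le_of_tendsto (u := fun _ => u n) tendsto_const_nhds hlim' fun m =>
    h N n _ hn ((Nat.le_add_left N m).trans (hφ.le_apply))

end

/-! ### Charts of a Riemannian manifold are locally bi-Lipschitz. -/

section ChartLipschitz

open Manifold Metric Set Bundle
open scoped NNReal

variable {E : Type*} [NormedAddCommGroup E] [NormedSpace ℝ E]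
  {H : Type*} [TopologicalSpace H] {I : ModelWithCorners ℝ E H}
  {M : Type*} [PseudoEMetricSpace M] [ChartedSpace H M]
  [Bundle.RiemannianBundle (fun (x : M) ↦ TangentSpace I x)]
  [IsManifold I 1 M] [IsContinuousRiemannianBundle E (fun (x : M) ↦ TangentSpace I x)]

attribute [local instance] normedAddCommGroupTangentSpaceVectorSpace
attribute [local instance] normedSpaceTangentSpaceVectorSpace

variable (I)

theorem eventually_enorm_mfderivWithin_symm_extChartAt_apply_le (x : M) :
    ∃ C : ℝ≥0, ∀ᶠ y in 𝓝[range I] (extChartAt I x x), ∀ v : TangentSpace 𝓘(ℝ, E) y,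
      ‖mfderiv[range I] (extChartAt I x).symm y v‖ₑ ≤ C * ‖v‖ₑ := by
  rcases eventually_enorm_mfderivWithin_symm_extChartAt_lt I x with ⟨C, -, hC⟩
  refine ⟨C, hC.mono fun y hy v => ?_⟩
  refine (ContinuousLinearMap.le_opENorm _ v).trans ?_
  exact mul_le_mul_left hy.le _

theorem eventually_enorm_mfderiv_extChartAt_apply_le (x : M) :
    ∃ C : ℝ≥0, ∀ᶠ y in 𝓝 x, ∀ v : TangentSpace I y,
      ‖mfderiv% (extChartAt I x) y v‖ₑ ≤ C * ‖v‖ₑ := by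
  rcases eventually_enorm_mfderiv_extChartAt_lt I x with ⟨C, -, hC⟩
  refine ⟨C, hC.mono fun y hy v => ?_⟩
  refine (ContinuousLinearMap.le_opENorm _ v).trans ?_
  exact mul_le_mul_left hy.le _

variable [IsRiemannianManifold I M]

/-- The inverse of an extended chart is locally Lipschitz for the Riemannian distance. -/
theorem exists_ball_edist_extChartAt_symm_le [I.Boundaryless] (x : M) :
    ∃ C : ℝ≥0, ∃ r > 0, ball (extChartAt I x x) r ⊆ (extChartAt I x).target ∧
      ∀ y ∈ ball (extChartAt I x x) r, ∀ z ∈ ball (extChartAt I x x) r,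
        edist ((extChartAt I x).symm y) ((extChartAt I x).symm z) ≤ C * edist y z := by
  rcases eventually_enorm_mfderivWithin_symm_extChartAt_apply_le I x with ⟨C, hC⟩
  obtain ⟨r, r_pos, hr⟩ : ∃ r > 0,
      ball (extChartAt I x x) r ∩ range I ⊆ (extChartAt I x).target ∩
        {y | ∀ v : TangentSpace 𝓘(ℝ, E) y,
          ‖mfderiv[range I] (extChartAt I x).symm y v‖ₑ ≤ C * ‖v‖ₑ} :=
    mem_nhdsWithin_iff.1 (inter_mem (extChartAt_target_mem_nhdsWithin x) hC)
  rw [I.range_eq_univ, inter_univ] at hr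
  refine ⟨C, r, r_pos, fun y hy => (hr hy).1, fun y hy z hz => ?_⟩
  -- The Riemannian distance is bounded by the length of the image of a straight segment, which
  -- stays in the ball by convexity.
  let η := ContinuousAffineMap.lineMap (R := ℝ) y z
  set γ := (extChartAt I x).symm ∘ η
  have hη : Icc 0 1 ⊆ ⇑η ⁻¹' ((extChartAt I x).target ∩
        {y | ∀ v : TangentSpace 𝓘(ℝ, E) y,
          ‖mfderiv[range I] (extChartAt I x).symm y v‖ₑ ≤ C * ‖v‖ₑ}) := by
    simp only [← image_subset_iff, ContinuousAffineMap.coe_lineMap_eq,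
     ← segment_eq_image_lineMap, η]
    rw [I.range_eq_univ]
    apply Subset.trans _ hr
    exact (convex_ball _ _).segment_subset hy hz
  simp only [preimage_inter, subset_inter_iff] at hη
  have η_smooth : CMDiff[Icc 0 1] 1 η := by
    apply ContMDiff.contMDiffOn
    rw [contMDiff_iff_contDiff]
    exact ContinuousAffineMap.contDiff _
  have : riemannianEDist I ((extChartAt I x).symm y) ((extChartAt I x).symm z)
      ≤ pathELength I γ 0 1 := by
    apply riemannianEDist_le_pathELength _ _ _ zero_le_one
    · exact (contMDiffOn_extChartAt_symm x).comp η_smooth hη.1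
    · simp [γ, η, ContinuousAffineMap.coe_lineMap_eq]
    · simp [γ, η, ContinuousAffineMap.coe_lineMap_eq]
  rw [IsRiemannianManifold.out (I := I)]
  apply this.trans
  rw [← lintegral_fderiv_lineMap_eq_edist, pathELength_eq_lintegral_mfderivWithin_Icc,
    ← lintegral_const_mul' _ _ ENNReal.coe_ne_top]
  apply setLIntegral_mono' measurableSet_Icc (fun t ht ↦ ?_)
  have : mfderiv[Icc 0 1] γ t =
      (mfderiv[range I] (extChartAt I x).symm (η t)) ∘L (mfderiv[Icc 0 1] η t) := by
    apply mfderivWithin_comp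
    · exact mdifferentiableWithinAt_extChartAt_symm (hη.1 ht)
    · exact η_smooth.mdifferentiableOn one_ne_zero t ht
    · exact hη.1.trans (preimage_mono (extChartAt_target_subset_range x))
    · rw [uniqueMDiffWithinAt_iff_uniqueDiffWithinAt]
      exact uniqueDiffOn_Icc zero_lt_one t ht
  have : mfderiv[Icc 0 1] γ t 1 =
      (mfderiv[range I] (extChartAt I x).symm (η t)) (mfderiv[Icc 0 1] η t 1) := congr($this 1)
  rw [this]
  apply (hη.2 ht _).trans
  gcongr
  simp only [mfderivWithin_eq_fderivWithin]
  exact le_of_eq rfl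

/-- An extended chart is locally Lipschitz for the Riemannian distance. -/
theorem exists_mem_nhds_edist_extChartAt_le (x : M) :
    ∃ C : ℝ≥0, ∃ U ∈ 𝓝 x, U ⊆ (extChartAt I x).source ∧ ∀ y ∈ U, ∀ z ∈ U,
      edist (extChartAt I x y) (extChartAt I x z) ≤ C * edist y z := by
  rcases eventually_enorm_mfderiv_extChartAt_apply_le I x with ⟨C, hC⟩
  obtain ⟨ρ, ρ_pos, hρ⟩ := EMetric.mem_nhds_iff.1
    (inter_mem hC (extChartAt_source_mem_nhds (I := I) x))
  -- With `y` and `z` within `ρ / 3` of `x`, an almost minimizing curve from `y` to `z` has length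
  -- below `2ρ / 3`, so it remains in the ball of radius `ρ` where the derivative bound holds.
  have hρ3 : ρ / 3 ≤ ρ := ENNReal.div_le_of_le_mul (le_mul_of_one_le_right' (by norm_num))
  have hρ0 : 0 < ρ / 3 := ENNReal.div_pos ρ_pos.ne' (by norm_num)
  refine ⟨C, Metric.eball x (ρ / 3), Metric.eball_mem_nhds _ hρ0,
    (Metric.eball_subset_eball hρ3).trans (hρ.trans inter_subset_right), fun y hy z hz => ?_⟩
  rw [Metric.mem_eball] at hy hz
  have hyz : edist y z < ρ / 3 + ρ / 3 := by
    refine (edist_triangle_right y z x).trans_lt (ENNReal.add_lt_add hy hz)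
  have key : ∀ L, edist y z < L → L ≤ ρ / 3 + ρ / 3 →
      edist (extChartAt I x y) (extChartAt I x z) ≤ C * L := by
    intro L hL hLρ
    rw [IsRiemannianManifold.out (I := I)] at hL
    rcases exists_lt_locally_constant_of_riemannianEDist_lt hL zero_lt_one
      with ⟨γ, hγx, hγy, γ_smooth, hγ, -⟩
    have hmem : ∀ t ∈ Icc (0 : ℝ) 1, γ t ∈ {y | ∀ v : TangentSpace I y,
        ‖mfderiv% (extChartAt I x) y v‖ₑ ≤ C * ‖v‖ₑ} ∩
        (extChartAt I x).source := by
      intro t ht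
      apply hρ
      have h1 : edist y (γ t) < ρ / 3 + ρ / 3 := by
        rw [IsRiemannianManifold.out (I := I)]
        calc riemannianEDist I y (γ t) ≤ pathELength I γ 0 t :=
              riemannianEDist_le_pathELength γ_smooth.contMDiffOn hγx rfl ht.1
          _ ≤ pathELength I γ 0 1 := pathELength_mono le_rfl ht.2
          _ < L := hγ
          _ ≤ _ := hLρ
      rw [Metric.mem_eball, edist_comm]
      calc edist x (γ t) ≤ edist x y + edist y (γ t) := edist_triangle _ _ _
        _ < ρ / 3 + (ρ / 3 + ρ / 3) := ENNReal.add_lt_add (by rwa [edist_comm]) h1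
        _ = ρ := by rw [← add_assoc, ENNReal.add_thirds]
    have uc' : ∀ t ∈ Icc (0 : ℝ) 1, γ t ∈ (chartAt H x).source := by
      intro t ht
      simpa [extChartAt_source I x] using (hmem t ht).2
    let γ' := extChartAt I x ∘ γ
    have hC' : CMDiff[Icc 0 1] 1 γ' :=
      contMDiffOn_extChartAt.comp (I' := I) (t := (chartAt H x).source)
        γ_smooth.contMDiffOn uc'
    have hs : UniqueDiffOn ℝ (Icc (0 : ℝ) 1) := uniqueDiffOn_Icc zero_lt_one
    rw [edist_comm]
    calc
      edist (extChartAt I x z) (extChartAt I x y)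
      _ = ‖γ' 1 - γ' 0‖ₑ := by simp [γ', hγx, hγy, edist_eq_enorm_sub]
      _ ≤ ∫⁻ t' in Icc 0 1, ‖derivWithin γ' (Icc 0 1) t'‖ₑ := by
        apply enorm_sub_le_lintegral_derivWithin_Icc_of_contDiffOn_Icc _ zero_le_one
        rwa [← contMDiffOn_iff_contDiffOn]
      _ = ∫⁻ t' in Icc 0 1, ‖mfderiv[Icc 0 1] γ' t' 1‖ₑ := by
        simp_rw [← fderivWithin_derivWithin, mfderivWithin_eq_fderivWithin]
        rfl
      _ ≤ ∫⁻ t' in Icc 0 1, C * ‖mfderiv[Icc 0 1] γ t' 1‖ₑ := by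
        apply setLIntegral_mono' measurableSet_Icc (fun t' ht' ↦ ?_)
        have : mfderiv[Icc 0 1] γ' t' =
            (mfderiv% (extChartAt I x) (γ t')) ∘L (mfderiv[Icc 0 1] γ t') := by
          apply mfderiv_comp_mfderivWithin
          · exact mdifferentiableAt_extChartAt (uc' _ ht')
          · exact (γ_smooth.mdifferentiable one_ne_zero).mdifferentiableOn _ ht'
          · rw [uniqueMDiffWithinAt_iff_uniqueDiffWithinAt]
            exact hs _ ht'
        have : mfderiv[Icc 0 1] γ' t' 1 =
            (mfderiv% (extChartAt I x) (γ t')) (mfderiv[Icc 0 1] γ t' 1) :=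
          congr($this 1)
        rw [this]
        exact (hmem t' ht').1 _
      _ = C * pathELength I γ 0 1 := by
        rw [lintegral_const_mul' _ _ ENNReal.coe_ne_top,
            pathELength_eq_lintegral_mfderivWithin_Icc]
      _ ≤ C * L := by gcongr
  have hlim : Tendsto (fun L => (C : ℝ≥0∞) * L) (𝓝[>] (edist y z)) (𝓝 (C * edist y z)) :=
    (ENNReal.Tendsto.const_mul tendsto_id (Or.inr ENNReal.coe_ne_top)).mono_left nhdsWithin_le_nhds
  have : (𝓝[>] (edist y z)).NeBot := nhdsGT_neBot_of_exists_gt ⟨_, hyz⟩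
  refine ge_of_tendsto hlim ?_
  filter_upwards [Ioo_mem_nhdsGT hyz] with L hL using key L hL.1 hL.2.le
end ChartLipschitz

/-! ### Straight paths in the torus -/

/-- The `d`-dimensional flat torus. -/
abbrev Torus (d : ℕ) : Type := Fin d → UnitAddCircle

instance : IsProbabilityMeasure (volume : Measure UnitAddCircle) := ⟨UnitAddCircle.measure_univ⟩

/-- The geodesic `t ↦ θ + t v`, where `v` is lifted to `(0,1]^d`. -/
noncomputable def torusPath {d : ℕ} (θ v : Torus d) (t : ℝ) : Torus d :=
  fun i => θ i + ((t * (AddCircle.measurableEquivIoc 1 0 (v i) : ℝ) : ℝ) : UnitAddCircle)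

theorem torusPath_zero {d : ℕ} (θ v : Torus d) : torusPath θ v 0 = θ := by
  ext i; simp [torusPath]

theorem torusPath_one {d : ℕ} (θ v : Torus d) : torusPath θ v 1 = θ + v := by
  ext i
  simp only [torusPath, one_mul, Pi.add_apply]
  congr 1
  exact AddCircle.coe_equivIoc

theorem lipschitzWith_torusPath {d : ℕ} (θ v : Torus d) : LipschitzWith 1 (torusPath θ v) := by
  refine LipschitzWith.of_dist_le_mul fun s t => ?_
  refine (dist_pi_le_iff (by positivity)).2 fun i => ?_
  set x : ℝ := (AddCircle.measurableEquivIoc 1 0 (v i) : ℝ) with hx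
  have hx01 : x ∈ Set.Ioc (0 : ℝ) (0 + 1) := (AddCircle.measurableEquivIoc 1 0 (v i)).2
  have h1 : torusPath θ v s i - torusPath θ v t i = (((s - t) * x : ℝ) : UnitAddCircle) := by
    simp only [torusPath, ← hx, add_sub_add_left_eq_sub, sub_mul, AddCircle.coe_sub]
  rw [dist_eq_norm, h1]
  have h2 : ‖(((s - t) * x : ℝ) : UnitAddCircle)‖ ≤ |(s - t) * x| := by
    exact QuotientAddGroup.norm_mk_le_norm
  refine h2.trans ?_
  rw [abs_mul, abs_of_pos hx01.1, NNReal.coe_one, one_mul, Real.dist_eq]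
  exact mul_le_of_le_one_right (abs_nonneg _) (by linarith [hx01.2])

theorem measurable_torusPath {d : ℕ} (t : ℝ) :
    Measurable fun p : Torus d × Torus d => torusPath p.1 p.2 t := by
  refine measurable_pi_lambda _ fun i => ?_
  refine Measurable.add (by fun_prop) ?_
  refine AddCircle.measurable_mk'.comp (Measurable.const_mul ?_ t)
  exact measurable_subtype_coe.comp
    ((AddCircle.measurableEquivIoc 1 0).measurable.comp (by fun_prop))

/-- For a fixed displacement `v`, the motion up to time `t` is a translation, which preserves Haar
measure. This is the source of incompressibility. -/
theorem map_torusPath {d : ℕ} (t : ℝ) (ρ : Measure (Torus d)) [SFinite ρ] (c : ℝ≥0∞)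
    (hρ : ρ = c • volume) :
    (ρ.prod volume).map (fun p : Torus d × Torus d => torusPath p.1 p.2 t) = c • volume := by
  subst hρ
  ext s hs
  rw [Measure.map_apply (measurable_torusPath t) hs, Measure.prod_smul_left, Measure.smul_apply,
    Measure.prod_apply_symm (measurable_torusPath t hs), Measure.smul_apply]
  have : ∀ v : Torus d, volume ((fun θ => (θ, v)) ⁻¹'
      ((fun p : Torus d × Torus d => torusPath p.1 p.2 t) ⁻¹' s)) = volume s := by
    intro v
    exact measure_preimage_add_right volume
      (fun i => ((t * (AddCircle.measurableEquivIoc 1 0 (v i) : ℝ) : ℝ) : UnitAddCircle)) s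
  simp [this]

/-! ### Plans given by a measure -/

section Plans

variable {D : Type*} [MeasurableSpace D] {μ : Measure D}

/-- The plan given by a measure with the right marginals. -/
noncomputable def MPPlan.ofMeasure [IsProbabilityMeasure μ] (m : Measure (D × D))
    (h₁ : m.map Prod.fst = μ) (h₂ : m.map Prod.snd = μ) : MPPlan μ where
  plan := ⟨m, ⟨by
    have := congrArg (fun ν : Measure D => ν Set.univ) h₁
    simpa [Measure.map_apply measurable_fst MeasurableSet.univ] using this⟩⟩
  map_fst := h₁
  map_snd := h₂

/-- The product plan, in which the label and the position are independent. -/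
noncomputable def MPPlan.product (μ : Measure D) [IsProbabilityMeasure μ] : MPPlan μ :=
  MPPlan.ofMeasure (μ.prod μ)
    (by rw [Measure.map_fst_prod]; simp) (by rw [Measure.map_snd_prod]; simp)

/-- Convex combination of two plans. -/
noncomputable def MPPlan.mix [IsProbabilityMeasure μ] (p q : ℝ≥0∞) (h : p + q = 1)
    (η γ : MPPlan μ) : MPPlan μ :=
  MPPlan.ofMeasure (p • (η.plan : Measure (D × D)) + q • (γ.plan : Measure (D × D)))
    (by rw [Measure.map_add _ _ measurable_fst, Measure.map_smul, Measure.map_smul, η.map_fst,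
          γ.map_fst, ← add_smul, h, one_smul])
    (by rw [Measure.map_add _ _ measurable_snd, Measure.map_smul, Measure.map_smul, η.map_snd,
          γ.map_snd, ← add_smul, h, one_smul])

theorem map_withDensity_comp {X Y : Type*} [MeasurableSpace X] [MeasurableSpace Y] (m : Measure X)
    {f : X → Y} (hf : Measurable f) {g : Y → ℝ≥0∞} (hg : Measurable g) :
    (m.withDensity fun x => g (f x)).map f = (m.map f).withDensity g := by
  ext s hs
  rw [Measure.map_apply hf hs, withDensity_apply _ (hf hs), withDensity_apply _ hs,
    setLIntegral_map hs hg hf]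

theorem MPPlan.map_snd_withDensity (η : MPPlan μ) {g : D → ℝ≥0∞} (hg : Measurable g) :
    ((η.plan : Measure (D × D)).withDensity fun p => g p.2).map Prod.snd = μ.withDensity g := by
  rw [map_withDensity_comp _ measurable_snd hg, η.map_snd]

end Plans

/-! ### Making part of the mass independent of the label. -/

section Mixing

variable {D : Type*} [MetricSpace D] [CompactSpace D] [MeasurableSpace D]
  [BorelSpace D] {μ : Measure D}

theorem measurable_const_path : Measurable
    (fun p : D × D => ((ContinuousMap.const unitInterval p.2 : PathSpace D), p.1)) :=
  (measurable_pathSpace_of_eval fun _ => measurable_snd).prodMk measurable_fst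

variable [Nonempty D]

/-- A flow in which the part `m` of the mass stays at rest. -/
theorem relaxedCost_le_of_partial_model {S : Type*} [MeasurableSpace S] (m : Measure (D × D))
    (P : Measure S) {Φ : S → PathSpace D} {a : S → D} (hΦ : Measurable Φ) (ha : Measurable a)
    {η γ : MPPlan μ} (hinc : ∀ t, m.map Prod.snd + P.map (fun s => Φ s t) = μ)
    (h0 : m + P.map (fun s => (a s, Φ s 0)) = (η.plan : Measure (D × D)))
    (h1 : m + P.map (fun s => (a s, Φ s 1)) = (γ.plan : Measure (D × D))) :
    relaxedCost η γ ≤ ∫⁻ s, pathAction (Φ s) ∂P := by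
  have hm : Measurable fun s => (Φ s, a s) := hΦ.prodMk ha
  have key : ∀ t : unitInterval, (m.map (fun p : D × D =>
      ((ContinuousMap.const unitInterval p.2 : PathSpace D), p.1)) +
      P.map (fun s => (Φ s, a s))).map (fun p => (p.2, p.1 t)) =
        m + P.map (fun s => (a s, Φ s t)) := by
    intro t
    rw [Measure.map_add _ _ (PathSpace.measurable_label_eval t),
      Measure.map_map (PathSpace.measurable_label_eval t) measurable_const_path,
      Measure.map_map (PathSpace.measurable_label_eval t) hm]
    congr 1
    exact Measure.map_id
  refine (relaxedCost_le_of_model (η := η) (γ := γ) (m.map (fun p : D × D =>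
    ((ContinuousMap.const unitInterval p.2 : PathSpace D), p.1)) +
    P.map (fun s => (Φ s, a s))) measurable_fst measurable_snd (fun t => ?_)
    ((key 0).trans h0) ((key 1).trans h1)).trans (le_of_eq ?_)
  · rw [Measure.map_add _ _ (PathSpace.measurable_fst_eval t),
      Measure.map_map (PathSpace.measurable_fst_eval t) measurable_const_path,
      Measure.map_map (PathSpace.measurable_fst_eval t) hm]
    exact hinc t
  · rw [lintegral_add_measure, lintegral_map measurable_pathAction_fst measurable_const_path,
      lintegral_map measurable_pathAction_fst hm]
    simp [pathAction_const]

variable [IsProbabilityMeasure μ]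

/-- The part `p θ` stays at rest while the part of weight `q` follows a flow from `η` to `γ`; the
action is multiplied by `q`. -/
theorem relaxedCost_mix_le (p q : ℝ≥0∞) (h : p + q = 1) (θ η γ : MPPlan μ) :
    relaxedCost (MPPlan.mix p q h θ η) (MPPlan.mix p q h θ γ) ≤ q * relaxedCost η γ := by
  have hq : q ≠ ⊤ := fun hq => by simp [hq] at h
  rcases eq_or_ne q 0 with rfl | hq0
  · have : MPPlan.mix p 0 h θ η = MPPlan.mix p 0 h θ γ := by
      refine MPPlan.ext (Subtype.ext ?_)
      change p • (θ.plan : Measure (D × D)) + (0 : ℝ≥0∞) • (η.plan : Measure (D × D)) =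
        p • (θ.plan : Measure (D × D)) + (0 : ℝ≥0∞) • (γ.plan : Measure (D × D))
      rw [zero_smul, zero_smul]
    rw [this, relaxedCost_self]
    exact zero_le
  rw [mul_comm, ← ENNReal.div_le_iff hq0 hq]
  refine le_iInf₂ fun Q hQ => ?_
  rw [ENNReal.div_le_iff hq0 hq, mul_comm, ← smul_eq_mul, ← lintegral_smul_measure]
  refine relaxedCost_le_of_partial_model (p • (θ.plan : Measure (D × D))) (q • Q)
    measurable_fst measurable_snd (fun t => ?_) ?_ ?_
  · rw [Measure.map_smul, Measure.map_smul, θ.map_snd, hQ.incompressible, ← add_smul, h, one_smul]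
  · rw [Measure.map_smul, hQ.initial]; rfl
  · rw [Measure.map_smul, hQ.final]; rfl

/-- The mass at `x` is moved, for a proportion `g x`, along straight paths in the image of a
torus, so that it gets independent of the label. -/
theorem exists_torus_move {d : ℕ} {ψ : Torus d → D} {L : NNReal} (hψ : LipschitzWith L ψ)
    {g : D → ℝ≥0∞} (hg : Measurable g) (hg1 : ∀ x, g x ≤ 1) {c : ℝ≥0∞} (hc : c ≤ 1)
    (h : μ.withDensity g = c • volume.map ψ) (η : MPPlan μ) :
    ∃ η' : MPPlan μ, relaxedCost η η' ≤ L ^ 2 / 2 ∧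
      (η'.plan : Measure (D × D)) = (η.plan : Measure (D × D)).withDensity (fun p => 1 - g p.2) +
        (((η.plan : Measure (D × D)).withDensity fun p => g p.2).map Prod.fst).prod
          (volume.map ψ) := by
  have hψm : Measurable ψ := hψ.continuous.measurable
  have hct : c ≠ ⊤ := (hc.trans_lt ENNReal.one_lt_top).ne
  set m₁ := (η.plan : Measure (D × D)).withDensity (fun p => 1 - g p.2) with hm₁
  set m₂ := (η.plan : Measure (D × D)).withDensity (fun p => g p.2) with hm₂
  have hsum : m₁ + m₂ = η.plan := by
    have hg' : Measurable fun p : D × D => g p.2 := hg.comp measurable_snd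
    rw [hm₁, hm₂, ← withDensity_add_right _ hg']
    simp only [Pi.add_def, tsub_add_cancel_of_le (hg1 _)]
    exact withDensity_one
  have : IsFiniteMeasure m₂ := ⟨by
    have : m₂ Set.univ ≤ (m₁ + m₂) Set.univ := by simp
    exact this.trans_lt (by rw [hsum]; simp)⟩
  have hsnd : m₂.map Prod.snd = (c • (volume : Measure (Torus d))).map ψ := by
    rw [Measure.map_smul, ← h, η.map_snd_withDensity hg]
  have : IsFiniteMeasure (c • (volume : Measure (Torus d))) := Measure.smul_finite _ hct
  -- Each moving particle at `x` is given a random parameter `θ` with `ψ θ = x`, such that `θ` has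
  -- law proportional to Haar measure.
  obtain ⟨ρ, hρ₁, hρ₂, hρ⟩ := exists_glue m₂ (c • (volume : Measure (Torus d)))
    measurable_snd hψm hsnd
  have : IsFiniteMeasure ρ := ⟨by
    rw [← Set.preimage_univ (f := Prod.fst), ← Measure.map_apply measurable_fst .univ, hρ₁]
    exact measure_lt_top _ _⟩
  let Φ : ((D × D) × Torus d) × Torus d → PathSpace D := fun s =>
    ⟨fun t => ψ (torusPath s.1.2 s.2 t), hψ.continuous.comp
      ((lipschitzWith_torusPath _ _).continuous.comp continuous_subtype_val)⟩
  have hΦt : ∀ t : unitInterval, Measurable fun s => Φ s t := fun t =>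
    hψm.comp ((measurable_torusPath t).comp
      (f := fun s : ((D × D) × Torus d) × Torus d => (s.1.2, s.2)) (by fun_prop))
  have hΦ : Measurable Φ := measurable_pathSpace_of_eval hΦt
  have ha : Measurable fun s : ((D × D) × Torus d) × Torus d => s.1.1.1 := by fun_prop
  have hA : ∀ s, pathAction (Φ s) ≤ L ^ 2 / 2 := fun s =>
    pathAction_le_of_lipschitzWith (by
      have := hψ.comp ((lipschitzWith_torusPath s.1.2 s.2).comp
        (LipschitzWith.subtype_val (s := Set.Icc (0 : ℝ) 1)))
      rw [mul_one, mul_one] at this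
      exact this)
  set P := ρ.prod (volume : Measure (Torus d)) with hP
  have hinc : ∀ t : unitInterval, P.map (fun s => Φ s t) = c • volume.map ψ := by
    intro t
    have h1 : P.map (Prod.map Prod.snd id) = (c • (volume : Measure (Torus d))).prod volume := by
      rw [hP, ← Measure.map_prod_map _ _ measurable_snd measurable_id, hρ₂, Measure.map_id]
    have h2 := map_torusPath (d := d) t (c • volume) c rfl
    rw [← h1, Measure.map_map (measurable_torusPath t) (by fun_prop)] at h2
    rw [← Measure.map_smul, ← h2,
      Measure.map_map hψm ((measurable_torusPath t).comp (by fun_prop))]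
    rfl
  have hP0 : P.map (fun s => (s.1.1.1, Φ s 0)) = m₂ := by
    have h1 : (fun s : ((D × D) × Torus d) × Torus d => (s.1.1.1, Φ s 0)) =
        (fun s => (s.1.1, ψ s.2)) ∘ Prod.fst := by
      ext s
      · rfl
      · simp [Φ, torusPath_zero]
    have h2 : P.map Prod.fst = ρ := by rw [hP, Measure.map_fst_prod]; simp
    have h3 : Measurable fun s : (D × D) × Torus d => (s.1.1, ψ s.2) :=
      (by fun_prop : Measurable fun s : (D × D) × Torus d => s.1.1).prodMk
        (hψm.comp measurable_snd)
    rw [h1, ← Measure.map_map h3 measurable_fst, h2, ← hρ₁]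
    refine Measure.map_congr (hρ.mono fun s hs => ?_)
    exact Prod.ext rfl hs.symm
  have hP1 : P.map (fun s => (s.1.1.1, Φ s 1)) = (m₂.map Prod.fst).prod (volume.map ψ) := by
    -- The displacement `v` is uniform and independent of the rest, hence so is `θ + v`; the final
    -- position forgets the label.
    have h1 : MeasurePreserving (fun s : ((D × D) × Torus d) × Torus d => (s.1, s.1.2 + s.2))
        P P := (MeasurePreserving.id ρ).skew_product (g := fun s v => s.2 + v)
          (by fun_prop) (Eventually.of_forall fun s => map_add_left_eq_self volume s.2)
    have h2 : (fun s : ((D × D) × Torus d) × Torus d => (s.1.1.1, Φ s 1)) =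
        (Prod.map (fun s : (D × D) × Torus d => s.1.1) ψ) ∘
          (fun s : ((D × D) × Torus d) × Torus d => (s.1, s.1.2 + s.2)) := by
      ext s
      · rfl
      · simp [Φ, torusPath_one]
    rw [h2, ← Measure.map_map (by fun_prop) h1.measurable, h1.map_eq, hP,
      ← Measure.map_prod_map _ _ (by fun_prop) hψm, ← hρ₁,
      Measure.map_map measurable_fst measurable_fst]
    rfl
  have hμ : m₁.map Prod.snd + c • volume.map ψ = μ := by
    rw [← Measure.map_smul, ← hsnd, ← Measure.map_add _ _ measurable_snd, hsum, η.map_snd]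
  have hprob : IsProbabilityMeasure ((volume : Measure (Torus d)).map ψ) :=
    Measure.isProbabilityMeasure_map hψm.aemeasurable
  have hm₂c : m₂ Set.univ = c := by
    rw [← Set.preimage_univ (f := Prod.snd), ← Measure.map_apply measurable_snd .univ, hsnd,
      Measure.map_apply hψm .univ]
    simp
  refine ⟨MPPlan.ofMeasure (m₁ + (m₂.map Prod.fst).prod (volume.map ψ)) ?_ ?_, ?_, rfl⟩
  · rw [Measure.map_add _ _ measurable_fst, Measure.map_fst_prod, measure_univ, one_smul,
      ← Measure.map_add _ _ measurable_fst, hsum, η.map_fst]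
  · rw [Measure.map_add _ _ measurable_snd, Measure.map_snd_prod,
      Measure.map_apply measurable_fst .univ, Set.preimage_univ, hm₂c, hμ]
  · refine (relaxedCost_le_of_partial_model m₁ P hΦ ha (fun t => ?_) ?_ ?_).trans ?_
    · rw [hinc, hμ]
    · rw [hP0, hsum]
    · rw [hP1]; rfl
    · refine (lintegral_mono hA).trans ?_
      rw [lintegral_const]
      refine mul_le_of_le_one_right' ?_
      rw [hP, ← Set.univ_prod_univ, Measure.prod_prod,
        measure_univ (μ := (volume : Measure (Torus d))), mul_one,
        ← Set.preimage_univ (f := Prod.fst), ← Measure.map_apply measurable_fst .univ, hρ₁, hm₂c]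
      exact hc

end Mixing

/-! ### Iteration of a mixing move -/

section Iteration

variable {D : Type*} [MeasurableSpace D] {μ : Measure D} [IsProbabilityMeasure μ]

/-- The remainder `η - ε θ` has both marginals equal to `q μ`, so dividing by `q` gives a plan. -/
theorem exists_eq_mix_of_smul_le {ε q : ℝ≥0∞} (h : ε + q = 1) (hq : q ≠ 0) {θ η : MPPlan μ}
    (hle : ε • (θ.plan : Measure (D × D)) ≤ η.plan) : ∃ ρ, η = MPPlan.mix ε q h θ ρ := by
  have hqt : q ≠ ⊤ := fun hq => by simp [hq] at h
  have hεt : ε ≠ ⊤ := fun hq => by simp [hq] at h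
  have : IsFiniteMeasure (ε • (θ.plan : Measure (D × D))) := Measure.smul_finite _ hεt
  set m := (η.plan : Measure (D × D)) - ε • (θ.plan : Measure (D × D)) with hm
  have hsub : ε • (θ.plan : Measure (D × D)) + m = η.plan := by
    rw [add_comm]; exact Measure.sub_add_cancel_of_le hle
  have key : ∀ f : D × D → D, Measurable f → (η.plan : Measure (D × D)).map f = μ →
      (θ.plan : Measure (D × D)).map f = μ → (q⁻¹ • m).map f = μ := by
    intro f hf h1 h2
    have h3 : ε • μ + m.map f = μ := by
      rw [← hsub, Measure.map_add _ _ hf, Measure.map_smul, h2] at h1; exact h1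
    have h4 : m.map f = q • μ := by
      ext s hs
      have h5 := congrArg (fun ν : Measure D => ν s) h3
      simp only [Measure.add_apply, Measure.smul_apply, smul_eq_mul] at h5 ⊢
      have h6 : ε * μ s + q * μ s = μ s := by rw [← add_mul, h, one_mul]
      exact (ENNReal.add_right_inj (ENNReal.mul_ne_top hεt (measure_ne_top _ _))).1
        (h5.trans h6.symm)
    rw [Measure.map_smul, h4, smul_smul, ENNReal.inv_mul_cancel hq hqt, one_smul]
  refine ⟨MPPlan.ofMeasure (q⁻¹ • m) (key _ measurable_fst η.map_fst θ.map_fst)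
    (key _ measurable_snd η.map_snd θ.map_snd), MPPlan.ext (Subtype.ext ?_)⟩
  change (η.plan : Measure (D × D)) = ε • (θ.plan : Measure (D × D)) + q • (q⁻¹ • m)
  rw [smul_smul, ENNReal.mul_inv_cancel hq hqt, one_smul, hsub]

theorem MPPlan.mix_mix {p q ε r p' q' : ℝ≥0∞} (h : p + q = 1) (h' : ε + r = 1) (h'' : p' + q' = 1)
    (hp : p + q * ε = p') (hq : q * r = q') (θ ρ : MPPlan μ) :
    MPPlan.mix p q h θ (MPPlan.mix ε r h' θ ρ) = MPPlan.mix p' q' h'' θ ρ := by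
  refine MPPlan.ext (Subtype.ext ?_)
  change p • (θ.plan : Measure (D × D)) + q • (ε • (θ.plan : Measure (D × D)) +
    r • (ρ.plan : Measure (D × D))) = p' • (θ.plan : Measure (D × D)) +
      q' • (ρ.plan : Measure (D × D))
  rw [smul_add, smul_smul, smul_smul, ← add_assoc, ← add_smul, hp, hq]


variable [MetricSpace D] [CompactSpace D] [BorelSpace D]

theorem tendsto_mix_of_tendsto_zero {p q : ℕ → ℝ≥0∞} (h : ∀ n, p n + q n = 1)
    (hq : Tendsto q atTop (𝓝 0)) (θ : MPPlan μ) (ρ : ℕ → MPPlan μ) :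
    Tendsto (fun n => (MPPlan.mix (p n) (q n) (h n) θ (ρ n)).plan) atTop (𝓝 θ.plan) := by
  rw [ProbabilityMeasure.tendsto_iff_forall_lintegral_tendsto]
  intro f
  have e : ∀ n, ∫⁻ x, f x ∂((MPPlan.mix (p n) (q n) (h n) θ (ρ n)).plan : Measure (D × D)) =
      p n * ∫⁻ x, f x ∂(θ.plan : Measure (D × D)) +
        q n * ∫⁻ x, f x ∂((ρ n).plan : Measure (D × D)) := by
    intro n
    change ∫⁻ x, f x ∂(p n • (θ.plan : Measure (D × D)) + q n • ((ρ n).plan : Measure (D × D))) = _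
    rw [lintegral_add_measure, lintegral_smul_measure, lintegral_smul_measure]
    rfl
  simp only [e]
  have hp : Tendsto p atTop (𝓝 1) := by
    have h1 : p = fun n => 1 - q n := funext fun n => by
      refine ENNReal.eq_sub_of_add_eq (fun hq => ?_) (h n)
      have := h n
      simp [hq] at this
    rw [h1]
    simpa using ENNReal.Tendsto.sub tendsto_const_nhds hq (Or.inl ENNReal.one_ne_top)
  obtain ⟨B, hB⟩ : ∃ B : NNReal, ∀ x, f x ≤ B := ⟨nndist f 0, fun x => by
    have := BoundedContinuousFunction.dist_coe_le_dist (f := f) (g := 0) x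
    rw [← NNReal.coe_le_coe, coe_nndist]
    simpa [NNReal.dist_eq] using this⟩
  have hb : ∀ n, ∫⁻ x, f x ∂((ρ n).plan : Measure (D × D)) ≤ B := fun n => by
    refine (lintegral_mono (g := fun _ => (B : ℝ≥0∞)) fun x =>
      ENNReal.coe_le_coe.2 (hB x)).trans ?_
    simp
  have h2 : Tendsto (fun n => q n * ∫⁻ x, f x ∂((ρ n).plan : Measure (D × D))) atTop (𝓝 0) := by
    refine tendsto_of_tendsto_of_tendsto_of_le_of_le tendsto_const_nhds ?_ (fun n => zero_le)
      (fun n => mul_le_mul_right (hb n) (q n))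
    simpa using ENNReal.Tendsto.mul_const (b := (B : ℝ≥0∞)) hq (Or.inr ENNReal.coe_ne_top)
  have h3 := ENNReal.Tendsto.mul_const (b := ∫⁻ x, f x ∂(θ.plan : Measure (D × D))) hp
    (Or.inl one_ne_zero)
  simpa using h3.add h2

variable [Nonempty D]

theorem relaxedDist_mix_le (p q : ℝ≥0∞) (h : p + q = 1) (θ η γ : MPPlan μ) :
    relaxedDist (MPPlan.mix p q h θ η) (MPPlan.mix p q h θ γ) ≤
      q ^ (1 / 2 : ℝ) * relaxedDist η γ := by
  rw [relaxedDist_le_iff, mul_pow, relaxedDist_sq, ← ENNReal.rpow_natCast, ← ENNReal.rpow_mul]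
  norm_num
  exact relaxedCost_mix_le p q h θ η γ

/-- If every plan is at bounded distance from a plan with a fixed part in common with `θ`, then
every plan is at bounded distance from `θ`. -/
theorem exists_relaxedDist_le_of_smul_le {C ε : ℝ≥0∞} (hC : C ≠ ⊤) (hε : ε ≠ 0) (θ : MPPlan μ)
    (H : ∀ η : MPPlan μ, ∃ η' : MPPlan μ, relaxedDist η η' ≤ C ∧
      ε • (θ.plan : Measure (D × D)) ≤ η'.plan) :
    ∃ B : ℝ≥0∞, B ≠ ⊤ ∧ ∀ η, relaxedDist η θ ≤ B := by
  -- If `ε ≥ 1` no mass would be left for the remainder, so it is lowered to `1 / 2`.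
  wlog hε1 : ε < 1 generalizing ε
  · refine this (ε := 1 / 2) (by simp) (fun η => ?_) (by simp)
    obtain ⟨η', h1, h2⟩ := H η
    refine ⟨η', h1, (Measure.le_iff.2 fun s _ => ?_).trans h2⟩
    simp only [Measure.smul_apply, smul_eq_mul]
    gcongr
    exact (by simp : (1 / 2 : ℝ≥0∞) ≤ 1).trans (not_lt.1 hε1)
  set q := 1 - ε with hq
  have hεq : ε + q = 1 := add_tsub_cancel_of_le hε1.le
  have hq0 : q ≠ 0 := (tsub_pos_of_lt hε1).ne'
  have hq1 : q < 1 := ENNReal.sub_lt_self ENNReal.one_ne_top one_ne_zero hε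
  have H' : ∀ η : MPPlan μ, ∃ ρ : MPPlan μ, relaxedDist η (MPPlan.mix ε q hεq θ ρ) ≤ C := by
    intro η
    obtain ⟨η', h1, h2⟩ := H η
    obtain ⟨ρ, rfl⟩ := exists_eq_mix_of_smul_le hεq hq0 h2
    exact ⟨ρ, h1⟩
  choose f hf using H'
  set s := q ^ (1 / 2 : ℝ) with hs
  have hs1 : s < 1 := ENNReal.rpow_lt_one hq1 (by norm_num)
  have hpn : ∀ n, (1 - q ^ n) + q ^ n = 1 := fun n =>
    tsub_add_cancel_of_le (pow_le_one₀ zero_le hq1.le)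
  refine ⟨C * (1 - s)⁻¹, ENNReal.mul_ne_top hC (ENNReal.inv_ne_top.2 (tsub_pos_of_lt hs1).ne'),
    fun η => ?_⟩
  -- After `n` turns the fraction `1 - q ^ n` has become `θ` and rests; only the remainder `f^[n] η`
  -- is transformed, at distance at most `q ^ (n / 2) * C`.
  let v : ℕ → MPPlan μ := fun n => MPPlan.mix (1 - q ^ n) (q ^ n) (hpn n) θ (f^[n] η)
  have hv0 : v 0 = η := by
    refine MPPlan.ext (Subtype.ext ?_)
    change (1 - q ^ 0) • (θ.plan : Measure (D × D)) + q ^ 0 • (η.plan : Measure (D × D)) = _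
    simp
  have hstep : ∀ n, relaxedDist (v n) (v (n + 1)) ≤ s ^ n * C := by
    intro n
    have h1 : v (n + 1) = MPPlan.mix (1 - q ^ n) (q ^ n) (hpn n) θ
        (MPPlan.mix ε q hεq θ (f (f^[n] η))) := by
      rw [MPPlan.mix_mix (hpn n) hεq (hpn (n + 1)) _ (pow_succ q n).symm,
        ← Function.iterate_succ_apply' f]
      refine ENNReal.eq_sub_of_add_eq (ENNReal.pow_ne_top (hq1.trans ENNReal.one_lt_top).ne) ?_
      rw [pow_succ, add_assoc, ← mul_add, hεq, mul_one, hpn]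
    rw [h1]
    refine (relaxedDist_mix_le _ _ _ _ _ _).trans ?_
    have h2 : (q ^ n) ^ (1 / 2 : ℝ) = s ^ n := by
      rw [hs, ← ENNReal.rpow_natCast, ← ENNReal.rpow_natCast, ← ENNReal.rpow_mul,
        ← ENNReal.rpow_mul, mul_comm]
    rw [h2]
    exact mul_le_mul_right (hf _) _
  have hsum : ∀ n, relaxedDist (v 0) (v n) ≤ C * ∑ k ∈ Finset.range n, s ^ k := by
    intro n
    induction n with
    | zero => simp [relaxedDist_self]
    | succ n ih =>
      refine (relaxedDist_triangle _ (v n) _).trans ?_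
      rw [Finset.sum_range_succ, mul_add]
      refine add_le_add ih ((hstep n).trans (mul_comm _ _).le)
  have hlim : Tendsto (fun n => (v n).plan) atTop (𝓝 θ.plan) :=
    tendsto_mix_of_tendsto_zero hpn (ENNReal.tendsto_pow_atTop_nhds_zero_of_lt_one hq1) θ _
  refine relaxedDist_le_of_tendsto (u := fun _ => η) (v := v) tendsto_const_nhds hlim fun n => ?_
  rw [← hv0]
  refine (hsum n).trans (mul_le_mul_right ?_ _)
  rw [← ENNReal.tsum_geometric]
  exact ENNReal.sum_le_tsum _

end Iteration

/-! ### Mixing in domains covered by images of a torus -/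

section Cells

variable {D : Type*} [MeasurableSpace D]

/-- The law of the label, restricted to the particles which lie in `V`. -/
noncomputable def labelPart (m : Measure (D × D)) (V : Set D) : Measure D :=
  (m.restrict (Prod.snd ⁻¹' V)).map Prod.fst

theorem labelPart_mono {m m' : Measure (D × D)} (h : m ≤ m') (V : Set D) :
    labelPart m V ≤ labelPart m' V :=
  Measure.map_mono (Measure.restrict_mono_measure h _) measurable_fst

theorem labelPart_smul (c : ℝ≥0∞) (m : Measure (D × D)) (V : Set D) :
    labelPart (c • m) V = c • labelPart m V := by
  rw [labelPart, Measure.restrict_smul, Measure.map_smul, labelPart]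

instance (m : Measure (D × D)) [IsFiniteMeasure m] (V : Set D) : IsFiniteMeasure (labelPart m V) :=
  Measure.isFiniteMeasure_map _ _

theorem labelPart_prod (m m' : Measure D) [SFinite m] [SFinite m'] (V : Set D) :
    labelPart (m.prod m') V = m' V • m := by
  have : (Prod.snd ⁻¹' V : Set (D × D)) = Set.univ ×ˢ V := by ext; simp
  rw [labelPart, this, ← Measure.prod_restrict, Measure.map_fst_prod, Measure.restrict_univ,
    Measure.restrict_apply_univ]

variable [MetricSpace D]

/-- `V` is comparable, in measure, to a Lipschitz image of the `d`-dimensional torus. -/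
def IsTorusCell (d : ℕ) (μ : Measure D) (V : Set D) : Prop :=
  MeasurableSet V ∧ ∃ (ψ : Torus d → D) (L : NNReal) (κ : ℝ≥0∞), LipschitzWith L ψ ∧ κ ≠ 0 ∧
    κ ≤ 1 ∧ κ • volume.map ψ ≤ μ ∧ κ • μ.restrict V ≤ volume.map ψ

variable [CompactSpace D] [BorelSpace D] {μ : Measure D} [IsProbabilityMeasure μ]

/-- The density `g` of `c • volume.map ψ` is the proportion of mass to be moved at each point. The
choice `c = κ / 2` leaves at least half of the mass at rest everywhere. -/
theorem IsTorusCell.exists_density {d : ℕ} {V : Set D} (h : IsTorusCell d μ V) :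
    ∃ (ψ : Torus d → D) (L : NNReal) (κ c : ℝ≥0∞) (g : D → ℝ≥0∞), LipschitzWith L ψ ∧ κ ≠ 0 ∧
      κ ≤ 1 ∧ c ≤ 1 ∧ Measurable g ∧ (∀ x, g x ≤ 2⁻¹) ∧ μ.withDensity g = c • volume.map ψ ∧
      (∀ᵐ x ∂μ, x ∈ V → κ ≤ g x) ∧ κ • μ.restrict V ≤ volume.map ψ := by
  obtain ⟨hV, ψ, L, κ, hψ, hκ0, hκ1, h1, h2⟩ := h
  have hκt : κ ≠ ⊤ := (hκ1.trans_lt ENNReal.one_lt_top).ne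
  have hprob : IsProbabilityMeasure ((volume : Measure (Torus d)).map ψ) :=
    Measure.isProbabilityMeasure_map hψ.continuous.measurable.aemeasurable
  set ν := (volume : Measure (Torus d)).map ψ
  set c := 2⁻¹ * κ with hc
  have hct : c ≠ ⊤ := ENNReal.mul_ne_top (by simp) hκt
  have hc1 : c ≤ 1 := mul_le_one' (by simp) hκ1
  have hcν : c • ν ≤ (2⁻¹ : ℝ≥0∞) • μ := Measure.le_iff.2 fun s _ => by
    have := h1 s
    simp only [Measure.smul_apply, smul_eq_mul, hc, mul_assoc] at this ⊢
    gcongr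
  have : IsFiniteMeasure (c • ν) := Measure.smul_finite _ hct
  have hac : c • ν ≪ μ :=
    (Measure.absolutelyContinuous_of_le hcν).trans (Measure.smul_absolutelyContinuous)
  have hd : μ.withDensity ((c • ν).rnDeriv μ) = c • ν := Measure.withDensity_rnDeriv_eq _ _ hac
  have hle : (c • ν).rnDeriv μ ≤ᵐ[μ] fun _ => 2⁻¹ := by
    refine ae_le_of_forall_setLIntegral_le_of_sigmaFinite (Measure.measurable_rnDeriv _ _)
      fun s hs _ => ?_
    rw [← withDensity_apply _ hs, hd, setLIntegral_const]
    exact hcν s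
  -- Capping the density gives the bound at every point, not only almost everywhere.
  have hae : (fun x => min ((c • ν).rnDeriv μ x) 2⁻¹) =ᵐ[μ] (c • ν).rnDeriv μ := by
    filter_upwards [hle] with x hx using min_eq_left hx
  -- On `V` the density of `c • volume.map ψ` is at least `c * κ`, since `κ • μ.restrict V` is below
  -- `volume.map ψ`.
  refine ⟨ψ, L, c * κ, c, fun x => min ((c • ν).rnDeriv μ x) 2⁻¹, hψ, ?_, mul_le_one' hc1 hκ1, hc1,
    (Measure.measurable_rnDeriv _ _).min measurable_const, fun x => min_le_right _ _, ?_, ?_, ?_⟩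
  · exact mul_ne_zero (mul_ne_zero (by simp) hκ0) hκ0
  · rw [withDensity_congr_ae hae, hd]
  · have h3 : V.indicator (fun _ => c * κ) ≤ᵐ[μ] (c • ν).rnDeriv μ := by
      refine ae_le_of_forall_setLIntegral_le_of_sigmaFinite (measurable_const.indicator hV)
        fun s hs _ => ?_
      rw [← withDensity_apply _ hs, ← withDensity_apply _ hs, hd, withDensity_indicator hV,
        withDensity_const, Measure.smul_apply, Measure.smul_apply, smul_eq_mul, smul_eq_mul,
        mul_assoc]
      exact mul_le_mul_right (h2 s) _
    filter_upwards [hae, h3] with x hx hx' hxV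
    rw [hx]
    simpa [hxV] using hx'
  · refine le_trans (Measure.le_iff.2 fun s _ => ?_) h2
    simp only [Measure.smul_apply, smul_eq_mul]
    gcongr
    exact mul_le_of_le_one_left' hc1

/-- The sets cover but may overlap, whence an inequality. -/
theorem prod_le_sum_labelPart {ι : Type*} [Finite ι] {V : ι → Set D} (hV : ⋃ i, V i = Set.univ)
    (η : MPPlan μ) : μ.prod μ ≤ Measure.sum fun p : ι × ι =>
      (labelPart (η.plan : Measure (D × D)) (V p.1)).prod (μ.restrict (V p.2)) := by
  have h1 : μ ≤ Measure.sum fun i => μ.restrict (V i) := by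
    have := Measure.restrict_iUnion_le (μ := μ) (s := V)
    rwa [hV, Measure.restrict_univ] at this
  have h2 : μ ≤ Measure.sum fun i => labelPart (η.plan : Measure (D × D)) (V i) := by
    have h3 := Measure.restrict_iUnion_le (μ := (η.plan : Measure (D × D)))
      (s := fun i => Prod.snd ⁻¹' V i)
    rw [← Set.preimage_iUnion, hV, Set.preimage_univ, Measure.restrict_univ] at h3
    have h4 := Measure.map_mono h3 measurable_fst
    rwa [η.map_fst, Measure.map_sum measurable_fst.aemeasurable] at h4
  have h5 := Measure.prod_mono h2 h1
  rwa [Measure.prod_sum] at h5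

variable [Nonempty D]

/-- Uniformly in the plan, one can move at bounded cost to a plan in which a fixed proportion of
the particles of `V` is spread over `W` independently of the label. -/
def IsMixedInto (μ : Measure D) (V W : Set D) : Prop :=
  ∃ C ε : ℝ≥0∞, C ≠ ⊤ ∧ ε ≠ 0 ∧ ∀ η : MPPlan μ, ∃ η' : MPPlan μ, relaxedDist η η' ≤ C ∧
    ε • (η.plan : Measure (D × D)) ≤ η'.plan ∧
    ε • (labelPart (η.plan : Measure (D × D)) V).prod (μ.restrict W) ≤ η'.plan

/-- After the torus move, a proportion at least `κ` of the particles of `V` has law `volume.map ψ`,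
itself at least `κ • μ.restrict V`, independently of the label. The mass at rest dominates half of
`η`. -/
theorem IsTorusCell.isMixedInto {d : ℕ} {V : Set D} (h : IsTorusCell d μ V) :
    IsMixedInto μ V V := by
  have hV := h.1
  obtain ⟨ψ, L, κ, c, g, hψ, hκ0, hκ1, hc, hg, hg2, hd, hgV, hVν⟩ := h.exists_density
  have hκt : κ ≠ ⊤ := (hκ1.trans_lt ENNReal.one_lt_top).ne
  have hprob : IsProbabilityMeasure ((volume : Measure (Torus d)).map ψ) :=
    Measure.isProbabilityMeasure_map hψ.continuous.measurable.aemeasurable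
  have h21 : (2⁻¹ : ℝ≥0∞) ≤ 1 := by simp
  refine ⟨((L : ℝ≥0∞) ^ 2 / 2) ^ (1 / 2 : ℝ), 2⁻¹ * (κ * κ), ?_, ?_, fun η => ?_⟩
  · exact ENNReal.rpow_ne_top_of_nonneg (by norm_num)
      (ENNReal.div_ne_top (ENNReal.pow_ne_top ENNReal.coe_ne_top) two_ne_zero)
  · exact mul_ne_zero (by simp) (mul_ne_zero hκ0 hκ0)
  obtain ⟨η', h1, h2⟩ := exists_torus_move hψ hg (fun x => (hg2 x).trans h21) hc hd η
  refine ⟨η', ?_, ?_, ?_⟩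
  · exact ENNReal.rpow_le_rpow h1 (by norm_num)
  · rw [h2]
    refine le_trans ?_ (Measure.le_add_right le_rfl)
    refine le_trans ?_ (withDensity_mono (f := fun _ => 2⁻¹ * (κ * κ)) (Eventually.of_forall ?_))
    · rw [withDensity_const]
    · intro p
      change 2⁻¹ * (κ * κ) ≤ 1 - g p.2
      refine (mul_le_of_le_one_right' (mul_le_one' hκ1 hκ1)).trans ?_
      refine ENNReal.le_sub_of_add_le_right ((hg2 _).trans_lt (by simp)).ne ?_
      calc 2⁻¹ + g p.2 ≤ 2⁻¹ + 2⁻¹ := add_le_add_right (hg2 _) _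
        _ = 1 := ENNReal.inv_two_add_inv_two
  · rw [h2]
    refine le_trans ?_ (Measure.le_add_left le_rfl)
    have h3 : κ • labelPart (η.plan : Measure (D × D)) V ≤
        ((η.plan : Measure (D × D)).withDensity fun p => g p.2).map Prod.fst := by
      rw [labelPart, ← Measure.map_smul]
      refine Measure.map_mono ?_ measurable_fst
      rw [← withDensity_const, ← withDensity_indicator (measurable_snd hV)]
      refine withDensity_mono ?_
      have h4 : ∀ᵐ p ∂(η.plan : Measure (D × D)), p.2 ∈ V → κ ≤ g p.2 := by
        rw [← η.map_snd] at hgV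
        exact ae_of_ae_map measurable_snd.aemeasurable hgV
      filter_upwards [h4] with p hp
      by_cases hpV : p ∈ (Prod.snd ⁻¹' V : Set (D × D))
      · rw [Set.indicator_of_mem hpV]; exact hp hpV
      · rw [Set.indicator_of_notMem hpV]; exact zero_le
    refine le_trans ?_ (Measure.prod_mono h3 hVν)
    rw [Measure.prod_smul_left, Measure.prod_smul_right, smul_smul]
    refine Measure.le_iff.2 fun s _ => ?_
    simp only [Measure.smul_apply, smul_eq_mul]
    exact mul_le_mul_left (mul_le_of_le_one_left' h21) _

/-- Of the particles spread over `W` independently of the label, a fixed positive amount lies in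
`W'`; the second move spreads these over `W'`. -/
theorem IsMixedInto.trans_of_overlap {V W W' : Set D} (h : IsMixedInto μ V W)
    (hW' : MeasurableSet W') (h' : IsMixedInto μ W' W') (ho : μ (W' ∩ W) ≠ 0) :
    IsMixedInto μ V W' := by
  obtain ⟨C₁, ε₁, hC₁, hε₁, H₁⟩ := h
  obtain ⟨C₂, ε₂, hC₂, hε₂, H₂⟩ := h'
  have ho1 : μ (W' ∩ W) ≤ 1 := prob_le_one
  refine ⟨C₁ + C₂, ε₂ * (ε₁ * μ (W' ∩ W)), ENNReal.add_ne_top.2 ⟨hC₁, hC₂⟩,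
    mul_ne_zero hε₂ (mul_ne_zero hε₁ ho), fun η => ?_⟩
  obtain ⟨η₁, a1, b1, c1⟩ := H₁ η
  obtain ⟨η₂, a2, b2, c2⟩ := H₂ η₁
  refine ⟨η₂, (relaxedDist_triangle _ η₁ _).trans (add_le_add a1 a2), ?_, ?_⟩
  · refine le_trans (Measure.le_iff.2 fun s _ => ?_) b2
    have := b1 s
    simp only [Measure.smul_apply, smul_eq_mul, mul_assoc] at this ⊢
    refine mul_le_mul_right (le_trans (mul_le_mul_right ?_ _) this) _
    exact mul_le_of_le_one_left' ho1
  · refine le_trans ?_ c2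
    have h3 := labelPart_mono c1 W'
    rw [labelPart_smul, labelPart_prod, Measure.restrict_apply hW', smul_smul] at h3
    have h4 := Measure.prod_mono h3 (le_refl (μ.restrict W'))
    rw [Measure.prod_smul_left] at h4
    rw [mul_smul]
    refine Measure.le_iff.2 fun s _ => ?_
    rw [Measure.smul_apply, Measure.smul_apply]
    exact mul_le_mul_right (h4 s) _

/-- Moves are made one after the other. Since each retains a fixed proportion of the plan it acts
on, it neither destroys what earlier moves achieved nor exhausts the particles needed by later ones.
-/
theorem exists_simultaneously_mixed {ι : Type*} (S : Finset (ι × ι)) (V : ι → Set D)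
    (H : ∀ p ∈ S, IsMixedInto μ (V p.1) (V p.2)) :
    ∃ C ε : ℝ≥0∞, C ≠ ⊤ ∧ ε ≠ 0 ∧ ∀ η : MPPlan μ, ∃ η' : MPPlan μ, relaxedDist η η' ≤ C ∧
      ε • (η.plan : Measure (D × D)) ≤ η'.plan ∧ ∀ p ∈ S,
      ε • (labelPart (η.plan : Measure (D × D)) (V p.1)).prod (μ.restrict (V p.2)) ≤ η'.plan := by
  classical
  induction S using Finset.induction_on with
  | empty =>
    exact ⟨0, 1, ENNReal.zero_ne_top, one_ne_zero, fun η => ⟨η, by simp [relaxedDist_self]⟩⟩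
  | insert p S hp ih =>
    obtain ⟨C₁, ε₁, hC₁, hε₁, H₁⟩ := ih fun q hq => H q (Finset.mem_insert_of_mem hq)
    obtain ⟨C₂, ε₂, hC₂, hε₂, H₂⟩ := H p (Finset.mem_insert_self _ _)
    refine ⟨C₁ + C₂, ε₂ * ε₁, ENNReal.add_ne_top.2 ⟨hC₁, hC₂⟩, mul_ne_zero hε₂ hε₁, fun η => ?_⟩
    obtain ⟨η₁, a1, b1, c1⟩ := H₁ η
    obtain ⟨η₂, a2, b2, c2⟩ := H₂ η₁
    have key : ∀ m : Measure (D × D), ε₁ • m ≤ η₁.plan → (ε₂ * ε₁) • m ≤ η₂.plan := by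
      intro m hm
      refine le_trans (Measure.le_iff.2 fun s _ => ?_) b2
      rw [mul_smul, Measure.smul_apply, Measure.smul_apply]
      exact mul_le_mul_right (hm s) _
    refine ⟨η₂, (relaxedDist_triangle _ η₁ _).trans (add_le_add a1 a2), key _ b1, fun q hq => ?_⟩
    rcases Finset.mem_insert.1 hq with rfl | hq
    · refine le_trans ?_ c2
      have h3 := labelPart_mono b1 (V q.1)
      rw [labelPart_smul] at h3
      have h4 := Measure.prod_mono h3 (le_refl (μ.restrict (V q.2)))
      rw [Measure.prod_smul_left] at h4
      rw [mul_smul]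
      refine Measure.le_iff.2 fun s _ => ?_
      rw [Measure.smul_apply, Measure.smul_apply]
      exact mul_le_mul_right (h4 s) _
    · exact key _ (c1 q hq)

/-- If the domain is covered by finitely many torus cells and the overlap graph is connected, then
the relaxed distance is bounded. -/
theorem exists_relaxedDist_le_of_cells {d : ℕ} {ι : Type*} [Finite ι] {V : ι → Set D}
    (hcell : ∀ i, IsTorusCell d μ (V i)) (hcov : ⋃ i, V i = Set.univ)
    (hconn : ∀ i j, Relation.ReflTransGen (fun i j => μ (V j ∩ V i) ≠ 0) i j) :
    ∃ B : ℝ≥0∞, B ≠ ⊤ ∧ ∀ η γ : MPPlan μ, relaxedDist η γ ≤ B := by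
  have hmix : ∀ i j, IsMixedInto μ (V i) (V j) := fun i j => by
    induction hconn i j with
    | refl => exact (hcell i).isMixedInto
    | tail _ h ih => exact ih.trans_of_overlap (hcell _).1 (hcell _).isMixedInto h
  have := Fintype.ofFinite ι
  obtain ⟨C, ε, hC, hε, H⟩ := exists_simultaneously_mixed (μ := μ) (Finset.univ : Finset (ι × ι)) V
    fun p _ => hmix p.1 p.2
  set N : ℝ≥0∞ := (Fintype.card (ι × ι) : ℝ≥0∞) with hN
  have hN0 : N + 1 ≠ 0 := by simp
  have hNt : N + 1 ≠ ⊤ := ENNReal.add_ne_top.2 ⟨ENNReal.natCast_ne_top _, ENNReal.one_ne_top⟩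
  -- The `N` pairs of cells each contribute at most `η'` to `ε μ ⊗ μ`; dividing by `N + 1` avoids a
  -- zero denominator.
  obtain ⟨B, hB, hB'⟩ := exists_relaxedDist_le_of_smul_le (ε := (N + 1)⁻¹ * ε) hC
    (mul_ne_zero (ENNReal.inv_ne_zero.2 hNt) hε) (MPPlan.product μ) fun η => by
      obtain ⟨η', a, -, c⟩ := H η
      refine ⟨η', a, Measure.le_iff.2 fun s hs => ?_⟩
      have h1 := prod_le_sum_labelPart hcov η s
      rw [Measure.sum_apply _ hs, tsum_fintype] at h1
      change ((N + 1)⁻¹ * ε) * μ.prod μ s ≤ _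
      rw [mul_assoc, mul_comm, ← div_eq_mul_inv, ENNReal.div_le_iff hN0 hNt]
      calc ε * μ.prod μ s ≤ ε * ∑ p : ι × ι,
            (labelPart (η.plan : Measure (D × D)) (V p.1)).prod (μ.restrict (V p.2)) s :=
              mul_le_mul_right h1 _
        _ = ∑ p : ι × ι, ε *
            (labelPart (η.plan : Measure (D × D)) (V p.1)).prod (μ.restrict (V p.2)) s :=
              Finset.mul_sum _ _ _
        _ ≤ ∑ p : ι × ι, (η'.plan : Measure (D × D)) s :=
              Finset.sum_le_sum fun p hp => c p hp s
        _ = N * (η'.plan : Measure (D × D)) s := by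
              rw [Finset.sum_const, Finset.card_univ, nsmul_eq_mul]
        _ ≤ (N + 1) * (η'.plan : Measure (D × D)) s := by gcongr; exact le_self_add
        _ = _ := mul_comm _ _
  refine ⟨B + B, ENNReal.add_ne_top.2 ⟨hB, hB⟩, fun η γ => ?_⟩
  refine (relaxedDist_triangle η (MPPlan.product μ) γ).trans (add_le_add (hB' η) ?_)
  rw [relaxedDist_comm]
  exact hB' γ

end Cells

/-! ### Folding the torus onto the cube -/

/-- The map from the torus onto `[0,1]^d` which folds each circle onto `[0,1]`. -/
noncomputable def torusFold {d : ℕ} (θ : Torus d) : Fin d → ℝ := fun i => 2 * ‖θ i‖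

theorem torusFold_mem {d : ℕ} (θ : Torus d) : torusFold θ ∈ Set.Icc (0 : Fin d → ℝ) 1 := by
  refine ⟨fun i => by simp [torusFold], fun i => ?_⟩
  have := AddCircle.norm_le_half_period 1 (x := θ i) one_ne_zero
  rw [abs_one] at this
  simp only [torusFold, Pi.one_apply]
  linarith

theorem lipschitzWith_torusFold {d : ℕ} : LipschitzWith 2 (torusFold : Torus d → Fin d → ℝ) := by
  refine LipschitzWith.of_dist_le_mul fun θ θ' => ?_
  refine (dist_pi_le_iff (by positivity)).2 fun i => ?_
  have h1 : dist (torusFold θ i) (torusFold θ' i) = 2 * |‖θ i‖ - ‖θ' i‖| := by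
    simp only [torusFold]
    rw [Real.dist_eq, ← mul_sub, abs_mul, abs_two]
  rw [h1]
  have h2 := abs_norm_sub_norm_le (θ i) (θ' i)
  rw [← dist_eq_norm] at h2
  have h3 := dist_le_pi_dist θ θ' i
  push_cast
  linarith

/-- A closed ball of radius `a / 2` in the circle has measure `min 1 a` for `a ≥ 0`. -/
theorem map_two_mul_norm_addCircle :
    (volume : Measure UnitAddCircle).map (fun x => 2 * ‖x‖) =
      (volume : Measure ℝ).restrict (Set.Icc 0 1) := by
  have hm : Measurable fun x : UnitAddCircle => 2 * ‖x‖ := by fun_prop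
  have : IsFiniteMeasure ((volume : Measure UnitAddCircle).map (fun x => 2 * ‖x‖)) :=
    Measure.isFiniteMeasure_map _ _
  refine Measure.ext_of_Iic _ _ fun a => ?_
  rw [Measure.map_apply hm measurableSet_Iic, Measure.restrict_apply measurableSet_Iic]
  have h1 : (fun x : UnitAddCircle => 2 * ‖x‖) ⁻¹' Set.Iic a = Metric.closedBall 0 (a / 2) := by
    ext x
    simp only [Set.mem_preimage, Set.mem_Iic, Metric.mem_closedBall, dist_zero_right]
    constructor <;> intro h <;> linarith
  have h2 : Set.Iic a ∩ Set.Icc 0 1 = Set.Icc 0 (min 1 a) := by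
    ext x
    simp only [Set.mem_inter_iff, Set.mem_Iic, Set.mem_Icc, le_min_iff]
    tauto
  rw [h1, h2, AddCircle.volume_closedBall, Real.volume_Icc, sub_zero, mul_div_cancel₀ _ two_ne_zero]

theorem map_torusFold {d : ℕ} : (volume : Measure (Torus d)).map torusFold =
    (volume : Measure (Fin d → ℝ)).restrict (Set.Icc 0 1) := by
  have h := measurePreserving_pi (fun _ : Fin d => (volume : Measure UnitAddCircle))
    (fun _ : Fin d => (volume : Measure ℝ).restrict (Set.Icc 0 1))
    (f := fun _ x => 2 * ‖x‖) fun _ => ⟨by fun_prop, map_two_mul_norm_addCircle⟩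
  have h2 := Measure.restrict_pi_pi (fun _ : Fin d => (volume : Measure ℝ))
    (fun _ => Set.Icc (0 : ℝ) 1)
  have h3 : (Set.univ.pi fun _ : Fin d => Set.Icc (0 : ℝ) 1) = Set.Icc 0 1 := Set.pi_univ_Icc 0 1
  rw [h3] at h2
  exact h.map_eq.trans h2.symm

section

variable {D : Type*} [MetricSpace D] [MeasurableSpace D] [BorelSpace D]

/-- The fold is Lipschitz and carries Haar measure to Lebesgue measure on the cube, so composing
with it turns a parametrization by the cube into one by the torus. -/
theorem isTorusCell_of_le {d : ℕ} {μ : Measure D} {V : Set D} (hV : MeasurableSet V)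
    {φ : (Fin d → ℝ) → D} {K : NNReal} (hφ : LipschitzOnWith K φ (Set.Icc 0 1)) {A : ℝ≥0∞}
    (hA : A ≠ ⊤) (h1 : ((volume : Measure (Fin d → ℝ)).restrict (Set.Icc 0 1)).map φ ≤ A • μ)
    (h2 : μ.restrict V ≤ A • ((volume : Measure (Fin d → ℝ)).restrict (Set.Icc 0 1)).map φ) :
    IsTorusCell d μ V := by
  have hQ : MeasurableSet (Set.Icc (0 : Fin d → ℝ) 1) := measurableSet_Icc
  have hmap : (volume : Measure (Torus d)).map (φ ∘ torusFold) =
      ((volume : Measure (Fin d → ℝ)).restrict (Set.Icc 0 1)).map φ := by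
    rw [← map_torusFold, AEMeasurable.map_map_of_aemeasurable]
    · rw [map_torusFold]
      exact hφ.continuousOn.aemeasurable hQ
    · exact lipschitzWith_torusFold.continuous.measurable.aemeasurable
  have hA0 : A + 1 ≠ 0 := by simp
  have hAt : A + 1 ≠ ⊤ := ENNReal.add_ne_top.2 ⟨hA, ENNReal.one_ne_top⟩
  have key : ∀ m m' : Measure D, m ≤ A • m' → (A + 1)⁻¹ • m ≤ m' := fun m m' h =>
    Measure.le_iff.2 fun s _ => by
      rw [Measure.smul_apply, smul_eq_mul, mul_comm, ← div_eq_mul_inv,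
        ENNReal.div_le_iff hA0 hAt, mul_comm]
      exact (h s).trans (mul_le_mul_left le_self_add _)
  refine ⟨hV, φ ∘ torusFold, K * 2, (A + 1)⁻¹, ?_, ENNReal.inv_ne_zero.2 hAt, ?_, ?_, ?_⟩
  · rw [← lipschitzOnWith_univ]
    exact hφ.comp (lipschitzOnWith_univ.2 lipschitzWith_torusFold) fun θ _ => torusFold_mem θ
  · rw [ENNReal.inv_le_one]; exact le_add_self
  · rw [hmap]; exact key _ _ h1
  · rw [hmap]; exact key _ _ h2

end

/-! ### The cube -/

theorem unitCube_eq_preimage (d : ℕ) :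
    unitCube d = (WithLp.ofLp : EuclideanSpace ℝ (Fin d) → Fin d → ℝ) ⁻¹' Set.Icc 0 1 := by
  ext x
  simp only [unitCube, Set.mem_preimage, Set.mem_Icc, Pi.le_def, ← forall_and]
  rfl

theorem measurableSet_unitCube (d : ℕ) : MeasurableSet (unitCube d) := by
  rw [unitCube_eq_preimage]
  exact (PiLp.continuous_ofLp 2 _).measurable measurableSet_Icc

/-- The parametrization of the Euclidean cube by the cube in `Fin d → ℝ`, with the coordinates
projected onto `[0,1]`. -/
noncomputable def cubeParam {d : ℕ} (u : Fin d → ℝ) : unitCube d :=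
  ⟨WithLp.toLp 2 fun i => Set.projIcc (0 : ℝ) 1 zero_le_one (u i), fun i =>
    (Set.projIcc (0 : ℝ) 1 zero_le_one (u i)).2⟩

theorem coe_cubeParam {d : ℕ} {u : Fin d → ℝ} (hu : u ∈ Set.Icc (0 : Fin d → ℝ) 1) :
    (cubeParam u : EuclideanSpace ℝ (Fin d)) = WithLp.toLp 2 u := by
  simp only [cubeParam]
  congr 1
  ext i
  rw [Set.projIcc_of_mem zero_le_one ⟨hu.1 i, hu.2 i⟩]

theorem exists_lipschitzOnWith_cubeParam (d : ℕ) :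
    ∃ K : NNReal, LipschitzOnWith K (cubeParam : (Fin d → ℝ) → unitCube d) (Set.Icc 0 1) := by
  refine ⟨(Fintype.card (Fin d) : NNReal) ^ (1 / (2 : ℝ≥0∞)).toReal, fun u hu v hv => ?_⟩
  rw [Subtype.edist_eq, coe_cubeParam hu, coe_cubeParam hv]
  exact PiLp.lipschitzWith_toLp 2 (fun _ : Fin d => ℝ) u v

theorem map_cubeParam (d : ℕ) :
    ((volume : Measure (Fin d → ℝ)).restrict (Set.Icc 0 1)).map cubeParam =
      (volume : Measure (EuclideanSpace ℝ (Fin d))).comap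
        ((↑) : unitCube d → EuclideanSpace ℝ (Fin d)) := by
  obtain ⟨K, hK⟩ := exists_lipschitzOnWith_cubeParam d
  have hQ : MeasurableSet (Set.Icc (0 : Fin d → ℝ) 1) := measurableSet_Icc
  ext s hs
  have hs' : MeasurableSet ((↑) '' s : Set (EuclideanSpace ℝ (Fin d))) :=
    (MeasurableEmbedding.subtype_coe (measurableSet_unitCube d)).measurableSet_image.2 hs
  rw [Measure.map_apply_of_aemeasurable (hK.continuousOn.aemeasurable hQ) hs,
    comap_subtype_coe_apply (measurableSet_unitCube d),
    Measure.restrict_apply₀' hQ.nullMeasurableSet,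
    ← (PiLp.volume_preserving_toLp (Fin d)).measure_preimage hs'.nullMeasurableSet]
  congr 1
  ext u
  simp only [Set.mem_inter_iff, Set.mem_preimage, Set.mem_image]
  constructor
  · rintro ⟨h1, h2⟩
    exact ⟨_, h1, coe_cubeParam h2⟩
  · rintro ⟨x, hx, hxu⟩
    have hu : u ∈ Set.Icc (0 : Fin d → ℝ) 1 := by
      have := x.2
      rw [hxu, unitCube_eq_preimage] at this
      exact this
    refine ⟨?_, hu⟩
    rwa [show cubeParam u = x from Subtype.ext ((coe_cubeParam hu).trans hxu.symm)]

section

variable {D : Type*} [MetricSpace D] [MeasurableSpace D] [BorelSpace D]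

theorem isTorusCell_univ_of_cube {d : ℕ} {μ : Measure D} (e : D ≃ᵢ unitCube d)
    (hμ : μ = ((volume : Measure (EuclideanSpace ℝ (Fin d))).comap
          ((↑) : unitCube d → EuclideanSpace ℝ (Fin d))).map e.symm) :
    IsTorusCell d μ Set.univ ∧ IsProbabilityMeasure μ := by
  obtain ⟨K, hK⟩ := exists_lipschitzOnWith_cubeParam d
  have hφ : LipschitzOnWith (1 * K) (e.symm ∘ cubeParam) (Set.Icc (0 : Fin d → ℝ) 1) :=
    (e.symm.isometry.lipschitz.lipschitzOnWith (s := Set.univ)).comp hK (Set.mapsTo_univ _ _)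
  have hQ : MeasurableSet (Set.Icc (0 : Fin d → ℝ) 1) := measurableSet_Icc
  have hm : ((volume : Measure (Fin d → ℝ)).restrict (Set.Icc 0 1)).map (e.symm ∘ cubeParam) =
      μ := by
    rw [hμ, ← map_cubeParam, AEMeasurable.map_map_of_aemeasurable]
    · exact e.symm.continuous.measurable.aemeasurable
    · exact hK.continuousOn.aemeasurable hQ
  refine ⟨isTorusCell_of_le MeasurableSet.univ hφ ENNReal.one_ne_top ?_ ?_, ?_⟩
  · rw [hm, one_smul]
  · rw [hm, one_smul, Measure.restrict_univ]
  · rw [← hm]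
    have : IsProbabilityMeasure ((volume : Measure (Fin d → ℝ)).restrict (Set.Icc 0 1)) :=
      ⟨by rw [Measure.restrict_apply_univ, Real.volume_Icc_pi]; simp⟩
    exact Measure.isProbabilityMeasure_map (hφ.continuousOn.aemeasurable hQ)

theorem nullSingletonClass_of_cube {d : ℕ} (hd : 1 ≤ d) {μ : Measure D} (e : D ≃ᵢ unitCube d)
    (hμ : μ = ((volume : Measure (EuclideanSpace ℝ (Fin d))).comap
          ((↑) : unitCube d → EuclideanSpace ℝ (Fin d))).map e.symm) :
    NullSingletonClass μ := by
  refine ⟨fun x => ?_⟩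
  -- In dimension zero the cube would be an atom.
  have : Nonempty (Fin d) := ⟨⟨0, hd⟩⟩
  rw [hμ, Measure.map_apply e.symm.continuous.measurable (measurableSet_singleton x),
    comap_subtype_coe_apply (measurableSet_unitCube d)]
  refine Set.Subsingleton.measure_zero ?_ _
  refine Set.Subsingleton.image ?_ _
  exact Set.subsingleton_singleton.preimage e.symm.injective

end

/-! ### Domains with bi-Lipschitz charts -/

/-- Every point is the image of the centre of the cube under a bi-Lipschitz parametrization of one
of its neighbourhoods. -/
def HasCubeCharts (d : ℕ) (D : Type*) [MetricSpace D] : Prop :=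
  ∀ x : D, ∃ (φ : (Fin d → ℝ) → D) (φ' : D → Fin d → ℝ) (K K' : NNReal),
    LipschitzOnWith K φ (Set.Icc 0 1) ∧ LipschitzOnWith K' φ' (φ '' Set.Icc 0 1) ∧
    (∀ u ∈ Set.Icc (0 : Fin d → ℝ) 1, φ' (φ u) = u) ∧ φ '' Set.Icc 0 1 ∈ 𝓝 x ∧
    φ (fun _ => 1 / 2) = x

section Charts

variable {D : Type*} [MetricSpace D] [MeasurableSpace D] [BorelSpace D] {d : ℕ}

theorem hausdorffMeasure_fin_real : (μH[(d : ℝ)] : Measure (Fin d → ℝ)) = volume := by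
  have := hausdorffMeasure_pi_real (ι := Fin d)
  rwa [Fintype.card_fin] at this

variable {φ : (Fin d → ℝ) → D} {φ' : D → Fin d → ℝ} {K K' : NNReal}

/-- With the next lemma, a bi-Lipschitz parametrization makes Hausdorff and Lebesgue measures
comparable. -/
theorem hausdorffMeasure_inter_image_le (hφ : LipschitzOnWith K φ (Set.Icc 0 1)) (s : Set D) :
    μH[(d : ℝ)] (s ∩ φ '' Set.Icc 0 1) ≤
      (K : ℝ≥0∞) ^ (d : ℝ) * volume (φ ⁻¹' s ∩ Set.Icc 0 1) := by
  rw [← hausdorffMeasure_fin_real, ← Set.image_preimage_inter]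
  exact (hφ.mono Set.inter_subset_right).hausdorffMeasure_image_le (Nat.cast_nonneg _)

theorem volume_preimage_inter_le (hφ' : LipschitzOnWith K' φ' (φ '' Set.Icc 0 1))
    (hinv : ∀ u ∈ Set.Icc (0 : Fin d → ℝ) 1, φ' (φ u) = u) (s : Set D) :
    volume (φ ⁻¹' s ∩ Set.Icc 0 1) ≤ (K' : ℝ≥0∞) ^ (d : ℝ) * μH[(d : ℝ)] s := by
  have h1 : φ ⁻¹' s ∩ Set.Icc 0 1 = φ' '' (s ∩ φ '' Set.Icc 0 1) := by
    rw [← Set.image_preimage_inter, Set.image_image]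
    refine (Set.EqOn.image_eq_self fun u hu => hinv u hu.2).symm
  rw [h1, ← hausdorffMeasure_fin_real]
  refine ((hφ'.mono Set.inter_subset_right).hausdorffMeasure_image_le (Nat.cast_nonneg _)).trans ?_
  exact mul_le_mul_right (measure_mono Set.inter_subset_left) _

theorem volume_Icc_zero_one : volume (Set.Icc (0 : Fin d → ℝ) 1) = 1 := by
  rw [Real.volume_Icc_pi]; simp

/-- Because the centre of the cube is an interior point, the preimage of `U` is a neighbourhood of
it and has positive volume. -/
theorem HasCubeCharts.hausdorffMeasure_pos (h : HasCubeCharts d D) {U : Set D} (hU : IsOpen U)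
    (hne : U.Nonempty) : μH[(d : ℝ)] U ≠ 0 := by
  obtain ⟨x, hx⟩ := hne
  obtain ⟨φ, φ', K, K', hφ, hφ', hinv, -, hx0⟩ := h x
  intro h0
  have h1 := volume_preimage_inter_le hφ' hinv U
  rw [h0, mul_zero] at h1
  have hQ : Set.Icc (0 : Fin d → ℝ) 1 ∈ 𝓝 (fun _ : Fin d => (1 / 2 : ℝ)) := by
    rw [← Set.pi_univ_Icc]
    refine set_pi_mem_nhds Set.finite_univ fun i _ => Icc_mem_nhds ?_ ?_ <;> norm_num
  have h2 : φ ⁻¹' U ∩ Set.Icc 0 1 ∈ 𝓝 (fun _ : Fin d => (1 / 2 : ℝ)) := by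
    refine inter_mem ?_ hQ
    refine (hφ.continuousOn.continuousAt hQ).preimage_mem_nhds ?_
    rw [hx0]
    exact hU.mem_nhds hx
  exact (Measure.measure_pos_of_mem_nhds volume h2).ne' (le_antisymm h1 zero_le)

theorem HasCubeCharts.hausdorffMeasure_ne_top [CompactSpace D] (h : HasCubeCharts d D) :
    μH[(d : ℝ)] (Set.univ : Set D) ≠ ⊤ := by
  refine (isCompact_univ.measure_lt_top_of_nhdsWithin fun x _ => ?_).ne
  obtain ⟨φ, φ', K, K', hφ, -, -, hx, -⟩ := h x
  refine ⟨_, mem_nhdsWithin_of_mem_nhds hx, ?_⟩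
  have := hausdorffMeasure_inter_image_le hφ Set.univ
  rw [Set.univ_inter, Set.preimage_univ, Set.univ_inter, volume_Icc_zero_one, mul_one] at this
  exact this.trans_lt (ENNReal.rpow_lt_top_of_nonneg (Nat.cast_nonneg _) ENNReal.coe_ne_top)

theorem nullSingletonClass_normalizedVolume (hd : 1 ≤ d) :
    NullSingletonClass (normalizedVolume d D) := by
  have := Measure.nullSingletonClass_hausdorff D (d := (d : ℝ)) (by exact_mod_cast hd)
  exact ⟨fun x => by simp [normalizedVolume]⟩

variable [CompactSpace D]

theorem HasCubeCharts.normalizedVolume_pos (h : HasCubeCharts d D) {U : Set D} (hU : IsOpen U)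
    (hne : U.Nonempty) : normalizedVolume d D U ≠ 0 :=
  mul_ne_zero (ENNReal.inv_ne_zero.2 h.hausdorffMeasure_ne_top) (h.hausdorffMeasure_pos hU hne)

variable [Nonempty D]

theorem HasCubeCharts.isProbabilityMeasure (h : HasCubeCharts d D) :
    IsProbabilityMeasure (normalizedVolume d D) :=
  ⟨ENNReal.inv_mul_cancel (h.hausdorffMeasure_pos isOpen_univ Set.univ_nonempty)
    h.hausdorffMeasure_ne_top⟩

theorem HasCubeCharts.exists_isTorusCell (h : HasCubeCharts d D) (x : D) :
    ∃ V ∈ 𝓝 x, IsTorusCell d (normalizedVolume d D) V := by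
  obtain ⟨φ, φ', K, K', hφ, hφ', hinv, hx, -⟩ := h x
  have hQ : MeasurableSet (Set.Icc (0 : Fin d → ℝ) 1) := measurableSet_Icc
  have hV : MeasurableSet (φ '' Set.Icc (0 : Fin d → ℝ) 1) :=
    (isCompact_Icc.image_of_continuousOn hφ.continuousOn).isClosed.measurableSet
  have hM0 := h.hausdorffMeasure_pos isOpen_univ Set.univ_nonempty
  have hMt := h.hausdorffMeasure_ne_top
  set M := μH[(d : ℝ)] (Set.univ : Set D)
  have hKt : (K : ℝ≥0∞) ^ (d : ℝ) ≠ ⊤ :=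
    ENNReal.rpow_ne_top_of_nonneg (Nat.cast_nonneg _) ENNReal.coe_ne_top
  have hKt' : (K' : ℝ≥0∞) ^ (d : ℝ) ≠ ⊤ :=
    ENNReal.rpow_ne_top_of_nonneg (Nat.cast_nonneg _) ENNReal.coe_ne_top
  have hμ : ∀ s, normalizedVolume d D s = M⁻¹ * μH[(d : ℝ)] s := fun s => rfl
  have hmap : ∀ s, MeasurableSet s →
      ((volume : Measure (Fin d → ℝ)).restrict (Set.Icc 0 1)).map φ s =
        volume (φ ⁻¹' s ∩ Set.Icc 0 1) := fun s hs => by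
    rw [Measure.map_apply_of_aemeasurable (hφ.continuousOn.aemeasurable hQ) hs,
      Measure.restrict_apply₀' hQ.nullMeasurableSet]
  -- Each summand of `A` serves one of the two comparisons, one for each Lipschitz constant.
  refine ⟨_, hx, isTorusCell_of_le hV hφ
    (A := M⁻¹ * (K : ℝ≥0∞) ^ (d : ℝ) + (K' : ℝ≥0∞) ^ (d : ℝ) * M) ?_ ?_ ?_⟩
  · exact ENNReal.add_ne_top.2 ⟨ENNReal.mul_ne_top (ENNReal.inv_ne_top.2 hM0) hKt,
      ENNReal.mul_ne_top hKt' hMt⟩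
  · refine Measure.le_iff.2 fun s hs => ?_
    rw [hmap s hs, Measure.smul_apply, smul_eq_mul, hμ]
    refine (volume_preimage_inter_le hφ' hinv s).trans ?_
    refine le_trans (le_of_eq ?_) (mul_le_mul_left le_add_self _)
    rw [mul_assoc, ← mul_assoc M, ENNReal.mul_inv_cancel hM0 hMt, one_mul]
  · refine Measure.le_iff.2 fun s hs => ?_
    rw [Measure.restrict_apply hs, Measure.smul_apply, smul_eq_mul, hμ, hmap s hs]
    refine (mul_le_mul_right (hausdorffMeasure_inter_image_le hφ s) _).trans ?_
    rw [← mul_assoc]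
    exact mul_le_mul_left le_self_add _

/-- A connected overlap graph. -/
theorem reflTransGen_of_isPreconnected {X ι : Type*} [TopologicalSpace X] [PreconnectedSpace X]
    {U : ι → Set X} (hU : ∀ i, IsOpen (U i)) (hne : ∀ i, (U i).Nonempty)
    (hcov : ⋃ i, U i = Set.univ) (i j : ι) :
    Relation.ReflTransGen (fun i j => (U j ∩ U i).Nonempty) i j := by
  set R : ι → ι → Prop := fun i j => (U j ∩ U i).Nonempty
  -- The union of the sets reachable from `i` is open, and so is its complement; by connectedness it
  -- is everything.
  set S := ⋃ k ∈ {k | Relation.ReflTransGen R i k}, U k with hS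
  have hmem : ∀ x, x ∈ S ↔ ∃ k, Relation.ReflTransGen R i k ∧ x ∈ U k := fun x => by
    simp [hS]
  have hopen : IsOpen S := isOpen_biUnion fun k _ => hU k
  have key : ∀ k x, x ∈ U k → x ∈ S → Relation.ReflTransGen R i k := fun k x hk hx => by
    obtain ⟨l, hl, hxl⟩ := (hmem x).1 hx
    exact hl.tail ⟨x, hk, hxl⟩
  have hclosed : IsClosed S := by
    refine ⟨isOpen_iff_mem_nhds.2 fun x hx => ?_⟩
    obtain ⟨k, hk⟩ := Set.mem_iUnion.1 (hcov ▸ Set.mem_univ x)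
    refine mem_of_superset ((hU k).mem_nhds hk) fun y hy hyS => hx ?_
    exact (hmem x).2 ⟨k, key k y hy hyS, hk⟩
  obtain ⟨x, hx⟩ := hne i
  have hSu : S = Set.univ := IsClopen.eq_univ ⟨hclosed, hopen⟩
    ⟨x, (hmem x).2 ⟨i, Relation.ReflTransGen.refl, hx⟩⟩
  obtain ⟨y, hy⟩ := hne j
  exact key j y hy (hSu ▸ Set.mem_univ y)

/-- Interiors of finitely many cells cover by compactness. Connectedness links them by nonempty open
overlaps, which have positive measure. -/
theorem HasCubeCharts.exists_relaxedDist_le [PreconnectedSpace D] (h : HasCubeCharts d D) :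
    ∃ B : ℝ≥0∞, B ≠ ⊤ ∧ ∀ η γ : MPPlan (normalizedVolume d D), relaxedDist η γ ≤ B := by
  have := h.isProbabilityMeasure
  choose V hV hcell using h.exists_isTorusCell
  obtain ⟨t, -, ht⟩ := isCompact_univ.elim_nhds_subcover (fun x => interior (V x))
    fun x _ => interior_mem_nhds.2 (hV x)
  have hcov : ⋃ x : t, interior (V x) = Set.univ := by
    rw [Set.iUnion_subtype]; exact Set.univ_subset_iff.1 ht
  refine exists_relaxedDist_le_of_cells (d := d) (V := fun x : t => V x) (fun x => hcell x) ?_ ?_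
  · exact Set.univ_subset_iff.1 (hcov ▸ Set.iUnion_mono fun x => interior_subset)
  · intro x y
    refine Relation.ReflTransGen.mono (fun x y hxy h0 => ?_) x y
      (reflTransGen_of_isPreconnected (U := fun x : t => interior (V x))
        (fun x => isOpen_interior) (fun x => ⟨x, mem_interior_iff_mem_nhds.2 (hV x)⟩) hcov x y)
    refine h.normalizedVolume_pos (isOpen_interior.inter isOpen_interior) hxy ?_
    exact measure_mono_null (Set.inter_subset_inter interior_subset interior_subset) h0

end Charts

/-! ### Riemannian manifolds have bi-Lipschitz charts -/

section

variable {d : ℕ} {D : Type*} [MetricSpace D] [ChartedSpace (EuclideanSpace ℝ (Fin d)) D]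
  [Bundle.RiemannianBundle (fun x : D => TangentSpace (𝓡 d) x)]

/-- The distance being finite, there is a curve of finite length between any two points. -/
theorem pathConnectedSpace_of_isRiemannianManifold [Nonempty D] [IsRiemannianManifold (𝓡 d) D] :
    PathConnectedSpace D := by
  refine ⟨‹_›, fun x y => ?_⟩
  have h : edist x y < ⊤ := edist_lt_top x y
  rw [IsRiemannianManifold.out (I := 𝓡 d)] at h
  obtain ⟨γ, h0, h1, hγ, -⟩ := Manifold.exists_lt_of_riemannianEDist_lt h
  have hc : Continuous fun t : unitInterval => γ t := hγ.continuousOn.domRestrict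
  exact ⟨⟨⟨fun t => γ t, hc⟩, by simpa using h0, by simpa using h1⟩⟩

theorem hasCubeCharts_of_isRiemannianManifold [IsManifold (𝓡 d) 1 D]
    [IsContinuousRiemannianBundle (EuclideanSpace ℝ (Fin d)) (fun x : D => TangentSpace (𝓡 d) x)]
    [IsRiemannianManifold (𝓡 d) D] : HasCubeCharts d D := by
  intro x
  obtain ⟨C, r, hr, htgt, hC⟩ := exists_ball_edist_extChartAt_symm_le (𝓡 d) x
  obtain ⟨C', U, hU, hUs, hC'⟩ := exists_mem_nhds_edist_extChartAt_le (𝓡 d) x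
  set ch := extChartAt (𝓡 d) x with hch
  set p : Fin d → ℝ := WithLp.ofLp (ch x) with hp
  have hcont : ContinuousAt ch.symm (ch x) := continuousAt_extChartAt_symm x
  have hsx : ch.symm (ch x) = x := extChartAt_to_inv x
  have hW : {w : Fin d → ℝ | WithLp.toLp 2 w ∈ Metric.ball (ch x) r ∩ ch.symm ⁻¹' U} ∈ 𝓝 p := by
    have h1 : Metric.ball (ch x) r ∩ ch.symm ⁻¹' U ∈ 𝓝 (ch x) :=
      inter_mem (Metric.ball_mem_nhds _ hr) (hcont.preimage_mem_nhds (by rwa [hsx]))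
    exact (PiLp.continuous_toLp 2 (fun _ : Fin d => ℝ)).continuousAt.preimage_mem_nhds h1
  -- A closed sup-norm ball is a cube; it is chosen small enough for the Lipschitz bounds of both
  -- the chart and its inverse, and `g` is the affine map from `[0,1]^d` onto it.
  obtain ⟨s, hs, hball⟩ := Metric.nhds_basis_closedBall.mem_iff.1 hW
  let g : (Fin d → ℝ) → EuclideanSpace ℝ (Fin d) := fun u =>
    WithLp.toLp 2 (p + s • ((2 : ℝ) • u - 1))
  let g' : EuclideanSpace ℝ (Fin d) → Fin d → ℝ := fun y =>
    (2 : ℝ)⁻¹ • (s⁻¹ • (WithLp.ofLp y - p) + 1)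
  have hg'g : ∀ u, g' (g u) = u := fun u => by
    simp only [g, g', add_sub_cancel_left, smul_smul, inv_mul_cancel₀ hs.ne', one_smul,
      sub_add_cancel]
    norm_num
  have hgg' : ∀ y, g (g' y) = y := fun y => by
    simp only [g, g', smul_smul]
    rw [mul_inv_cancel₀ two_ne_zero, one_smul, add_sub_cancel_right, smul_smul,
      mul_inv_cancel₀ hs.ne', one_smul, add_sub_cancel]
  have hgQ : ∀ u ∈ Set.Icc (0 : Fin d → ℝ) 1, p + s • ((2 : ℝ) • u - 1) ∈
      Metric.closedBall p s := by
    intro u hu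
    rw [Metric.mem_closedBall, dist_pi_le_iff hs.le]
    intro i
    have h1 := hu.1 i
    have h2 := hu.2 i
    simp only [Pi.zero_apply, Pi.one_apply] at h1 h2
    rw [Real.dist_eq]
    simp only [Pi.add_apply, Pi.smul_apply, Pi.sub_apply, Pi.one_apply, smul_eq_mul,
      add_sub_cancel_left]
    rw [abs_mul, abs_of_pos hs]
    refine mul_le_of_le_one_right hs.le (abs_le.2 ⟨by linarith, by linarith⟩)
  have hgm : ∀ u ∈ Set.Icc (0 : Fin d → ℝ) 1, g u ∈ Metric.ball (ch x) r ∩ ch.symm ⁻¹' U :=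
    fun u hu => hball (hgQ u hu)
  have hgL : ∃ A : NNReal, LipschitzWith A g := by
    refine ⟨_, (PiLp.lipschitzWith_toLp 2 (fun _ : Fin d => ℝ)).comp
      ((LipschitzWith.const p).add ((lipschitzWith_smul s).comp
        ((lipschitzWith_smul (2 : ℝ)).sub (LipschitzWith.const 1))))⟩
  have hgL' : ∃ A : NNReal, LipschitzWith A g' := by
    refine ⟨_, (lipschitzWith_smul (2 : ℝ)⁻¹).comp (((lipschitzWith_smul s⁻¹).comp
      ((PiLp.lipschitzWith_ofLp 2 (fun _ : Fin d => ℝ)).sub (LipschitzWith.const p))).add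
        (LipschitzWith.const 1))⟩
  obtain ⟨A, hA⟩ := hgL
  obtain ⟨A', hA'⟩ := hgL'
  have hinv : ∀ u ∈ Set.Icc (0 : Fin d → ℝ) 1, g' (ch (ch.symm (g u))) = u := fun u hu => by
    rw [ch.right_inv (htgt (hgm u hu).1), hg'g]
  refine ⟨fun u => ch.symm (g u), fun y => g' (ch y), C * A, A' * C', ?_, ?_, hinv, ?_, ?_⟩
  · intro u hu v hv
    refine (hC _ (hgm u hu).1 _ (hgm v hv).1).trans ?_
    rw [ENNReal.coe_mul, mul_assoc]
    exact mul_le_mul_right (hA u v) _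
  · rintro _ ⟨u, hu, rfl⟩ _ ⟨v, hv, rfl⟩
    refine (hA' _ _).trans ?_
    rw [ENNReal.coe_mul, mul_assoc]
    exact mul_le_mul_right (hC' _ (hgm u hu).2 _ (hgm v hv).2) _
  · have h1 : {y : D | WithLp.ofLp (ch y) ∈ Metric.closedBall p s} ∈ 𝓝 x := by
      have h2 : ContinuousAt (fun y => WithLp.ofLp (ch y)) x :=
        (PiLp.continuous_ofLp 2 (fun _ : Fin d => ℝ)).continuousAt.comp (continuousAt_extChartAt x)
      exact h2.preimage_mem_nhds (Metric.closedBall_mem_nhds _ hs)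
    filter_upwards [h1, extChartAt_source_mem_nhds (I := 𝓡 d) x] with y hy hys
    refine ⟨g' (ch y), ?_, ?_⟩
    · rw [Metric.mem_closedBall, dist_pi_le_iff hs.le] at hy
      have h3 : ∀ i, |s⁻¹ * ((ch y).ofLp i - p i)| ≤ 1 := fun i => by
        rw [abs_mul, abs_of_pos (inv_pos.2 hs), inv_mul_le_iff₀ hs, mul_one]
        exact hy i
      refine ⟨fun i => ?_, fun i => ?_⟩
      · have := (abs_le.1 (h3 i)).1
        simp only [g', Pi.zero_apply, Pi.smul_apply, Pi.add_apply, Pi.sub_apply, Pi.one_apply,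
          smul_eq_mul]
        linarith
      · have := (abs_le.1 (h3 i)).2
        simp only [g', Pi.smul_apply, Pi.add_apply, Pi.sub_apply, Pi.one_apply, smul_eq_mul]
        linarith
    · change ch.symm (g (g' (ch y))) = y
      rw [hgg', ch.left_inv hys]
  · have h1 : g (fun _ => 1 / 2) = ch x := by
      have : (2 : ℝ) • (fun _ : Fin d => (1 / 2 : ℝ)) - 1 = 0 := by
        ext i; simp
      simp only [g, this, smul_zero, add_zero, hp]
    change ch.symm (g _) = x
    rw [h1, hsx]

end

/-- The relaxed distance is bounded, and the measure is a probability measure without atoms. -/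
theorem IsFluidDomain.exists_relaxedDist_le {d : ℕ} (hd : 1 ≤ d) {D : Type*} [MetricSpace D]
    [CompactSpace D] [Nonempty D] [MeasurableSpace D] [BorelSpace D] {μ : Measure D}
    (hD : IsFluidDomain d D μ) : IsProbabilityMeasure μ ∧ NullSingletonClass μ ∧
      ∃ B : ℝ≥0∞, B ≠ ⊤ ∧ ∀ η γ : MPPlan μ, relaxedDist η γ ≤ B := by
  induction hD with
  | @riemannian _ _ _ _ _ hμ =>
    have : IsManifold (𝓡 d) 1 D := IsManifold.of_le (n := ∞) (by simp)
    have : IsContinuousRiemannianBundle (EuclideanSpace ℝ (Fin d))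
        (fun x : D => TangentSpace (𝓡 d) x) := by
      obtain ⟨g, hg, hg'⟩ := ‹IsContMDiffRiemannianBundle (𝓡 d) ∞ (EuclideanSpace ℝ (Fin d))
        (fun x : D => TangentSpace (𝓡 d) x)›.exists_contMDiff
      exact ⟨g, hg.continuous, hg'⟩
    have hc : HasCubeCharts d D := hasCubeCharts_of_isRiemannianManifold
    have : PathConnectedSpace D := pathConnectedSpace_of_isRiemannianManifold (d := d)
    subst hμ
    exact ⟨hc.isProbabilityMeasure, nullSingletonClass_normalizedVolume hd,
      hc.exists_relaxedDist_le⟩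
  | cube e hμ =>
    obtain ⟨h1, h2⟩ := isTorusCell_univ_of_cube e hμ
    refine ⟨h2, nullSingletonClass_of_cube hd e hμ, ?_⟩
    exact exists_relaxedDist_le_of_cells (ι := Unit) (V := fun _ => Set.univ) (fun _ => h1)
      (Set.iUnion_const _) fun _ _ => Relation.ReflTransGen.refl

/-! ### Oscillating functions on an atomless probability space -/

/-- The jump of the distribution function at `x` is the mass of `x`. -/
theorem continuous_cdf (ν : Measure ℝ) [IsProbabilityMeasure ν] [NullSingletonClass ν] :
    Continuous (cdf ν) := by
  refine continuous_iff_continuousAt.2 fun x => ?_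
  rw [(monotone_cdf ν).continuousAt_iff_leftLim_eq_rightLim, StieltjesFunction.rightLim_eq]
  have h := (cdf ν).measure_singleton x
  rw [measure_cdf, measure_singleton, eq_comm, ENNReal.ofReal_eq_zero, sub_nonpos] at h
  exact le_antisymm ((monotone_cdf ν).leftLim_le le_rfl) h

/-- Continuity lets the distribution function take every value of `(0,1)`. If it equals `b > a` at
`x`, the set where it is at most `a` lies below `x`; letting `b` decrease to `a` avoids locating the
end of a flat piece. -/
theorem map_cdf_of_nullSingletonClass (ν : Measure ℝ) [IsProbabilityMeasure ν]
    [NullSingletonClass ν] : ν.map (cdf ν) = (volume : Measure ℝ).restrict (Set.Icc 0 1) := by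
  have hc := continuous_cdf ν
  have hmono := monotone_cdf ν
  have hsol : ∀ a ∈ Set.Ioo (0 : ℝ) 1, ∃ x, cdf ν x = a := fun a ha =>
    mem_range_of_exists_le_of_exists_ge hc
      (((tendsto_cdf_atBot ν).eventually_le_const ha.1).exists)
      (((tendsto_cdf_atTop ν).eventually_const_le ha.2).exists)
  have hIic : ∀ x, ν (Set.Iic x) = ENNReal.ofReal (cdf ν x) := fun x => (ofReal_cdf ν x).symm
  have : IsFiniteMeasure (ν.map (cdf ν)) := Measure.isFiniteMeasure_map _ _
  refine Measure.ext_of_Iic _ _ fun a => ?_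
  rw [Measure.map_apply hc.measurable measurableSet_Iic, Measure.restrict_apply measurableSet_Iic]
  have h2 : Set.Iic a ∩ Set.Icc 0 1 = Set.Icc 0 (min 1 a) := by
    ext x
    simp only [Set.mem_inter_iff, Set.mem_Iic, Set.mem_Icc, le_min_iff]
    tauto
  rw [h2, Real.volume_Icc, sub_zero]
  have hle : ∀ b ∈ Set.Ioo (0 : ℝ) 1, ∀ c < b, ν (cdf ν ⁻¹' Set.Iic c) ≤ ENNReal.ofReal b := by
    intro b hb c hcb
    obtain ⟨x, hx⟩ := hsol b hb
    rw [← hx, ← hIic]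
    refine measure_mono fun y hy => ?_
    by_contra hxy
    have := hmono (not_le.1 hxy).le
    exact absurd (this.trans hy) (by rw [hx]; exact not_le.2 hcb)
  rcases le_or_gt 1 a with ha | ha
  · rw [min_eq_left ha, ENNReal.ofReal_one]
    have : cdf ν ⁻¹' Set.Iic a = Set.univ :=
      Set.eq_univ_of_forall fun x => (cdf_le_one ν x).trans ha
    rw [this, measure_univ]
  rw [min_eq_right ha.le]
  refine le_antisymm ?_ ?_
  · rcases lt_or_ge a 0 with h0 | h0
    · have : cdf ν ⁻¹' Set.Iic a = ∅ :=
        Set.eq_empty_of_forall_notMem fun x hx => absurd ((cdf_nonneg ν x).trans hx) (not_le.2 h0)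
      simp [this]
    · have hlim : Tendsto (fun b => ENNReal.ofReal b) (𝓝[>] a) (𝓝 (ENNReal.ofReal a)) :=
        (ENNReal.continuous_ofReal.tendsto a).mono_left nhdsWithin_le_nhds
      refine ge_of_tendsto hlim ?_
      filter_upwards [Ioo_mem_nhdsGT ha] with b hb
      exact hle b ⟨h0.trans_lt hb.1, hb.2⟩ a hb.1
  · rcases le_or_gt a 0 with h0 | h0
    · simp [ENNReal.ofReal_of_nonpos h0]
    · obtain ⟨x, hx⟩ := hsol a ⟨h0, ha⟩
      rw [← hx, ← hIic]
      exact measure_mono fun y hy => hmono hy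

theorem exists_uniform_variable {X : Type*} [MeasurableSpace X] [StandardBorelSpace X]
    (μ : Measure X) [IsProbabilityMeasure μ] [NullSingletonClass μ] :
    ∃ T : X → ℝ, Measurable T ∧ μ.map T = (volume : Measure ℝ).restrict (Set.Icc 0 1) := by
  have he := measurableEmbedding_embeddingReal X
  have : IsProbabilityMeasure (μ.map (embeddingReal X)) :=
    Measure.isProbabilityMeasure_map he.measurable.aemeasurable
  have : NullSingletonClass (μ.map (embeddingReal X)) := ⟨fun x => by
    rw [Measure.map_apply he.measurable (measurableSet_singleton x)]
    exact (Set.subsingleton_singleton.preimage he.injective).measure_zero _⟩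
  refine ⟨cdf (μ.map (embeddingReal X)) ∘ embeddingReal X,
    (continuous_cdf _).measurable.comp he.measurable, ?_⟩
  rw [← Measure.map_map (continuous_cdf _).measurable he.measurable,
    map_cdf_of_nullSingletonClass]

theorem integral_cos_two_pi_int_mul (k : ℤ) :
    ∫ t in Set.Icc (0 : ℝ) 1, Real.cos (2 * Real.pi * k * t) = if k = 0 then 1 else 0 := by
  rw [integral_Icc_eq_integral_Ioc, ← intervalIntegral.integral_of_le zero_le_one]
  split_ifs with hk
  · simp [hk]
  · have hk' : (2 * Real.pi * k : ℝ) ≠ 0 :=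
      mul_ne_zero Real.two_pi_pos.ne' (by exact_mod_cast hk)
    rw [intervalIntegral.integral_comp_mul_left (fun t => Real.cos t) hk', integral_cos, mul_one,
      mul_zero, Real.sin_zero, sub_zero]
    have : Real.sin (2 * Real.pi * k) = 0 := by
      rw [show 2 * Real.pi * (k : ℝ) = ((2 * k : ℤ) : ℝ) * Real.pi by push_cast; ring]
      exact Real.sin_int_mul_pi _
    rw [this, smul_zero]

/-- On an atomless probability space, there is a bounded sequence of centred functions with a fixed
variance which converges weakly to zero. -/
theorem exists_oscillating_sequence {X : Type*} [MeasurableSpace X] [StandardBorelSpace X]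
    (μ : Measure X) [IsProbabilityMeasure μ] [NullSingletonClass μ] :
    ∃ s : ℕ → X → ℝ, (∀ n, Measurable (s n)) ∧ (∀ n x, |s n x| ≤ 1) ∧ (∀ n, ∫ x, s n x ∂μ = 0) ∧
      (∀ n, ∫ x, s n x ^ 2 ∂μ = 1 / 2) ∧
      ∀ G : X → ℝ, Measurable G → (∃ C, ∀ x, |G x| ≤ C) →
        Tendsto (fun n => ∫ x, s n x * G x ∂μ) atTop (𝓝 0) := by
  obtain ⟨T, hT, hTμ⟩ := exists_uniform_variable μ
  have hint : ∀ k : ℤ, ∫ x, Real.cos (2 * Real.pi * k * T x) ∂μ = if k = 0 then 1 else 0 := by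
    intro k
    rw [← integral_cos_two_pi_int_mul, ← hTμ, integral_map hT.aemeasurable]
    exact (by fun_prop : Continuous fun t : ℝ => Real.cos (2 * Real.pi * k * t)).aestronglyMeasurable
  -- The frequency `n + 1` excludes the constant function.
  set s : ℕ → X → ℝ := fun n x => Real.cos (2 * Real.pi * ((n + 1 : ℤ) : ℝ) * T x) with hs
  have hsm : ∀ n, Measurable (s n) := fun n => by fun_prop
  have hs1 : ∀ n x, |s n x| ≤ 1 := fun n x => Real.abs_cos_le_one _
  have hcosint : ∀ k : ℤ, Integrable (fun x => Real.cos (2 * Real.pi * k * T x)) μ := fun k =>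
    Integrable.of_bound (by fun_prop : Measurable _).aestronglyMeasurable 1
      (Eventually.of_forall fun x => Real.abs_cos_le_one _)
  have hprod : ∀ n m, ∫ x, s n x * s m x ∂μ = if n = m then 1 / 2 else 0 := by
    intro n m
    have h1 : ∀ x, s n x * s m x = (1 / 2) * (Real.cos (2 * Real.pi * ((n - m : ℤ) : ℝ) * T x) +
        Real.cos (2 * Real.pi * ((n + m + 2 : ℤ) : ℝ) * T x)) := by
      intro x
      have h2 := Real.cos_add (2 * Real.pi * ((n + 1 : ℤ) : ℝ) * T x)
        (2 * Real.pi * ((m + 1 : ℤ) : ℝ) * T x)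
      have h3 := Real.cos_sub (2 * Real.pi * ((n + 1 : ℤ) : ℝ) * T x)
        (2 * Real.pi * ((m + 1 : ℤ) : ℝ) * T x)
      have e1 : 2 * Real.pi * ((n - m : ℤ) : ℝ) * T x = 2 * Real.pi * ((n + 1 : ℤ) : ℝ) * T x -
        2 * Real.pi * ((m + 1 : ℤ) : ℝ) * T x := by push_cast; ring
      have e2 : 2 * Real.pi * ((n + m + 2 : ℤ) : ℝ) * T x = 2 * Real.pi * ((n + 1 : ℤ) : ℝ) * T x +
        2 * Real.pi * ((m + 1 : ℤ) : ℝ) * T x := by push_cast; ring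
      rw [e1, e2, h2, h3]
      simp only [hs]
      ring
    simp only [h1]
    rw [integral_const_mul, integral_add (hcosint _) (hcosint _), hint, hint,
      if_neg (by omega : ¬ ((n : ℤ) + m + 2 = 0))]
    by_cases hnm : n = m
    · simp [hnm]
    · rw [if_neg (by omega : ¬ ((n : ℤ) - m = 0)), if_neg hnm]
      norm_num
  refine ⟨s, hsm, hs1, fun n => ?_, fun n => ?_, fun G hG ⟨C, hC⟩ => ?_⟩
  · rw [hint, if_neg (by omega)]
  · simpa [sq] using hprod n n
  · have hL : ∀ n, MemLp (fun x => √2 * s n x) 2 μ := fun n =>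
      MemLp.of_bound ((hsm n).const_mul _).aestronglyMeasurable √2 (Eventually.of_forall fun x => by
        rw [norm_mul, Real.norm_of_nonneg (Real.sqrt_nonneg 2)]
        exact mul_le_of_le_one_right (Real.sqrt_nonneg 2) (hs1 n x))
    have hGL : MemLp G 2 μ := MemLp.of_bound hG.aestronglyMeasurable C (Eventually.of_forall hC)
    -- Weak convergence to zero is Bessel's inequality: the coefficients of `G` on an orthonormal
    -- family are square summable.
    have horth : Orthonormal ℝ fun n => (hL n).toLp := by
      rw [orthonormal_iff_ite]
      intro n m
      rw [L2.inner_def]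
      have h1 : ∫ x, inner ℝ ((hL n).toLp _ x) ((hL m).toLp _ x) ∂μ = ∫ x, 2 * (s n x * s m x) ∂μ := by
        refine integral_congr_ae ?_
        filter_upwards [(hL n).coeFn_toLp, (hL m).coeFn_toLp] with x hx hy
        rw [hx, hy, RCLike.inner_apply, conj_trivial]
        linear_combination (s n x * s m x) * Real.mul_self_sqrt (by norm_num : (0 : ℝ) ≤ 2)
      rw [h1, integral_const_mul, hprod]
      split_ifs <;> norm_num
    have hsum := (horth.inner_products_summable hGL.toLp).tendsto_atTop_zero
    have hinner : ∀ n, inner ℝ ((hL n).toLp) hGL.toLp = √2 * ∫ x, s n x * G x ∂μ := by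
      intro n
      rw [L2.inner_def, ← integral_const_mul]
      refine integral_congr_ae ?_
      filter_upwards [(hL n).coeFn_toLp, hGL.coeFn_toLp] with x hx hy
      rw [hx, hy, RCLike.inner_apply, conj_trivial]
      ring
    simp only [hinner] at hsum
    refine squeeze_zero_norm (a := fun n => √(‖√2 * ∫ x, s n x * G x ∂μ‖ ^ 2)) (fun n => ?_) ?_
    · rw [Real.sqrt_sq (norm_nonneg _), norm_mul, Real.norm_of_nonneg (Real.sqrt_nonneg 2)]
      exact le_mul_of_one_le_left (norm_nonneg _) (Real.one_le_sqrt.2 one_le_two)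
    · simpa using hsum.sqrt

/-! ### Plans which converge narrowly but not for the relaxed distance -/

section

variable {D : Type*} [MetricSpace D] [CompactSpace D] [MeasurableSpace D] [BorelSpace D]
  {μ : Measure D} [IsProbabilityMeasure μ]

/-- The distance to a point `x₀` of the support, centred and divided by `B + 1`. If it were almost
surely equal to its mean `m`, then either `m = 0` and `x₀` is an atom, or the ball of radius `m`
around `x₀` is null. -/
theorem exists_centred_lipschitz (μ : Measure D) [IsProbabilityMeasure μ]
    [NullSingletonClass μ] : ∃ (φ : D → ℝ) (L : NNReal), L ≠ 0 ∧ LipschitzWith L φ ∧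
      (∀ x, |φ x| ≤ 1) ∧ ∫ x, φ x ∂μ = 0 ∧ 0 < ∫ x, φ x ^ 2 ∂μ := by
  obtain ⟨x₀, -, hx₀⟩ := exists_mem_forall_mem_nhdsWithin_pos_measure (μ := μ) (s := Set.univ)
    (by simp)
  simp only [nhdsWithin_univ] at hx₀
  have hf : LipschitzWith 1 fun x : D => dist x x₀ := LipschitzWith.dist_left x₀
  obtain ⟨B, hB⟩ : ∃ B, ∀ x : D, dist x x₀ ≤ B :=
    ⟨Metric.diam (Set.univ : Set D), fun x =>
      Metric.dist_le_diam_of_mem isCompact_univ.isBounded (Set.mem_univ _) (Set.mem_univ _)⟩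
  have hB0 : 0 ≤ B := dist_nonneg.trans (hB x₀)
  have hfi : Integrable (fun x => dist x x₀) μ :=
    Integrable.of_bound hf.continuous.measurable.aestronglyMeasurable B
      (Eventually.of_forall fun x => by rw [Real.norm_of_nonneg dist_nonneg]; exact hB x)
  set m := ∫ x, dist x x₀ ∂μ with hm
  have hm0 : 0 ≤ m := integral_nonneg fun x => dist_nonneg
  have hmB : m ≤ B := by
    have := integral_mono hfi (integrable_const B) hB
    simpa using this
  set K : ℝ := B + 1 with hK
  have hK0 : 0 < K := by positivity
  have hφ1 : ∀ x, |K⁻¹ * (dist x x₀ - m)| ≤ 1 := by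
    intro x
    rw [abs_mul, abs_of_pos (inv_pos.2 hK0), inv_mul_le_iff₀ hK0, mul_one, abs_le]
    have h1 := hB x
    have h2 : 0 ≤ dist x x₀ := dist_nonneg
    constructor <;> linarith
  have hcont : Continuous fun x : D => K⁻¹ * (dist x x₀ - m) :=
    continuous_const.mul (hf.continuous.sub continuous_const)
  refine ⟨fun x => K⁻¹ * (dist x x₀ - m), K⁻¹.toNNReal, ?_, ?_, hφ1, ?_, ?_⟩
  · simpa using hK0
  · refine LipschitzWith.of_dist_le_mul fun x y => ?_
    rw [Real.coe_toNNReal _ (inv_pos.2 hK0).le, Real.dist_eq, ← mul_sub, abs_mul,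
      abs_of_pos (inv_pos.2 hK0), sub_sub_sub_cancel_right]
    exact mul_le_mul_of_nonneg_left (abs_dist_sub_le x y x₀) (inv_pos.2 hK0).le
  · rw [integral_const_mul, integral_sub hfi (integrable_const _)]
    simp [← hm]
  · have hint : Integrable (fun x => (K⁻¹ * (dist x x₀ - m)) ^ 2) μ :=
      Integrable.of_bound (hcont.pow 2).measurable.aestronglyMeasurable 1
        (Eventually.of_forall fun x => by
          rw [norm_pow]; exact pow_le_one₀ (norm_nonneg _) (hφ1 x))
    refine lt_of_le_of_ne (integral_nonneg fun x => sq_nonneg _) fun h0 => ?_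
    have h1 := (integral_eq_zero_iff_of_nonneg (fun x => sq_nonneg _) hint).1 h0.symm
    have h2 : ∀ᵐ x ∂μ, dist x x₀ = m := by
      filter_upwards [h1] with x hx
      have h3 : K⁻¹ * (dist x x₀ - m) = 0 := pow_eq_zero_iff two_ne_zero |>.1 hx
      have := (mul_eq_zero.1 h3).resolve_left (inv_pos.2 hK0).ne'
      linarith
    rcases hm0.eq_or_lt with h | h
    · have h3 : ∀ᵐ x ∂μ, x = x₀ := by
        filter_upwards [h2] with x hx
        rwa [← h, dist_eq_zero] at hx
      have h4 : μ Set.univ ≤ μ {x₀} := measure_mono_ae (by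
        filter_upwards [h3] with x hx _ using hx)
      simp at h4
    · have h3 := hx₀ _ (Metric.ball_mem_nhds x₀ h)
      have h4 : μ (Metric.ball x₀ m) = 0 :=
        measure_mono_null (fun x hx => (Metric.mem_ball.1 hx).ne) h2
      exact h3.ne' h4

/-- The plan with a given density with respect to the product plan. -/
theorem exists_plan_of_density {ρ : D × D → ℝ≥0∞} (hρ : Measurable ρ)
    (h₁ : ∀ a, ∫⁻ x, ρ (a, x) ∂μ = 1) (h₂ : ∀ x, ∫⁻ a, ρ (a, x) ∂μ = 1) :
    ∃ η : MPPlan μ, (η.plan : Measure (D × D)) = (μ.prod μ).withDensity ρ := by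
  refine ⟨MPPlan.ofMeasure ((μ.prod μ).withDensity ρ) ?_ ?_, rfl⟩
  · ext s hs
    rw [Measure.map_apply measurable_fst hs, withDensity_apply _ (measurable_fst hs),
      ← Set.prod_univ, ← Measure.prod_restrict, Measure.restrict_univ,
      lintegral_prod _ hρ.aemeasurable]
    simp [h₁]
  · ext s hs
    rw [Measure.map_apply measurable_snd hs, withDensity_apply _ (measurable_snd hs),
      ← Set.univ_prod, ← Measure.prod_restrict, Measure.restrict_univ,
      lintegral_prod_symm _ hρ.aemeasurable]
    simp [h₂]

variable [Nonempty D]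

/-- The relaxed distance is strictly finer than the narrow topology. -/
theorem exists_tendsto_plan_of_le_relaxedCost (μ : Measure D) [IsProbabilityMeasure μ]
    [NullSingletonClass μ] : ∃ (u : ℕ → MPPlan μ) (γ : MPPlan μ) (c : ℝ≥0∞), c ≠ 0 ∧
      Tendsto (fun n => (u n).plan) atTop (𝓝 γ.plan) ∧ ∀ n, c ≤ relaxedCost (u n) γ := by
  obtain ⟨s, hsm, hs1, hs0, hs2, hslim⟩ := exists_oscillating_sequence μ
  obtain ⟨φ, L, hL0, hL, hφ1, hφ0, hφ2⟩ := exists_centred_lipschitz μ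
  have hφm : Measurable φ := hL.continuous.measurable
  have hsφ : ∀ n a x, |s n a * φ x| ≤ 1 := fun n a x => by
    rw [abs_mul]; exact mul_le_one₀ (hs1 n a) (abs_nonneg _) (hφ1 x)
  have hnn : ∀ n a x, 0 ≤ 1 + s n a * φ x := fun n a x => by
    linarith [(abs_le.1 (hsφ n a x)).1]
  have hsint : ∀ n, Integrable (s n) μ := fun n =>
    Integrable.of_bound (hsm n).aestronglyMeasurable 1 (Eventually.of_forall (hs1 n))
  have hφint : Integrable φ μ :=
    Integrable.of_bound hφm.aestronglyMeasurable 1 (Eventually.of_forall hφ1)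
  have hρm : ∀ n, Measurable fun p : D × D => s n p.1 * φ p.2 := fun n =>
    ((hsm n).comp measurable_fst).mul (hφm.comp measurable_snd)
  -- Both factors are centred, so the perturbation changes neither marginal; both are bounded by 1,
  -- so the density is nonnegative.
  have hplan : ∀ n, ∃ η : MPPlan μ, (η.plan : Measure (D × D)) =
      (μ.prod μ).withDensity fun p => ENNReal.ofReal (1 + s n p.1 * φ p.2) := by
    intro n
    refine exists_plan_of_density ((hρm n).const_add 1).ennreal_ofReal (fun a => ?_) fun x => ?_
    · have hi : Integrable (fun x => 1 + s n a * φ x) μ :=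
        (integrable_const 1).add (hφint.const_mul _)
      rw [← ofReal_integral_eq_lintegral_ofReal hi (Eventually.of_forall fun x => hnn n a x),
        integral_add (integrable_const 1) (hφint.const_mul _), integral_const_mul, hφ0]
      simp
    · have hi : Integrable (fun a => 1 + s n a * φ x) μ :=
        (integrable_const 1).add ((hsint n).mul_const _)
      rw [← ofReal_integral_eq_lintegral_ofReal hi (Eventually.of_forall fun a => hnn n a x),
        integral_add (integrable_const 1) ((hsint n).mul_const _), integral_mul_const, hs0]
      simp
  choose u hu using hplan
  have hdiff : ∀ n (F : D × D → ℝ), Measurable F → (∃ C, ∀ p, |F p| ≤ C) →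
      ∫ p, F p ∂((u n).plan : Measure (D × D)) = ∫ p, F p ∂(μ.prod μ) +
        ∫ a, s n a * ∫ x, φ x * F (a, x) ∂μ ∂μ := by
    intro n F hF ⟨C, hC⟩
    have hFi : Integrable F (μ.prod μ) :=
      Integrable.of_bound hF.aestronglyMeasurable C (Eventually.of_forall hC)
    have hFi' : Integrable (fun p => (s n p.1 * φ p.2) * F p) (μ.prod μ) :=
      Integrable.of_bound ((hρm n).mul hF).aestronglyMeasurable (1 * C)
        (Eventually.of_forall fun p => by
          rw [norm_mul]
          exact mul_le_mul (hsφ n _ _) (hC p) (norm_nonneg _) zero_le_one)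
    rw [hu, integral_withDensity_eq_integral_toReal_smul
      ((hρm n).const_add 1).ennreal_ofReal (Eventually.of_forall fun p => ENNReal.ofReal_lt_top)]
    have h1 : ∀ p : D × D, (ENNReal.ofReal (1 + s n p.1 * φ p.2)).toReal • F p =
        F p + (s n p.1 * φ p.2) * F p := fun p => by
      rw [ENNReal.toReal_ofReal (hnn n _ _), smul_eq_mul]; ring
    simp only [h1]
    rw [integral_add hFi hFi', integral_prod _ hFi']
    simp only [mul_assoc, integral_const_mul]
  -- The lower bound tests the plans against the perturbation `s n a * φ x` itself: the integrals
  -- differ by `∫ s n ^ 2 * ∫ φ ^ 2`, which is half of `∫ φ ^ 2` for every `n`.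
  refine ⟨u, MPPlan.product μ, (2 * (L : ℝ≥0∞) ^ 2)⁻¹ *
    ENNReal.ofReal |(1 / 2) * ∫ x, φ x ^ 2 ∂μ| ^ 2, ?_, ?_, fun n => ?_⟩
  · refine mul_ne_zero (ENNReal.inv_ne_zero.2 ?_) (pow_ne_zero _ ?_)
    · exact ENNReal.mul_ne_top (by simp) (ENNReal.pow_ne_top ENNReal.coe_ne_top)
    · have : 0 < |(1 / 2) * ∫ x, φ x ^ 2 ∂μ| := abs_pos.2 (by positivity)
      simpa using this
  · rw [ProbabilityMeasure.tendsto_iff_forall_integral_tendsto]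
    intro F
    have hFm : Measurable F := F.continuous.measurable
    have hFb : ∀ p, |F p| ≤ ‖F‖ := fun p => F.norm_coe_le_norm p
    simp only [fun n => hdiff n F hFm ⟨_, hFb⟩]
    -- For a fixed `F`, integration in `x` leaves a bounded function of the label, against which `s
    -- n` tends weakly to zero.
    have hG : Tendsto (fun n => ∫ a, s n a * ∫ x, φ x * F (a, x) ∂μ ∂μ) atTop (𝓝 0) := by
      refine hslim _ ?_ ⟨‖F‖, fun a => ?_⟩
      · have : StronglyMeasurable fun p : D × D => φ p.2 * F p :=
          ((hφm.comp measurable_snd).mul hFm).stronglyMeasurable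
        exact (this.integral_prod_right' (ν := μ)).measurable
      · have := norm_integral_le_of_norm_le_const (μ := μ) (f := fun x => φ x * F (a, x))
          (C := ‖F‖) (Eventually.of_forall fun x => by
            rw [norm_mul]
            exact (mul_le_of_le_one_left (norm_nonneg _) (hφ1 x)).trans (hFb _))
        simpa using this
    have h0 : Tendsto (fun _ : ℕ => ∫ p, F p ∂(μ.prod μ)) atTop (𝓝 (∫ p, F p ∂(μ.prod μ))) :=
      tendsto_const_nhds
    have h1 := h0.add hG
    rw [add_zero] at h1
    exact h1
  · have hb : ∀ p : D × D, |s n p.1 * φ p.2| ≤ 1 := fun p => hsφ n _ _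
    have h1 := sq_integral_sub_le_relaxedCost (u n) (MPPlan.product μ) (hρm n) hb hL0
      (fun a x y => by
        rw [← mul_sub, abs_mul]
        refine (mul_le_of_le_one_left (abs_nonneg _) (hs1 n a)).trans ?_
        rw [← Real.dist_eq]
        exact hL.dist_le_mul x y)
    have h2 : ∫ a, s n a * ∫ x, φ x * (s n a * φ x) ∂μ ∂μ = (1 / 2) * ∫ x, φ x ^ 2 ∂μ := by
      have : ∀ a, s n a * ∫ x, φ x * (s n a * φ x) ∂μ = s n a ^ 2 * ∫ x, φ x ^ 2 ∂μ := by
        intro a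
        rw [← integral_const_mul, ← integral_const_mul]
        refine integral_congr_ae (Eventually.of_forall fun x => ?_)
        simp only
        ring
      simp only [this]
      rw [integral_mul_const, hs2]
    rw [hdiff n _ (hρm n) ⟨1, hb⟩, h2] at h1
    change ENNReal.ofReal |_ - ∫ p, s n p.1 * φ p.2 ∂(μ.prod μ)| ^ 2 ≤ _ at h1
    rw [add_sub_cancel_left] at h1
    have hL2 : 2 * (L : ℝ≥0∞) ^ 2 ≠ 0 := by simpa using hL0
    have hL2t : 2 * (L : ℝ≥0∞) ^ 2 ≠ ⊤ :=
      ENNReal.mul_ne_top (by simp) (ENNReal.pow_ne_top ENNReal.coe_ne_top)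
    rw [mul_comm, ← div_eq_mul_inv, ENNReal.div_le_iff hL2 hL2t,
      mul_comm (relaxedCost _ _)]
    exact h1

end

/-! ### The metric structure and the final assembly. -/

section

variable {D : Type*} [MetricSpace D] [CompactSpace D] [Nonempty D] [MeasurableSpace D]
  [BorelSpace D] {μ : Measure D}

/-- The metric space structure on the plans given by a finite relaxed distance. -/
@[reducible]
noncomputable def MPPlan.metricSpace (h : ∀ η γ : MPPlan μ, relaxedDist η γ ≠ ⊤) :
    MetricSpace (MPPlan μ) :=
  letI : EMetricSpace (MPPlan μ) :=
    { edist := relaxedDist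
      edist_self := relaxedDist_self
      edist_comm := relaxedDist_comm
      edist_triangle := relaxedDist_triangle
      eq_of_edist_eq_zero := eq_of_relaxedDist_eq_zero }
  EMetricSpace.toMetricSpace h

end

theorem proposition3p3 {d : ℕ} (hd : 1 ≤ d) {D : Type*} [MetricSpace D] [CompactSpace D]
    [Nonempty D] [MeasurableSpace D] [BorelSpace D] (μ : Measure D)
    (hD : IsFluidDomain d D μ) :
    -- the relaxed distance is a (finite) metric on `Γ(D)`
    ∃ m : MetricSpace (MPPlan μ),
      (∀ η γ : MPPlan μ, edist η γ = relaxedDist η γ) ∧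
      -- it is complete
      CompleteSpace (MPPlan μ) ∧
      -- it is bounded from below by the Wasserstein distance
      (∀ η γ : MPPlan μ, wasserstein₂ η.plan γ.plan ≤ relaxedDist η γ) ∧
      -- its convergence implies narrow convergence
      (∀ (u : ℕ → MPPlan μ) (γ : MPPlan μ), Tendsto u atTop (𝓝 γ) →
        Tendsto (fun n => (u n).plan) atTop (𝓝 γ.plan)) ∧
      -- it is right invariant
      (∀ (h : D → D) (hh : IsEssInjMeasurePreserving μ h) (η γ : MPPlan μ),
        dist (η.rightComp h hh.measurePreserving) (γ.rightComp h hh.measurePreserving) =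
          dist η γ) ∧
      -- its convergence is strictly stronger than narrow convergence
      (∃ (u : ℕ → MPPlan μ) (γ : MPPlan μ),
        Tendsto (fun n => (u n).plan) atTop (𝓝 γ.plan) ∧ ¬ Tendsto u atTop (𝓝 γ)) ∧
      ¬ CompactSpace (MPPlan μ) := by
  obtain ⟨hprob, hatom, B, hB, hfin⟩ := hD.exists_relaxedDist_le hd
  let m : MetricSpace (MPPlan μ) :=
    MPPlan.metricSpace fun η γ => ((hfin η γ).trans_lt hB.lt_top).ne
  have hed : ∀ η γ : MPPlan μ, edist η γ = relaxedDist η γ := fun η γ => rfl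
  have hnarrow : ∀ (u : ℕ → MPPlan μ) (γ : MPPlan μ), Tendsto u atTop (𝓝 γ) →
      Tendsto (fun n => (u n).plan) atTop (𝓝 γ.plan) := fun u γ h =>
    tendsto_plan_of_relaxedDist (tendsto_iff_edist_tendsto_0.1 h)
  obtain ⟨u, γ, c, hc, hu, hcu⟩ := exists_tendsto_plan_of_le_relaxedCost μ
  -- The lower bound on the cost is uniform in `n`, so no subsequence converges to `γ`; this serves
  -- both negative statements.
  have hsub : ∀ σ : ℕ → ℕ, ¬ Tendsto (u ∘ σ) atTop (𝓝 γ) := fun σ h => by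
    have h1 : Tendsto (fun n => relaxedDist (u (σ n)) γ) atTop (𝓝 0) :=
      tendsto_iff_edist_tendsto_0.1 h
    have h2 := ENNReal.Tendsto.pow (n := 2) h1
    simp only [relaxedDist_sq, ne_eq, OfNat.ofNat_ne_zero, not_false_eq_true, zero_pow] at h2
    exact hc (le_antisymm (ge_of_tendsto' h2 fun n => hcu (σ n)) zero_le)
  refine ⟨m, hed, ?_, wasserstein₂_le_relaxedDist, hnarrow, ?_, ⟨u, γ, hu, hsub id⟩, ?_⟩
  · refine EMetric.complete_of_convergent_controlled_sequences
      (fun n => ENNReal.ofReal ((1 / 2) ^ n)) (fun n => by simp) fun v hv => ?_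
    obtain ⟨θ, hθ⟩ := exists_relaxedDist_le_of_cauchy (u := v)
      (B := fun n => ENNReal.ofReal ((1 / 2) ^ n)) fun N n k hn hk => (hv N n k hn hk).le
    refine ⟨θ, tendsto_iff_edist_tendsto_0.2 ?_⟩
    have h0 : Tendsto (fun n : ℕ => ENNReal.ofReal ((1 / 2) ^ n)) atTop (𝓝 0) := by
      rw [← ENNReal.ofReal_zero]
      exact ENNReal.tendsto_ofReal
        (tendsto_pow_atTop_nhds_zero_of_lt_one (by norm_num) (by norm_num))
    exact tendsto_of_tendsto_of_tendsto_of_le_of_le tendsto_const_nhds h0 (fun n => zero_le)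
      fun n => hθ n n le_rfl
  · intro h hh η γ
    rw [dist_edist, dist_edist, hed, hed, relaxedDist_rightComp]
  · intro hcomp
    obtain ⟨θ, -, σ, hσ, hlim⟩ := isCompact_univ.tendsto_subseq fun n => Set.mem_univ (u n)
    -- A limit for the distance is also a narrow limit, so it could only be `γ`.
    have h1 := hnarrow _ _ hlim
    have h2 : Tendsto (fun n => (u (σ n)).plan) atTop (𝓝 γ.plan) := hu.comp hσ.tendsto_atTop
    have h3 : θ = γ := MPPlan.ext (tendsto_nhds_unique h1 h2)
    exact hsub σ (h3 ▸ hlim)
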